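/- Let $\mathbb H=\{z\in\mathbb C:\operatorname{Im} z>0\}$ and let $k_x,k_y\ge 0$. A Borel measure $\mu$ on $\mathbb H$ is called well-projected with constants $k_x,k_y$, written $\mu\in W(k_x,k_y)$, if $\mu(A)\le k_x|A_x|+k_y|A_y|$ for every Borel set $A\subset\mathbb H$ for which the right-hand side is finite; here $|A_x|$ and $|A_y|$ are the Lebesgue measures of the projections of $A$ to the real and imaginary axes. For $z=x+iy\in\mathbb H$ and $u:\mathbb R\to\mathbb C$ consider the Poisson integral and the Cauchy integral $$\mathcal P u(z)=\int_{\mathbb R}\frac1\pi\,\frac{y}{(x-t)^2+y^2}\,u(t)\,dt,\qquad \mathcal S u(z)=\int_{\mathbb R}\frac{i}{\pi}\,\frac{u(t)}{z-t}\,dt ,$$ and for $1<p<\infty$ put $$K_3(p,k_x,k_y)=\sup_{\mu\in W(k_x,k_y)}\|\mathcal P\|_{L^p(\mathbb R)\to L^p(d\mu)},\qquad K_4(p,k_x,k_y)=\sup_{\mu\in W(k_x,k_y)}\|\mathcal S\|_{L^p(\mathbb R)\to L^p(d\mu)} .$$ Theorem. Let $1<p<\infty$ and $1/p+1/p'=1$.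 For every $u\in L^p(\mathbb R)$ the integral $\mathcal S u(z)$ converges absolutely at every $z\in\mathbb H$. For every $\mu\in W(k_x,k_y)$ the operator $\mathcal S$ is bounded and linear from $L^p(\mathbb R)$ to $L^p(d\mu)$. Its norm is bounded uniformly in $\mu$: $K_4(p,k_x,k_y)<\infty$ and $$K_4(p,k_x,k_y)\le K_3(p,k_x,k_y)\left(1+\tan\left(\frac{\pi}{2}\max\left(\frac1p,\frac1{p'}\right)\right)\right).$$ In particular, for $p=2$, $K_4(2,k_x,k_y)\le 4\sqrt{6k_x+k_y}$. -/

import Mathlib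

open MeasureTheory
open scoped NNReal ENNReal

noncomputable section

/-- The open upper half-plane `{z : Im z > 0}` as a subset of `ℂ`. -/
def upperHalf : Set ℂ := {z : ℂ | 0 < z.im}

/-- `μ` is a Borel measure on `D` (a measure on `ℂ` that does not charge the complement of `D`)
that is well-projected with constants `kx`, `ky`: the measure of a Borel subset `A` of `D` is at
most `kx |A_x| + ky |A_y|`, where `A_x`, `A_y` are the projections of `A` to the coordinate axes.
The inequality is in `[0, ∞]`, so it says nothing when the right-hand side is infinite. -/
structure WellProjected (D : Set ℂ) (kx ky : ℝ≥0) (μ : Measure ℂ) : Prop where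
  compl_null : μ Dᶜ = 0
  le_proj : ∀ A : Set ℂ, A ⊆ D → MeasurableSet A →
    μ A ≤ (kx : ℝ≥0∞) * volume (Complex.re '' A) + (ky : ℝ≥0∞) * volume (Complex.im '' A)

/-- The Poisson kernel `P(x, y) = π⁻¹ y / (x² + y²)`. -/
def poissonKernelR (x y : ℝ) : ℝ := 1 / Real.pi * (y / (x ^ 2 + y ^ 2))

/-- The Cauchy kernel `S(x, y) = (i / π) / (x + i y)`. -/
def cauchyKernel (x y : ℝ) : ℂ :=
  Complex.I / (Real.pi : ℂ) * (1 / ((x : ℂ) + Complex.I * (y : ℂ)))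

/-- The Poisson integral of `u` at `z = x + i y`. -/
def poissonInt (u : ℝ → ℂ) (z : ℂ) : ℂ :=
  ∫ t : ℝ, (poissonKernelR (z.re - t) z.im : ℂ) * u t

/-- The Cauchy integral of `u` at `z = x + i y`. -/
def cauchyInt (u : ℝ → ℂ) (z : ℂ) : ℂ :=
  ∫ t : ℝ, cauchyKernel (z.re - t) z.im * u t

/-- The norm, in `[0, ∞]`, of an operator `T` from (complex) `L^p(ℝ)` to `L^p(μ)`: the least `C`
such that `T u ∈ L^p(μ)` and `‖T u‖ ≤ C ‖u‖` for all `u ∈ L^p(ℝ)`, and `∞` if there is no finite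
such `C`. -/
def lpOpNorm (T : (ℝ → ℂ) → ℂ → ℂ) (p : ℝ) (μ : Measure ℂ) : ℝ≥0∞ :=
  ⨅ (C : ℝ≥0) (_ : ∀ u : ℝ → ℂ, MemLp u (ENNReal.ofReal p) volume →
    MemLp (T u) (ENNReal.ofReal p) μ ∧
      eLpNorm (T u) (ENNReal.ofReal p) μ
        ≤ (C : ℝ≥0∞) * eLpNorm u (ENNReal.ofReal p) volume), (C : ℝ≥0∞)

/-- The supremum of the norms of the Poisson integral `L^p(ℝ) → L^p(μ)` over all measures `μ` on
the upper half-plane that are well-projected with constants `kx`, `ky`. -/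
def K₃ (p : ℝ) (kx ky : ℝ≥0) : ℝ≥0∞ :=
  ⨆ (μ : Measure ℂ) (_ : WellProjected upperHalf kx ky μ), lpOpNorm poissonInt p μ

/-- The same supremum for the Cauchy integral. -/
def K₄ (p : ℝ) (kx ky : ℝ≥0) : ℝ≥0∞ :=
  ⨆ (μ : Measure ℂ) (_ : WellProjected upperHalf kx ky μ), lpOpNorm cauchyInt p μ

end

/-!
The Cauchy kernel is `S = P + i Q` with the Poisson kernel `P` and the conjugate Poisson kernel `Q`.
The Hilbert transform is never formed; it is replaced by the operators `u ↦ Q_y * u`, `y > 0`, that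
is, by the imaginary parts of Cauchy integrals on horizontal lines.

*Reduction to horizontal lines.* By the Poisson formula, `P_y * S_ε = S_{y + ε}`, so for compactly
supported `u` the function `z ↦ S u (z + i ε)` is the Poisson integral of `S_ε * u`
(`cauchyInt_add_eq_poissonInt`). Its norm in `L^p(μ)` is therefore at most the norm of the Poisson
integral times `‖S_ε * u‖ ≤ ‖P_ε * u‖ + ‖Q_ε * u‖`. Fatou's lemma lets `ε` tend to `0`, and, a
second time, extends the estimate from functions with compact support to `L^p`.

*The theorem of Pichorides* (`eLpNorm_conjPoissonInt_le`). For `1 < p ≤ 2` and real `u` let `F` be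
the Cauchy integral of `u`. The function `G(x + i y) = Re (|x| + i y) ^ p` is subharmonic and
satisfies `|y| ^ p ≤ tan (π / (2 p)) ^ p * |x| ^ p - B * G(x + i y)` with `B > 0`
(`abs_rpow_le_pichorides`). The integral of `G ∘ F` over the line at height `y` is a convex function
of `y` that tends to `0` at infinity, hence nonnegative; this is carried out for the smooth
subharmonic functions `Re (√(x² + δ²) + i y) ^ p`, whose second derivatives are computed explicitly
(`regPowDD_add_nonneg`, `HalfPlaneDecay.convexOn_integral_regPow_sub`), and `δ` tends to `0` by
domination. Complex `u` are treated by averaging over the real projections of `Q_y * u`, which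
does not change the constant, and `p > 2` by duality, since `Q` is odd.

*The Poisson integral* (`lintegral_poissonInt_rpow_le`). If the Poisson integral of `g ≥ 0` exceeds
`λ` at `z`, then some interval centred at `Re z` has `g`-average greater than `λ`, and
`Im z < λ⁻¹ ∫ g`. The Vitali covering lemma gives the weak type estimate
`μ {P g > λ} ≤ (6 kx + ky) λ⁻¹ ∫ g`. Applying it to `(g - λ / 2)₊` with `λ / 2` in place of `λ` and
integrating over `λ` gives
`‖P u‖ ^ p ≤ (6 kx + ky) * 2 ^ p / (p - 1) * ‖u‖ ^ p`, which for `p = 2` is the constant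
`2 √(6 kx + ky)`.
-/

/-! ### The Poisson kernel as a probability density -/

lemma poissonKernelR_eq_cauchyPDFReal (x t : ℝ) {y : ℝ} (hy : 0 < y) :
    poissonKernelR (x - t) y = ProbabilityTheory.cauchyPDFReal x y.toNNReal t := by
  rw [ProbabilityTheory.cauchyPDFReal_def, Real.coe_toNNReal y hy.le, poissonKernelR, one_div,
    div_eq_mul_inv, ← mul_assoc, show (x - t) ^ 2 = (t - x) ^ 2 by ring]

lemma poissonKernelR_nonneg (x : ℝ) {y : ℝ} (hy : 0 ≤ y) : 0 ≤ poissonKernelR x y := by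
  unfold poissonKernelR; positivity

lemma lintegral_poissonKernelR (x : ℝ) {y : ℝ} (hy : 0 < y) :
    ∫⁻ t, ENNReal.ofReal (poissonKernelR (x - t) y) = 1 := by
  simp_rw [poissonKernelR_eq_cauchyPDFReal x _ hy]
  exact ProbabilityTheory.lintegral_cauchyPDF_eq_one x (by simpa using hy)

lemma integrable_poissonKernelR (x : ℝ) {y : ℝ} (hy : 0 < y) :
    Integrable (fun t => poissonKernelR (x - t) y) := by
  simp_rw [poissonKernelR_eq_cauchyPDFReal x _ hy]
  exact ProbabilityTheory.integrable_cauchyPDFReal x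

@[fun_prop]
lemma Measurable.poissonKernelR {α : Type*} [MeasurableSpace α] {f g : α → ℝ}
    (hf : Measurable f) (hg : Measurable g) : Measurable fun a => poissonKernelR (f a) (g a) := by
  unfold _root_.poissonKernelR; fun_prop

lemma poissonKernelR_le (x : ℝ) {y : ℝ} (hy : 0 < y) : poissonKernelR x y ≤ 1 / y := by
  unfold poissonKernelR
  have h1 : 1 / Real.pi ≤ 1 := by
    rw [div_le_one Real.pi_pos]; linarith [Real.pi_gt_three]
  have h2 : y / (x ^ 2 + y ^ 2) ≤ 1 / y := by
    rw [div_le_div_iff₀ (by positivity) hy]; nlinarith [sq_nonneg x]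
  calc _ ≤ 1 * (y / (x ^ 2 + y ^ 2)) := by gcongr
    _ ≤ _ := by rwa [one_mul]

/-! ### Poisson integrals and averages over intervals -/

lemma poissonKernelR_superlevel (x s : ℝ) {y : ℝ} (hy : 0 < y) (hs : 0 < s) :
    {t | s < poissonKernelR (x - t) y} = ∅ ∨
      ∃ r > 0, {t | s < poissonKernelR (x - t) y} = Metric.ball x r := by
  have key : ∀ t, s < poissonKernelR (x - t) y ↔ (t - x) ^ 2 < y / (Real.pi * s) - y ^ 2 := by
    intro t
    have hpi := Real.pi_pos
    unfold poissonKernelR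
    rw [lt_sub_iff_add_lt, lt_div_iff₀ (by positivity), one_div, ← div_eq_inv_mul, div_div,
      lt_div_iff₀ (by positivity)]
    constructor <;> intro h <;> nlinarith
  by_cases hc : y / (Real.pi * s) - y ^ 2 ≤ 0
  · left
    ext t
    simp only [Set.mem_ofPred_eq, key, Set.mem_empty_iff_false, iff_false, not_lt]
    exact hc.trans (sq_nonneg _)
  · right
    push Not at hc
    refine ⟨√(y / (Real.pi * s) - y ^ 2), Real.sqrt_pos.2 hc, ?_⟩
    ext t
    rw [Set.mem_ofPred_eq, key, Metric.mem_ball, Real.dist_eq, Real.lt_sqrt (abs_nonneg _), sq_abs]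

/-- The superlevel sets of the Poisson kernel are intervals centred at `x`, so by the layer cake
formula a Poisson integral is at most the supremum of the averages over centred intervals. -/
lemma lintegral_poissonKernelR_le_of_ball_le {ν : Measure ℝ} {lam : ℝ≥0∞} (x : ℝ) {y : ℝ}
    (hy : 0 < y) (h : ∀ r > 0, ν (Metric.ball x r) ≤ lam * volume (Metric.ball x r)) :
    ∫⁻ t, ENNReal.ofReal (poissonKernelR (x - t) y) ∂ν ≤ lam := by
  have hm : Measurable fun t => poissonKernelR (x - t) y := by fun_prop
  have hnn : ∀ t, 0 ≤ poissonKernelR (x - t) y := fun t => poissonKernelR_nonneg _ hy.le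
  rw [lintegral_eq_lintegral_meas_lt ν (Filter.Eventually.of_forall hnn) hm.aemeasurable]
  calc _ ≤ ∫⁻ s in Set.Ioi (0 : ℝ), lam * volume {t | s < poissonKernelR (x - t) y} := by
        refine setLIntegral_mono' measurableSet_Ioi fun s hs => ?_
        rcases poissonKernelR_superlevel x s hy hs with h0 | ⟨r, hr, h0⟩
        · simp [h0]
        · rw [h0]; exact h r hr
    _ = lam * ∫⁻ s in Set.Ioi (0 : ℝ), volume {t | s < poissonKernelR (x - t) y} := by
        refine lintegral_const_mul _ ?_
        exact Antitone.measurable fun a b hab => measure_mono fun t ht => lt_of_le_of_lt hab ht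
    _ = lam := by
        rw [← lintegral_eq_lintegral_meas_lt volume (Filter.Eventually.of_forall hnn)
          hm.aemeasurable, lintegral_poissonKernelR x hy, mul_one]

/-- The weak type estimate for the centred maximal function, from the Vitali covering lemma. -/
lemma volume_setOf_exists_ball_gt_le {ν : Measure ℝ} {lam : ℝ≥0∞} (hlam : lam ≠ 0)
    (hlam' : lam ≠ ∞) (hν : ν Set.univ ≠ ∞) :
    volume {x : ℝ | ∃ r > 0, lam * volume (Metric.ball x r) < ν (Metric.ball x r)}
      ≤ 6 * ν Set.univ / lam := by
  set E := {x : ℝ | ∃ r > 0, lam * volume (Metric.ball x r) < ν (Metric.ball x r)} with hE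
  have hex : ∀ x : E, ∃ r > 0, lam * volume (Metric.ball x.1 r) < ν (Metric.ball x.1 r) :=
    fun x => x.2
  choose r hr0 hr using hex
  have hr' : ∀ x : E, ENNReal.ofReal (2 * r x) ≤ ν (Metric.closedBall x.1 (r x)) / lam := by
    intro x
    rw [ENNReal.le_div_iff_mul_le (Or.inl hlam) (Or.inl hlam'), mul_comm]
    have := hr x
    rw [Real.volume_ball] at this
    exact this.le.trans (measure_mono Metric.ball_subset_closedBall)
  have hbd : ∀ x ∈ (Set.univ : Set E), r x ≤ (ν Set.univ / lam).toReal := by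
    intro x _
    have h1 : ENNReal.ofReal (2 * r x) ≤ ν Set.univ / lam :=
      (hr' x).trans (ENNReal.div_le_div_right (measure_mono (Set.subset_univ _)) _)
    have h2 := ENNReal.toReal_mono (ENNReal.div_ne_top hν hlam) h1
    rw [ENNReal.toReal_ofReal (by linarith [hr0 x])] at h2
    linarith [hr0 x]
  obtain ⟨u, -, hu, hcov⟩ := Vitali.exists_disjoint_subfamily_covering_enlargement_closedBall
    (Set.univ : Set E) (fun x => x.1) r _ hbd 6 (by norm_num)
  have hucount : u.Countable := by
    refine Set.PairwiseDisjoint.countable_of_nonempty_interior hu fun x _ => ?_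
    exact ⟨x.1, Metric.ball_subset_interior_closedBall (Metric.mem_ball_self (hr0 x))⟩
  have hsub : E ⊆ ⋃ b ∈ u, Metric.closedBall b.1 (6 * r b) := by
    intro x hx
    obtain ⟨b, hb, hxb⟩ := hcov ⟨x, hx⟩ trivial
    exact Set.mem_biUnion hb (hxb (Metric.mem_closedBall_self (hr0 _).le))
  have := hucount.to_subtype
  calc volume E ≤ volume (⋃ b ∈ u, Metric.closedBall b.1 (6 * r b)) := measure_mono hsub
    _ ≤ ∑' b : u, volume (Metric.closedBall b.1.1 (6 * r b.1)) := by
        rw [Set.biUnion_eq_iUnion]; exact measure_iUnion_le _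
    _ ≤ ∑' b : u, 6 * (ν (Metric.closedBall b.1.1 (r b.1)) / lam) := by
        refine ENNReal.tsum_le_tsum fun b => ?_
        rw [Real.volume_closedBall, show 2 * (6 * r b.1) = 6 * (2 * r b.1) by ring,
          ENNReal.ofReal_mul (by norm_num), ENNReal.ofReal_ofNat]
        gcongr
        exact hr' b.1
    _ = 6 * (ν (⋃ b ∈ u, Metric.closedBall b.1 (r b)) / lam) := by
        rw [ENNReal.tsum_mul_left, measure_biUnion hucount hu
          (fun b _ => Metric.isClosed_closedBall.measurableSet)]
        simp_rw [div_eq_mul_inv]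
        rw [ENNReal.tsum_mul_right]
    _ ≤ 6 * ν Set.univ / lam := by
        rw [mul_div_assoc]; gcongr; exact Set.subset_univ _

/-! ### The Carleson embedding for well-projected measures -/

/-- The Poisson integral of a nonnegative function, with values in `[0, ∞]`. -/
noncomputable def poissonLInt (g : ℝ → ℝ≥0∞) (z : ℂ) : ℝ≥0∞ :=
  ∫⁻ t, ENNReal.ofReal (poissonKernelR (z.re - t) z.im) * g t

lemma measurable_poissonLInt {g : ℝ → ℝ≥0∞} (hg : Measurable g) : Measurable (poissonLInt g) := by
  refine Measurable.lintegral_prod_right (f := fun (z : ℂ) (t : ℝ) =>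
    ENNReal.ofReal (poissonKernelR (z.re - t) z.im) * g t) ?_
  have h1 : Measurable fun a : ℂ × ℝ => a.1.re - a.2 :=
    (Complex.measurable_re.comp measurable_fst).sub measurable_snd
  have h2 : Measurable fun a : ℂ × ℝ => a.1.im := Complex.measurable_im.comp measurable_fst
  exact (h1.poissonKernelR h2).ennreal_ofReal.mul (hg.comp measurable_snd)

lemma measurableSet_upperHalf : MeasurableSet upperHalf :=
  measurableSet_lt measurable_const Complex.measurable_im

lemma enorm_poissonInt_le (u : ℝ → ℂ) {z : ℂ} (hz : z ∈ upperHalf) :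
    ‖poissonInt u z‖ₑ ≤ poissonLInt (fun t => ‖u t‖ₑ) z := by
  refine (enorm_integral_le_lintegral_enorm _).trans (lintegral_mono fun t => ?_)
  rw [enorm_mul]
  gcongr
  rw [← ofReal_norm, Complex.norm_real, Real.norm_of_nonneg]
  exact poissonKernelR_nonneg _ (le_of_lt hz)

/-- The weak type `(1, 1)` estimate for the Poisson integral: the projections of a superlevel set
are controlled by the centred maximal function on the real axis, and by the trivial bound
`P ≤ 1 / y` on the imaginary axis. -/
lemma measure_poissonLInt_gt_le {kx ky : ℝ≥0} {μ : Measure ℂ}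
    (hμ : WellProjected upperHalf kx ky μ) {g : ℝ → ℝ≥0∞} (hg : Measurable g) {lam : ℝ≥0∞}
    (hlam : lam ≠ 0) (hlam' : lam ≠ ∞) :
    μ {z | z ∈ upperHalf ∧ lam < poissonLInt g z} ≤ (6 * kx + ky) * ((∫⁻ t, g t) / lam) := by
  by_cases htop : ∫⁻ t, g t = ∞
  · by_cases hk : (6 * kx + ky : ℝ≥0∞) = 0
    · have hk' : kx = 0 ∧ ky = 0 := by simpa using hk
      have h0 := hμ.le_proj _ (fun z hz => hz.1 : {z | z ∈ upperHalf ∧ lam < poissonLInt g z} ⊆ _)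
        (measurableSet_upperHalf.inter (measurableSet_lt measurable_const
          (measurable_poissonLInt hg)))
      simpa [hk'.1, hk'.2] using h0
    · rw [htop, ENNReal.top_div_of_ne_top hlam', ENNReal.mul_top hk]; exact le_top
  set A := {z | z ∈ upperHalf ∧ lam < poissonLInt g z} with hA
  set ν := volume.withDensity g with hν
  have hνu : ν Set.univ = ∫⁻ t, g t := by simp [hν]
  have hP : ∀ z, poissonLInt g z = ∫⁻ t, ENNReal.ofReal (poissonKernelR (z.re - t) z.im) ∂ν := by
    intro z
    rw [hν, lintegral_withDensity_eq_lintegral_mul _ hg (by fun_prop)]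
    simp only [poissonLInt, Pi.mul_apply, mul_comm]
  have hx : volume (Complex.re '' A) ≤ 6 * ((∫⁻ t, g t) / lam) := by
    rw [← mul_div_assoc, ← hνu]
    refine (measure_mono ?_).trans (volume_setOf_exists_ball_gt_le hlam hlam' (by rwa [hνu]))
    rintro _ ⟨z, ⟨hz, hz'⟩, rfl⟩
    by_contra hcon
    simp only [Set.mem_ofPred_eq, not_exists, not_and, not_lt] at hcon
    rw [hP] at hz'
    exact absurd (lintegral_poissonKernelR_le_of_ball_le z.re hz hcon) (not_le.2 hz')
  have hy : volume (Complex.im '' A) ≤ (∫⁻ t, g t) / lam := by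
    have hfin : (∫⁻ t, g t) / lam ≠ ∞ := ENNReal.div_ne_top htop hlam
    calc volume (Complex.im '' A) ≤ volume (Set.Ioc 0 ((∫⁻ t, g t) / lam).toReal) := by
          refine measure_mono ?_
          rintro _ ⟨z, ⟨hz, hz'⟩, rfl⟩
          refine ⟨hz, ?_⟩
          rw [← ENNReal.ofReal_le_iff_le_toReal hfin,
            ENNReal.le_div_iff_mul_le (Or.inl hlam) (Or.inl hlam')]
          have hzi : (0 : ℝ) < z.im := hz
          have h1 : poissonLInt g z ≤ ENNReal.ofReal (1 / z.im) * ∫⁻ t, g t := by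
            rw [← lintegral_const_mul _ hg]
            refine lintegral_mono fun t => ?_
            gcongr
            exact poissonKernelR_le _ hzi
          calc ENNReal.ofReal z.im * lam
              ≤ ENNReal.ofReal z.im * (ENNReal.ofReal (1 / z.im) * ∫⁻ t, g t) := by
                gcongr; exact hz'.le.trans h1
            _ = ∫⁻ t, g t := by
                rw [← mul_assoc, ← ENNReal.ofReal_mul hzi.le, mul_one_div_cancel hzi.ne']
                simp
      _ = _ := by rw [Real.volume_Ioc, sub_zero, ENNReal.ofReal_toReal hfin]
  calc μ A ≤ kx * volume (Complex.re '' A) + ky * volume (Complex.im '' A) :=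
        hμ.le_proj A (fun z hz => hz.1) (measurableSet_upperHalf.inter
          (measurableSet_lt measurable_const (measurable_poissonLInt hg)))
    _ ≤ kx * (6 * ((∫⁻ t, g t) / lam)) + ky * ((∫⁻ t, g t) / lam) := by gcongr
    _ = _ := by ring

/-- Truncation at height `lam / 2` improves the weak type estimate: the truncated part of `g` has
Poisson integral at most `lam / 2`. -/
lemma measure_poissonLInt_gt_le_truncate {kx ky : ℝ≥0} {μ : Measure ℂ}
    (hμ : WellProjected upperHalf kx ky μ) {g : ℝ → ℝ≥0∞} (hg : Measurable g) {lam : ℝ}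
    (hlam : 0 < lam) :
    μ {z | z ∈ upperHalf ∧ ENNReal.ofReal lam < poissonLInt g z} ≤
      (6 * kx + ky) * ((∫⁻ t, (g t - ENNReal.ofReal (lam / 2))) / ENNReal.ofReal (lam / 2)) := by
  refine (measure_mono ?_).trans (measure_poissonLInt_gt_le hμ
    (g := fun t => g t - ENNReal.ofReal (lam / 2)) (by fun_prop)
    (by simpa using hlam) ENNReal.ofReal_ne_top)
  rintro z ⟨hz, hz'⟩
  refine ⟨hz, ?_⟩
  by_contra hcon
  push Not at hcon
  refine absurd hz' (not_lt.2 ?_)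
  calc poissonLInt g z ≤ ∫⁻ t, (ENNReal.ofReal (poissonKernelR (z.re - t) z.im)
          * (g t - ENNReal.ofReal (lam / 2))
          + ENNReal.ofReal (poissonKernelR (z.re - t) z.im) * ENNReal.ofReal (lam / 2)) := by
        refine lintegral_mono fun t => ?_
        rw [← mul_add]
        gcongr
        exact le_tsub_add
    _ = poissonLInt (fun t => g t - ENNReal.ofReal (lam / 2)) z + ENNReal.ofReal (lam / 2) := by
        rw [lintegral_add_left (by fun_prop), lintegral_mul_const _ (by fun_prop),
          lintegral_poissonKernelR _ hz, one_mul, poissonLInt]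
    _ ≤ ENNReal.ofReal (lam / 2) + ENNReal.ofReal (lam / 2) := by gcongr
    _ = ENNReal.ofReal lam := by
        rw [← ENNReal.ofReal_add (by positivity) (by positivity)]; congr 1; ring

lemma stronglyMeasurable_poissonInt {u : ℝ → ℂ} (hu : StronglyMeasurable u) :
    StronglyMeasurable (poissonInt u) := by
  refine StronglyMeasurable.integral_prod_right (f := fun (z : ℂ) (t : ℝ) =>
    (poissonKernelR (z.re - t) z.im : ℂ) * u t) ?_
  have h1 : Measurable fun a : ℂ × ℝ => a.1.re - a.2 :=
    (Complex.measurable_re.comp measurable_fst).sub measurable_snd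
  have h2 : Measurable fun a : ℂ × ℝ => a.1.im := Complex.measurable_im.comp measurable_fst
  have h3 : Measurable fun a : ℂ × ℝ => poissonKernelR (a.1.re - a.2) a.1.im :=
    h1.poissonKernelR h2
  exact (Complex.continuous_ofReal.measurable.comp h3).stronglyMeasurable.mul
    (hu.comp_measurable measurable_snd)

/-- The inner integral that appears when the truncated weak type estimate is integrated against
`d(lam ^ p)`. -/
lemma lintegral_truncate_mul_rpow {p : ℝ} (hp : 1 < p) {c : ℝ} (hc : 0 ≤ c) :
    ∫⁻ s in Set.Ioi (0 : ℝ), (ENNReal.ofReal c - ENNReal.ofReal (s / 2)) / ENNReal.ofReal (s / 2)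
        * ENNReal.ofReal (s ^ (p - 1))
      = ENNReal.ofReal ((2 * c) ^ p / (p * (p - 1))) := by
  have hp0 : 0 < p := by linarith
  have hp1 : 0 < p - 1 := by linarith
  set f : ℝ → ℝ := fun s => 2 * c * s ^ (p - 2) - s ^ (p - 1) with hf
  have hint : IntervalIntegrable f volume 0 (2 * c) :=
    ((intervalIntegral.intervalIntegrable_rpow' (by linarith)).const_mul _).sub
      (intervalIntegral.intervalIntegrable_rpow' (by linarith))
  have hcong : ∀ s ∈ Set.Ioi (0 : ℝ),
      (ENNReal.ofReal c - ENNReal.ofReal (s / 2)) / ENNReal.ofReal (s / 2)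
        * ENNReal.ofReal (s ^ (p - 1))
      = (Set.Ioc 0 (2 * c)).indicator (fun s => ENNReal.ofReal (f s)) s := by
    intro s hs
    have hs : 0 < s := hs
    by_cases hsc : s ≤ 2 * c
    · rw [Set.indicator_of_mem (Set.mem_Ioc.2 ⟨hs, hsc⟩), ← ENNReal.ofReal_sub _ (by positivity),
        ← ENNReal.ofReal_div_of_pos (by positivity), ← ENNReal.ofReal_mul]
      · congr 1
        have e1 : s ^ (p - 1) = s ^ (p - 2) * s := by
          rw [← Real.rpow_add_one hs.ne']; congr 1; ring
        simp only [hf, e1]; field_simp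
      · apply div_nonneg <;> linarith
    · rw [Set.indicator_of_notMem (fun h => hsc h.2), tsub_eq_zero_of_le]
      · simp
      · apply ENNReal.ofReal_le_ofReal; linarith
  rw [setLIntegral_congr_fun measurableSet_Ioi hcong, lintegral_indicator measurableSet_Ioc,
    Measure.restrict_restrict measurableSet_Ioc,
    Set.inter_eq_left.2 Set.Ioc_subset_Ioi_self]
  rw [← ofReal_integral_eq_lintegral_ofReal]
  · congr 1
    rw [← intervalIntegral.integral_of_le (by positivity)]
    simp only [hf]
    rw [intervalIntegral.integral_sub, intervalIntegral.integral_const_mul, integral_rpow,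
      integral_rpow, Real.zero_rpow, Real.zero_rpow]
    · rcases hc.eq_or_lt with rfl | hc'
      · simp only [mul_zero, zero_mul, sub_zero]
        rw [Real.zero_rpow (by linarith), Real.zero_rpow hp0.ne']; simp
      have e1 : (2 * c) ^ (p - 2 + 1) = (2 * c) ^ p / (2 * c) := by
        rw [← Real.rpow_sub_one (by positivity)]; congr 1; ring
      have e2 : p - 2 + 1 = p - 1 := by ring
      have e3 : p - 1 + 1 = p := by ring
      rw [e1, e2, e3]
      field_simp
      ring
    · linarith
    · linarith
    · left; linarith
    · left; linarith
    · exact (intervalIntegral.intervalIntegrable_rpow' (by linarith)).const_mul _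
    · exact intervalIntegral.intervalIntegrable_rpow' (by linarith)
  · exact (intervalIntegrable_iff_integrableOn_Ioc_of_le (by positivity)).1 hint
  · refine (ae_restrict_iff' measurableSet_Ioc).2 (Filter.Eventually.of_forall fun s hs => ?_)
    have e1 : s ^ (p - 1) = s ^ (p - 2) * s := by
      rw [← Real.rpow_add_one hs.1.ne']; congr 1; ring
    have : 0 ≤ s ^ (p - 2) * (2 * c - s) :=
      mul_nonneg (Real.rpow_nonneg hs.1.le _) (by linarith [hs.2])
    simp only [hf, e1, Pi.zero_apply]
    linarith

/-- The strong type estimate for the Poisson integral. -/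
lemma lintegral_poissonInt_rpow_le {kx ky : ℝ≥0} {μ : Measure ℂ}
    (hμ : WellProjected upperHalf kx ky μ) {u : ℝ → ℂ} (hu : StronglyMeasurable u) {p : ℝ}
    (hp : 1 < p) :
    ∫⁻ z, ENNReal.ofReal (‖poissonInt u z‖ ^ p) ∂μ ≤
      (6 * kx + ky) * ENNReal.ofReal (2 ^ p / (p - 1)) * ∫⁻ t, ENNReal.ofReal (‖u t‖ ^ p) := by
  have hp0 : 0 < p := by linarith
  have hp1 : 0 < p - 1 := by linarith
  have hg : Measurable fun t => ‖u t‖ₑ := hu.enorm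
  have hPm := (stronglyMeasurable_poissonInt hu).norm.measurable
  rw [lintegral_rpow_eq_lintegral_meas_lt_mul μ (Filter.Eventually.of_forall fun z => norm_nonneg _)
    hPm.aemeasurable hp0]
  have hslice : ∀ s ∈ Set.Ioi (0 : ℝ), μ {z | s < ‖poissonInt u z‖} * ENNReal.ofReal (s ^ (p - 1))
      ≤ (6 * kx + ky) * ∫⁻ t, (‖u t‖ₑ - ENNReal.ofReal (s / 2)) / ENNReal.ofReal (s / 2)
        * ENNReal.ofReal (s ^ (p - 1)) := by
    intro s hs
    have h1 : μ {z | s < ‖poissonInt u z‖} ≤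
        μ ({z | z ∈ upperHalf ∧ ENNReal.ofReal s < poissonLInt (fun t => ‖u t‖ₑ) z} ∪
          upperHalfᶜ) := by
      refine measure_mono fun z hz => ?_
      by_cases hz' : z ∈ upperHalf
      · refine Or.inl ⟨hz', lt_of_lt_of_le ?_ (enorm_poissonInt_le u hz')⟩
        rw [← ofReal_norm]
        exact (ENNReal.ofReal_lt_ofReal_iff_of_nonneg (le_of_lt hs)).2 hz
      · exact Or.inr hz'
    have h2 := (h1.trans (measure_union_le _ _)).trans
      (add_le_add (measure_poissonLInt_gt_le_truncate hμ hg hs) hμ.compl_null.le)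
    rw [add_zero] at h2
    refine (mul_le_mul_left h2 _).trans (le_of_eq ?_)
    rw [mul_assoc]
    congr 1
    simp_rw [div_eq_mul_inv]
    rw [lintegral_mul_const _ (by fun_prop), lintegral_mul_const _ (by fun_prop)]
  have hm : Measurable (Function.uncurry fun (s t : ℝ) =>
      (‖u t‖ₑ - ENNReal.ofReal (s / 2)) / ENNReal.ofReal (s / 2)
        * ENNReal.ofReal (s ^ (p - 1))) := by
    have h1 : Measurable fun a : ℝ × ℝ => ‖u a.2‖ₑ := hg.comp measurable_snd
    have h2 : Measurable fun a : ℝ × ℝ => ENNReal.ofReal (a.1 / 2) := by fun_prop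
    have h3 : Measurable fun a : ℝ × ℝ => ENNReal.ofReal (a.1 ^ (p - 1)) := by fun_prop
    exact ((h1.sub h2).div h2).mul h3
  calc _ ≤ ENNReal.ofReal p * ∫⁻ s in Set.Ioi (0 : ℝ), (6 * kx + ky) *
          ∫⁻ t, (‖u t‖ₑ - ENNReal.ofReal (s / 2)) / ENNReal.ofReal (s / 2)
        * ENNReal.ofReal (s ^ (p - 1)) := by
        exact mul_le_mul_right (setLIntegral_mono' measurableSet_Ioi hslice) _
    _ = ENNReal.ofReal p * ((6 * kx + ky) * ∫⁻ t, ∫⁻ s in Set.Ioi (0 : ℝ),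
          (‖u t‖ₑ - ENNReal.ofReal (s / 2)) / ENNReal.ofReal (s / 2)
        * ENNReal.ofReal (s ^ (p - 1))) := by
        rw [lintegral_const_mul _ hm.lintegral_prod_right, lintegral_lintegral_swap hm.aemeasurable]
    _ = ENNReal.ofReal p * ((6 * kx + ky) * ∫⁻ t,
          ENNReal.ofReal (2 ^ p / (p * (p - 1))) * ENNReal.ofReal (‖u t‖ ^ p)) := by
        congr 2
        refine lintegral_congr fun t => ?_
        rw [← ofReal_norm, lintegral_truncate_mul_rpow hp (norm_nonneg _),
          ← ENNReal.ofReal_mul (by positivity), Real.mul_rpow (by norm_num) (norm_nonneg _)]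
        congr 1; ring
    _ = _ := by
        rw [lintegral_const_mul _ (by have := hu.norm.measurable; fun_prop), ← mul_assoc,
          ← mul_assoc, mul_comm (ENNReal.ofReal p), mul_assoc _ (ENNReal.ofReal p),
          ← ENNReal.ofReal_mul hp0.le]
        congr 3
        field_simp

/-! ### The trigonometric inequality of Pichorides -/

/-- `φ ↦ sin (a φ) / (sin φ) ^ a` is increasing on `(0, π / 2)` for `0 < a ≤ 1`. -/
lemma monotoneOn_sin_mul_sin_rpow_neg {a : ℝ} (ha : 0 < a) (ha1 : a ≤ 1) :
    MonotoneOn (fun φ => Real.sin (a * φ) * Real.sin φ ^ (-a)) (Set.Ioo 0 (Real.pi / 2)) := by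
  have hder : ∀ φ ∈ Set.Ioo 0 (Real.pi / 2),
      HasDerivAt (fun φ => Real.sin (a * φ) * Real.sin φ ^ (-a))
        (a * Real.sin φ ^ (-a - 1) * Real.sin ((1 - a) * φ)) φ := by
    intro φ hφ
    have hs : 0 < Real.sin φ := Real.sin_pos_of_pos_of_lt_pi hφ.1 (by linarith [hφ.2, Real.pi_pos])
    have h1 : HasDerivAt (fun φ => Real.sin (a * φ)) (Real.cos (a * φ) * a) φ := by
      simpa using ((hasDerivAt_id φ).const_mul a).sin
    have h2 := (Real.hasDerivAt_sin φ).rpow_const (p := -a) (Or.inl hs.ne')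
    refine (h1.mul h2).congr_deriv ?_
    have e1 : Real.sin φ ^ (-a) = Real.sin φ ^ (-a - 1) * Real.sin φ := by
      rw [← Real.rpow_add_one hs.ne']; congr 1; ring
    have e2 : Real.sin ((1 - a) * φ)
        = Real.sin φ * Real.cos (a * φ) - Real.cos φ * Real.sin (a * φ) := by
      rw [← Real.sin_sub]; congr 1; ring
    rw [e1, e2]; ring
  refine monotoneOn_of_deriv_nonneg (convex_Ioo _ _)
    (fun φ hφ => (hder φ hφ).continuousAt.continuousWithinAt) ?_ ?_
  · rw [interior_Ioo]
    exact fun φ hφ => (hder φ hφ).differentiableAt.differentiableWithinAt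
  · rw [interior_Ioo]
    intro φ hφ
    rw [(hder φ hφ).deriv]
    have hs : 0 < Real.sin φ := Real.sin_pos_of_pos_of_lt_pi hφ.1 (by linarith [hφ.2, Real.pi_pos])
    have : 0 ≤ Real.sin ((1 - a) * φ) := Real.sin_nonneg_of_nonneg_of_le_pi
      (mul_nonneg (by linarith) hφ.1.le) (by nlinarith [hφ.1, hφ.2, Real.pi_pos])
    positivity

/-- The constant `(sin φ₀) ^ (p - 1) / sin ((p - 1) φ₀)` of the trigonometric inequality, with
`φ₀ = π / (2 p)`. -/
noncomputable def pichoridesConst (p : ℝ) : ℝ :=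
  (Real.sin ((p - 1) * (Real.pi / (2 * p))) * Real.sin (Real.pi / (2 * p)) ^ (-(p - 1)))⁻¹

lemma pi_div_two_mul_mem {p : ℝ} (hp : 1 < p) : Real.pi / (2 * p) ∈ Set.Ioo 0 (Real.pi / 2) := by
  have := Real.pi_pos
  refine ⟨by positivity, ?_⟩
  rw [div_lt_div_iff₀ (by positivity) (by norm_num)]
  nlinarith

lemma pichoridesConst_pos {p : ℝ} (hp : 1 < p) (hp2 : p ≤ 2) : 0 < pichoridesConst p := by
  have h := pi_div_two_mul_mem hp
  have hpi := Real.pi_pos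
  have hs : 0 < Real.sin (Real.pi / (2 * p)) :=
    Real.sin_pos_of_pos_of_lt_pi h.1 (by linarith [h.2])
  have hs' : 0 < Real.sin ((p - 1) * (Real.pi / (2 * p))) :=
    Real.sin_pos_of_pos_of_lt_pi (mul_pos (by linarith) h.1) (by nlinarith [h.1, h.2])
  unfold pichoridesConst; positivity

/-- The difference of the two sides, divided by `(cos φ) ^ p`, is minimal at `φ₀ = π / (2 p)`,
where it vanishes. -/
lemma sin_rpow_le_pichorides {p : ℝ} (hp : 1 < p) (hp2 : p ≤ 2) {φ : ℝ} (h0 : 0 ≤ φ)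
    (h1 : φ < Real.pi / 2) :
    Real.sin φ ^ p ≤ Real.tan (Real.pi / (2 * p)) ^ p * Real.cos φ ^ p
      - pichoridesConst p * Real.cos (p * φ) := by
  have hpi := Real.pi_pos
  set B := pichoridesConst p with hB
  set φ₀ := Real.pi / (2 * p) with hφ₀
  have hφ₀m : φ₀ ∈ Set.Ioo 0 (Real.pi / 2) := pi_div_two_mul_mem hp
  have hcos : ∀ ψ ∈ Set.Ico 0 (Real.pi / 2), 0 < Real.cos ψ := fun ψ hψ =>
    Real.cos_pos_of_mem_Ioo ⟨by linarith [hψ.1], hψ.2⟩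
  have hsin : ∀ ψ ∈ Set.Ioo 0 (Real.pi / 2), 0 < Real.sin ψ := fun ψ hψ =>
    Real.sin_pos_of_pos_of_lt_pi hψ.1 (by linarith [hψ.2])
  have hsin' : ∀ ψ ∈ Set.Ioo 0 (Real.pi / 2), 0 < Real.sin ((p - 1) * ψ) := fun ψ hψ =>
    Real.sin_pos_of_pos_of_lt_pi (mul_pos (by linarith) hψ.1) (by nlinarith [hψ.1, hψ.2])
  set K : ℝ → ℝ := fun ψ => (Real.sin ψ ^ p + B * Real.cos (p * ψ)) * Real.cos ψ ^ (-p) with hK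
  have hder : ∀ ψ ∈ Set.Ico 0 (Real.pi / 2), HasDerivAt K
      (p * Real.cos ψ ^ (-p - 1) * (Real.sin ψ ^ (p - 1) - B * Real.sin ((p - 1) * ψ))) ψ := by
    intro ψ hψ
    have hc := hcos ψ hψ
    have d1 := (Real.hasDerivAt_sin ψ).rpow_const (p := p) (Or.inr hp.le)
    have d2 : HasDerivAt (fun ψ => B * Real.cos (p * ψ)) (B * (-Real.sin (p * ψ) * p)) ψ := by
      simpa using (((hasDerivAt_id ψ).const_mul p).cos).const_mul B
    have d3 := (Real.hasDerivAt_cos ψ).rpow_const (p := -p) (Or.inl hc.ne')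
    refine ((d1.add d2).mul d3).congr_deriv ?_
    have e1 : Real.cos ψ ^ (-p) = Real.cos ψ ^ (-p - 1) * Real.cos ψ := by
      rw [← Real.rpow_add_one hc.ne']; congr 1; ring
    have hs0 : 0 ≤ Real.sin ψ := Real.sin_nonneg_of_nonneg_of_le_pi hψ.1 (by linarith [hψ.2])
    have e3 : Real.sin ψ ^ p = Real.sin ψ ^ (p - 1) * Real.sin ψ := by
      conv_lhs => rw [show p = (p - 1) + 1 by ring, Real.rpow_add_one' hs0 (by linarith)]
    have e2 : Real.sin ((p - 1) * ψ)
        = Real.sin (p * ψ) * Real.cos ψ - Real.cos (p * ψ) * Real.sin ψ := by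
      rw [← Real.sin_sub]; congr 1; ring
    have e4 := Real.sin_sq_add_cos_sq ψ
    simp only [Pi.add_apply]
    rw [e1, e2, e3]
    linear_combination (p * Real.cos ψ ^ (-p - 1) * Real.sin ψ ^ (p - 1)) * e4
  have hKφ₀ : K φ₀ = Real.tan φ₀ ^ p := by
    have hc := hcos φ₀ ⟨hφ₀m.1.le, hφ₀m.2⟩
    have : p * φ₀ = Real.pi / 2 := by rw [hφ₀]; field_simp
    simp only [hK]
    rw [this, Real.cos_pi_div_two, mul_zero, add_zero, Real.tan_eq_sin_div_cos,
      Real.div_rpow (hsin _ hφ₀m).le hc.le, Real.rpow_neg hc.le, div_eq_mul_inv]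
  -- the sign of the derivative of `K`, by monotonicity of `sin (a φ) / (sin φ) ^ a`
  have hsgn : ∀ ψ ∈ Set.Ioo 0 (Real.pi / 2),
      Real.sin ψ ^ (p - 1) - B * Real.sin ((p - 1) * ψ) = Real.sin ψ ^ (p - 1) * B *
        (Real.sin ((p - 1) * φ₀) * Real.sin φ₀ ^ (-(p - 1))
          - Real.sin ((p - 1) * ψ) * Real.sin ψ ^ (-(p - 1))) := by
    intro ψ hψ
    have e1 : B * (Real.sin ((p - 1) * φ₀) * Real.sin φ₀ ^ (-(p - 1))) = 1 := by
      rw [hB, pichoridesConst]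
      exact inv_mul_cancel₀ (mul_pos (hsin' _ hφ₀m) (Real.rpow_pos_of_pos (hsin _ hφ₀m) _)).ne'
    have e2 : Real.sin ψ ^ (p - 1) * Real.sin ψ ^ (-(p - 1)) = 1 := by
      rw [← Real.rpow_add (hsin _ hψ), add_neg_cancel, Real.rpow_zero]
    linear_combination -Real.sin ψ ^ (p - 1) * e1 + B * Real.sin ((p - 1) * ψ) * e2
  have hBpos : 0 < B := pichoridesConst_pos hp hp2
  have hmono := monotoneOn_sin_mul_sin_rpow_neg (a := p - 1) (by linarith) (by linarith)
  have hKle : K φ ≤ K φ₀ := by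
    rcases le_total φ φ₀ with hle | hle
    · have hsub : Set.Icc 0 φ₀ ⊆ Set.Ico 0 (Real.pi / 2) := fun ψ hψ =>
        ⟨hψ.1, hψ.2.trans_lt hφ₀m.2⟩
      refine monotoneOn_of_deriv_nonneg (convex_Icc 0 φ₀)
        (fun ψ hψ => (hder ψ (hsub hψ)).continuousAt.continuousWithinAt)
        (fun ψ hψ => (hder ψ (hsub (interior_subset hψ))).differentiableAt.differentiableWithinAt)
        ?_ ⟨h0, hle⟩ ⟨hφ₀m.1.le, le_rfl⟩ hle
      intro ψ hψ
      rw [(hder ψ (hsub (interior_subset hψ))).deriv]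
      rw [interior_Icc] at hψ
      have hψ' : ψ ∈ Set.Ioo 0 (Real.pi / 2) := ⟨hψ.1, hψ.2.trans hφ₀m.2⟩
      rw [hsgn ψ hψ']
      have hm := hmono hψ' hφ₀m hψ.2.le
      have := hcos ψ ⟨hψ.1.le, hψ'.2⟩
      have := hsin ψ hψ'
      exact mul_nonneg (by positivity) (mul_nonneg (by positivity) (sub_nonneg.2 hm))
    · have hsub : Set.Icc φ₀ φ ⊆ Set.Ioo 0 (Real.pi / 2) := fun ψ hψ =>
        ⟨hφ₀m.1.trans_le hψ.1, hψ.2.trans_lt h1⟩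
      refine antitoneOn_of_deriv_nonpos (convex_Icc φ₀ φ)
        (fun ψ hψ => (hder ψ ⟨(hsub hψ).1.le, (hsub hψ).2⟩).continuousAt.continuousWithinAt)
        (fun ψ hψ => (hder ψ ⟨(hsub (interior_subset hψ)).1.le,
          (hsub (interior_subset hψ)).2⟩).differentiableAt.differentiableWithinAt)
        ?_ ⟨le_rfl, hle⟩ ⟨hle, le_rfl⟩ hle
      intro ψ hψ
      have hψI := interior_subset hψ
      have hψ' := hsub hψI
      rw [(hder ψ ⟨hψ'.1.le, hψ'.2⟩).deriv, hsgn ψ hψ']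
      have hm := hmono hφ₀m hψ' hψI.1
      have := hcos ψ ⟨hψ'.1.le, hψ'.2⟩
      have := hsin ψ hψ'
      exact mul_nonpos_of_nonneg_of_nonpos (by positivity)
        (mul_nonpos_of_nonneg_of_nonpos (by positivity) (sub_nonpos.2 hm))
  rw [hKφ₀] at hKle
  have hc := hcos φ ⟨h0, h1⟩
  have e5 : Real.cos φ ^ (-p) * Real.cos φ ^ p = 1 := by
    rw [← Real.rpow_add hc, neg_add_cancel, Real.rpow_zero]
  have h6 := mul_le_mul_of_nonneg_right hKle (Real.rpow_nonneg hc.le p)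
  simp only [hK] at h6
  rw [mul_assoc, e5, mul_one] at h6
  linarith

/-- The trigonometric inequality in Cartesian coordinates, for `s > 0`. -/
lemma abs_rpow_le_pichorides_of_pos {p : ℝ} (hp : 1 < p) (hp2 : p ≤ 2) {s : ℝ} (hs : 0 < s)
    (y : ℝ) :
    |y| ^ p ≤ Real.tan (Real.pi / (2 * p)) ^ p * s ^ p
      - pichoridesConst p * (((s : ℂ) + y * Complex.I) ^ (p : ℂ)).re := by
  set w : ℂ := (s : ℂ) + y * Complex.I with hw
  have hre : w.re = s := by simp [hw]
  have him : w.im = y := by simp [hw]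
  have hw0 : 0 < ‖w‖ := norm_pos_iff.2 fun h => by rw [h] at hre; simp at hre; linarith
  have hlt : |w.arg| < Real.pi / 2 :=
    Complex.abs_arg_lt_pi_div_two_iff.2 (Or.inl (by rw [hre]; exact hs))
  have hpi := Real.pi_pos
  have h := sin_rpow_le_pichorides hp hp2 (abs_nonneg w.arg) hlt
  have e1 : |y| = ‖w‖ * Real.sin |w.arg| := by
    rw [← him, ← Complex.norm_mul_sin_arg w, abs_mul, abs_of_pos hw0,
      Real.abs_sin_eq_sin_abs_of_abs_le_pi (by linarith)]
  have e2 : s = ‖w‖ * Real.cos |w.arg| := by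
    rw [← hre, Real.cos_abs, Complex.norm_mul_cos_arg]
  have e3 : (w ^ (p : ℂ)).re = ‖w‖ ^ p * Real.cos (p * |w.arg|) := by
    rw [Complex.cpow_ofReal_re]
    congr 1
    rw [← Real.cos_abs (w.arg * p), abs_mul, abs_of_pos (by linarith : 0 < p), mul_comm]
  have hs' : 0 ≤ Real.sin |w.arg| :=
    Real.sin_nonneg_of_nonneg_of_le_pi (abs_nonneg _) (by linarith)
  have hc' : 0 ≤ Real.cos |w.arg| :=
    Real.cos_nonneg_of_mem_Icc ⟨by linarith [abs_nonneg w.arg], hlt.le⟩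
  rw [e3, e1, Real.mul_rpow hw0.le hs']
  conv_rhs => rw [e2, Real.mul_rpow hw0.le hc']
  have := mul_le_mul_of_nonneg_left h (Real.rpow_nonneg hw0.le p)
  linarith

/-- The trigonometric inequality in Cartesian coordinates; the boundary case `s = 0` follows by
continuity. -/
lemma abs_rpow_le_pichorides {p : ℝ} (hp : 1 < p) (hp2 : p ≤ 2) {s : ℝ} (hs : 0 ≤ s) (y : ℝ) :
    |y| ^ p ≤ Real.tan (Real.pi / (2 * p)) ^ p * s ^ p
      - pichoridesConst p * (((s : ℂ) + y * Complex.I) ^ (p : ℂ)).re := by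
  rcases hs.eq_or_lt with rfl | hs
  swap
  · exact abs_rpow_le_pichorides_of_pos hp hp2 hs y
  have hcont : ContinuousAt (fun s : ℝ => Real.tan (Real.pi / (2 * p)) ^ p * s ^ p
      - pichoridesConst p * (((s : ℂ) + y * Complex.I) ^ (p : ℂ)).re) 0 := by
    have h1 : Continuous fun s : ℝ => s ^ p := Real.continuous_rpow_const (by linarith)
    have h2 : ContinuousAt (fun z : ℂ => z ^ (p : ℂ)) (((0 : ℝ) : ℂ) + y * Complex.I) :=
      Complex.continuousAt_cpow_const_of_re_pos (Or.inl (by simp)) (by simp; linarith)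
    have h3 : ContinuousAt (fun s : ℝ => ((s : ℂ) + y * Complex.I) ^ (p : ℂ)) 0 :=
      ContinuousAt.comp (g := fun z : ℂ => z ^ (p : ℂ)) (f := fun s : ℝ => (s : ℂ) + y * Complex.I)
        h2 (by fun_prop)
    exact (h1.continuousAt.const_mul _).sub
      ((Complex.continuous_re.continuousAt.comp h3).const_mul _)
  have hlim := hcont.tendsto.mono_left (nhdsWithin_le_nhds (s := Set.Ioi 0))
  refine ge_of_tendsto hlim ?_
  filter_upwards [self_mem_nhdsWithin] with s hs
  exact abs_rpow_le_pichorides_of_pos hp hp2 hs y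

/-! ### A smooth subharmonic approximation of `Re (|x| + i y) ^ p` -/

/-- The point `√(x² + δ²) + i y`, for `w = x + i y`. For `δ > 0` it is a smooth function of `w`
with values in the right half-plane; for `δ = 0` it is `|x| + i y`. -/
noncomputable def regPt (δ : ℝ) (w : ℂ) : ℂ := (√(w.re ^ 2 + δ ^ 2) : ℝ) + w.im * Complex.I

/-- The function `Re (√(x² + δ²) + i y) ^ p` of `w = x + i y`, subharmonic for `1 < p ≤ 2`. -/
noncomputable def regPow (p δ : ℝ) (w : ℂ) : ℝ := (regPt δ w ^ (p : ℂ)).re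

/-- The first derivative of `regPt δ` along a curve through `w` with velocity `v`. -/
noncomputable def regPtD (δ : ℝ) (w v : ℂ) : ℂ :=
  ((w.re * v.re / √(w.re ^ 2 + δ ^ 2) : ℝ) : ℂ) + v.im * Complex.I

/-- The second derivative of `regPt δ` along a curve through `w` with velocity `v` and
acceleration `a`. -/
noncomputable def regPtDD (δ : ℝ) (w v a : ℂ) : ℂ :=
  (((v.re ^ 2 + w.re * a.re) / √(w.re ^ 2 + δ ^ 2)
    - (w.re * v.re) ^ 2 / √(w.re ^ 2 + δ ^ 2) ^ 3 : ℝ) : ℂ) + a.im * Complex.I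

/-- The first derivative of `regPow p δ` along a curve through `w` with velocity `v`. -/
noncomputable def regPowD (p δ : ℝ) (w v : ℂ) : ℝ :=
  (p * regPt δ w ^ ((p - 1 : ℝ) : ℂ) * regPtD δ w v).re

/-- The second derivative of `regPow p δ` along a curve through `w` with velocity `v` and
acceleration `a`. -/
noncomputable def regPowDD (p δ : ℝ) (w v a : ℂ) : ℝ :=
  (p * ((p - 1 : ℝ) * regPt δ w ^ ((p - 2 : ℝ) : ℂ) * regPtD δ w v) * regPtD δ w v
    + p * regPt δ w ^ ((p - 1 : ℝ) : ℂ) * regPtDD δ w v a).re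

lemma regPt_re (δ : ℝ) (w : ℂ) : (regPt δ w).re = √(w.re ^ 2 + δ ^ 2) := by simp [regPt]

lemma regPt_im (δ : ℝ) (w : ℂ) : (regPt δ w).im = w.im := by simp [regPt]

lemma regPt_re_pos {δ : ℝ} (hδ : 0 < δ) (w : ℂ) : 0 < √(w.re ^ 2 + δ ^ 2) :=
  Real.sqrt_pos.2 (by positivity)

lemma norm_regPt_sq (δ : ℝ) (w : ℂ) : ‖regPt δ w‖ ^ 2 = δ ^ 2 + ‖w‖ ^ 2 := by
  rw [Complex.sq_norm, Complex.normSq_apply, Complex.sq_norm, Complex.normSq_apply, regPt_re,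
    regPt_im, Real.mul_self_sqrt (by positivity)]
  ring

lemma le_norm_regPt {δ : ℝ} (w : ℂ) : δ ≤ ‖regPt δ w‖ :=
  le_of_sq_le_sq (by rw [norm_regPt_sq]; nlinarith [sq_nonneg ‖w‖]) (norm_nonneg _)

lemma norm_regPt_le {δ : ℝ} (hδ : 0 ≤ δ) (w : ℂ) : ‖regPt δ w‖ ≤ δ + ‖w‖ :=
  le_of_sq_le_sq (by rw [norm_regPt_sq]; nlinarith [mul_nonneg hδ (norm_nonneg w)])
    (by positivity)

lemma regPt_mem_slitPlane {δ : ℝ} (hδ : 0 < δ) (w : ℂ) : regPt δ w ∈ Complex.slitPlane :=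
  Or.inl (by rw [regPt_re]; exact regPt_re_pos hδ w)

section Derivatives

variable {z z' : ℝ → ℂ} {y : ℝ} {v a : ℂ} {p δ : ℝ}

lemma HasDerivAt.complex_re (h : HasDerivAt z v y) : HasDerivAt (fun s => (z s).re) v.re y :=
  (Complex.reCLM.hasFDerivAt.comp_hasDerivAt y h)

lemma HasDerivAt.complex_im (h : HasDerivAt z v y) : HasDerivAt (fun s => (z s).im) v.im y :=
  (Complex.imCLM.hasFDerivAt.comp_hasDerivAt y h)

lemma hasDerivAt_sqrt_re_sq_add (hδ : 0 < δ) (h : HasDerivAt z v y) :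
    HasDerivAt (fun s => √((z s).re ^ 2 + δ ^ 2))
      ((z y).re * v.re / √((z y).re ^ 2 + δ ^ 2)) y := by
  have hpos : ((fun s => (z s).re) ^ 2) y + δ ^ 2 ≠ 0 := by
    simp only [Pi.pow_apply]; positivity
  refine (((h.complex_re.pow 2).add_const (δ ^ 2)).sqrt hpos).congr_deriv ?_
  have := regPt_re_pos hδ (z y)
  simp only [Pi.pow_apply]
  push_cast
  field_simp

lemma hasDerivAt_regPt (hδ : 0 < δ) (h : HasDerivAt z v y) :
    HasDerivAt (fun s => regPt δ (z s)) (regPtD δ (z y) v) y :=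
  (hasDerivAt_sqrt_re_sq_add hδ h).ofReal_comp.add (h.complex_im.ofReal_comp.mul_const Complex.I)

lemma hasDerivAt_regPtD (hδ : 0 < δ) (h : HasDerivAt z (z' y) y) (h' : HasDerivAt z' a y) :
    HasDerivAt (fun s => regPtD δ (z s) (z' s)) (regPtDD δ (z y) (z' y) a) y := by
  have hs := regPt_re_pos hδ (z y)
  refine HasDerivAt.add (HasDerivAt.ofReal_comp ?_) (h'.complex_im.ofReal_comp.mul_const Complex.I)
  refine ((h.complex_re.mul h'.complex_re).div (hasDerivAt_sqrt_re_sq_add hδ h)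
    hs.ne').congr_deriv ?_
  simp only [Pi.mul_apply]
  field_simp

lemma hasDerivAt_regPt_cpow (hδ : 0 < δ) (h : HasDerivAt z v y) (b : ℝ) :
    HasDerivAt (fun s => regPt δ (z s) ^ (b : ℂ))
      (b * regPt δ (z y) ^ ((b - 1 : ℝ) : ℂ) * regPtD δ (z y) v) y := by
  have := HasDerivAt.comp_of_eq y ((hasDerivAt_id (regPt δ (z y))).cpow_const (c := (b : ℂ))
    (regPt_mem_slitPlane hδ _)) (hasDerivAt_regPt hδ h) rfl
  refine this.congr_deriv ?_
  push_cast; simp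

lemma hasDerivAt_regPow (hδ : 0 < δ) (h : HasDerivAt z v y) :
    HasDerivAt (fun s => regPow p δ (z s)) (regPowD p δ (z y) v) y :=
  (hasDerivAt_regPt_cpow hδ h p).complex_re

lemma hasDerivAt_regPowD (hδ : 0 < δ) (h : HasDerivAt z (z' y) y) (h' : HasDerivAt z' a y) :
    HasDerivAt (fun s => regPowD p δ (z s) (z' s)) (regPowDD p δ (z y) (z' y) a) y := by
  have h1 := (hasDerivAt_regPt_cpow hδ h (p - 1)).const_mul (p : ℂ)
  rw [show p - 1 - 1 = p - 2 by ring] at h1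
  exact (h1.mul (hasDerivAt_regPtD hδ h h')).complex_re

end Derivatives

/-- Subharmonicity of `regPow p δ`, composed with a holomorphic function: `F`, `F'`, `F''` have
values `w`, `v`, `a`, and the second derivatives in the two real directions are taken with
velocities `v` and `i v` and accelerations `a` and `-a`. -/
lemma regPowDD_add_nonneg {p δ : ℝ} (hp : 1 < p) (hp2 : p ≤ 2) (hδ : 0 < δ) (w v a : ℂ) :
    0 ≤ regPowDD p δ w v a + regPowDD p δ w (Complex.I * v) (-a) := by
  set W := regPt δ w with hW
  set s := √(w.re ^ 2 + δ ^ 2) with hs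
  have hs0 : 0 < s := regPt_re_pos hδ w
  have hs2 : s ^ 2 = w.re ^ 2 + δ ^ 2 := Real.sq_sqrt (by positivity)
  have e1 : regPtD δ w v ^ 2 + regPtD δ w (Complex.I * v) ^ 2
      = ((-(δ ^ 2 / s ^ 2 * (v.re ^ 2 + v.im ^ 2)) : ℝ) : ℂ) := by
    have hx : w.re ^ 2 / s ^ 2 = 1 - δ ^ 2 / s ^ 2 := by field_simp; linarith
    have aux : ∀ A B C D E : ℝ, A * B + C * D = 0 → A ^ 2 - B ^ 2 + C ^ 2 - D ^ 2 = E →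
        ((A : ℂ) + B * Complex.I) ^ 2 + ((C : ℂ) + D * Complex.I) ^ 2 = (E : ℂ) := by
      intro A B C D E h1 h2
      rw [← h2]
      have h1' : (A : ℂ) * B + C * D = 0 := by exact_mod_cast h1
      push_cast
      linear_combination 2 * Complex.I * h1' + ((B : ℂ) ^ 2 + D ^ 2) * Complex.I_sq
    simp only [regPtD, ← hs, Complex.I_mul_re, Complex.I_mul_im]
    refine aux _ _ _ _ _ (by ring) ?_
    linear_combination (v.re ^ 2 + v.im ^ 2) * hx
  have e2 : regPtDD δ w v a + regPtDD δ w (Complex.I * v) (-a)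
      = ((δ ^ 2 / s ^ 3 * (v.re ^ 2 + v.im ^ 2) : ℝ) : ℂ) := by
    have aux : ∀ A B C D E : ℝ, B + D = 0 → A + C = E →
        ((A : ℂ) + B * Complex.I) + ((C : ℂ) + D * Complex.I) = (E : ℂ) := by
      intro A B C D E h1 h2
      rw [← h2]
      have h1' : (B : ℂ) + D = 0 := by exact_mod_cast h1
      push_cast
      linear_combination Complex.I * h1'
    simp only [regPtDD, ← hs, Complex.I_mul_re, Complex.neg_re, Complex.neg_im]
    refine aux _ _ _ _ _ (by ring) ?_
    field_simp
    linear_combination (v.re ^ 2 + v.im ^ 2) * hs2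
  have e3 : regPowDD p δ w v a + regPowDD p δ w (Complex.I * v) (-a)
      = p * (δ ^ 2 / s ^ 2 * (v.re ^ 2 + v.im ^ 2)) *
        ((W ^ ((p - 1 : ℝ) : ℂ)).re / s - (p - 1) * (W ^ ((p - 2 : ℝ) : ℂ)).re) := by
    have : regPowDD p δ w v a + regPowDD p δ w (Complex.I * v) (-a)
      = (p * (p - 1 : ℝ) * W ^ ((p - 2 : ℝ) : ℂ) *
          (regPtD δ w v ^ 2 + regPtD δ w (Complex.I * v) ^ 2)
        + p * W ^ ((p - 1 : ℝ) : ℂ) *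
          (regPtDD δ w v a + regPtDD δ w (Complex.I * v) (-a))).re := by
      rw [regPowDD, regPowDD, ← Complex.add_re, ← hW]
      congr 1; ring
    rw [this, e1, e2, Complex.add_re, Complex.re_mul_ofReal, Complex.re_mul_ofReal,
      ← Complex.ofReal_mul, Complex.re_ofReal_mul, Complex.re_ofReal_mul]
    field_simp
    ring
  rw [e3]
  refine mul_nonneg (by have : 0 < p := by linarith
                        positivity) ?_
  -- in polar coordinates this is `cos ((p - 1) φ) ≥ (p - 1) cos φ cos ((p - 2) φ)`
  have hWre : W.re = s := regPt_re δ w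
  have hW0 : 0 < ‖W‖ := hδ.trans_le (le_norm_regPt w)
  have harg : |W.arg| < Real.pi / 2 :=
    Complex.abs_arg_lt_pi_div_two_iff.2 (Or.inl (by rw [hWre]; exact hs0))
  have hcos : Real.cos W.arg ≤ Real.cos (W.arg * (p - 1)) := by
    rw [← Real.cos_abs, ← Real.cos_abs (W.arg * (p - 1))]
    refine Real.cos_le_cos_of_nonneg_of_le_pi (abs_nonneg _) (by linarith [Real.pi_pos]) ?_
    rw [abs_mul, abs_of_pos (by linarith : 0 < p - 1)]
    nlinarith [abs_nonneg W.arg]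
  have hsW : ‖W‖ * Real.cos W.arg = s := by rw [Complex.norm_mul_cos_arg, hWre]
  rw [Complex.cpow_ofReal_re, Complex.cpow_ofReal_re, sub_nonneg, le_div_iff₀ hs0]
  have e4 : ‖W‖ ^ (p - 1) = ‖W‖ ^ (p - 2) * ‖W‖ := by
    rw [← Real.rpow_add_one hW0.ne']; congr 1; ring
  have hr := Real.rpow_pos_of_pos hW0 (p - 2)
  have h1 := Real.cos_le_one (W.arg * (p - 2))
  calc (p - 1) * (‖W‖ ^ (p - 2) * Real.cos (W.arg * (p - 2))) * s
      = (‖W‖ ^ (p - 2) * s) * ((p - 1) * Real.cos (W.arg * (p - 2))) := by ring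
    _ ≤ (‖W‖ ^ (p - 2) * s) * 1 := by
        gcongr
        nlinarith
    _ = ‖W‖ ^ (p - 1) * Real.cos W.arg := by rw [e4, ← hsW]; ring
    _ ≤ _ := by gcongr

/-- Uniformly in `δ`, the function `regPow p δ` differs from its value at `0` by `O(|w| ^ p)`. -/
lemma abs_regPow_sub_le {p δ : ℝ} (hp : 1 < p) (hp2 : p ≤ 2) (hδ : 0 ≤ δ) (w : ℂ) :
    |regPow p δ w - δ ^ p| ≤ 5 * ‖w‖ ^ p := by
  set W := regPt δ w with hW
  have hp0 : 0 < p := by linarith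
  have hwp : 0 ≤ ‖w‖ ^ p := by positivity
  have hpi := Real.pi_pos
  have harg : |W.arg| ≤ Real.pi / 2 :=
    Complex.abs_arg_le_pi_div_two_iff.2 (by rw [hW, regPt_re]; positivity)
  have heq : regPow p δ w = ‖W‖ ^ p * Real.cos (W.arg * p) := Complex.cpow_ofReal_re _ _
  have hWp : 0 ≤ ‖W‖ ^ p := by positivity
  have hsq : ∀ r : ℝ, 0 ≤ r → r ^ p = (r ^ 2) ^ (p / 2) := fun r hr => by
    rw [← Real.rpow_natCast, ← Real.rpow_mul hr]; congr 1; push_cast; ring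
  rw [abs_le]
  constructor
  · have h1 : δ ^ p ≤ ‖W‖ ^ p := Real.rpow_le_rpow hδ (le_norm_regPt w) hp0.le
    have h2 : 1 - (W.arg * p) ^ 2 / 2 ≤ Real.cos (W.arg * p) := Real.one_sub_sq_div_two_le_cos
    have hsin : 0 ≤ Real.sin |W.arg| :=
      Real.sin_nonneg_of_nonneg_of_le_pi (abs_nonneg _) (by linarith)
    have h3 : 2 / Real.pi * |W.arg| ≤ Real.sin |W.arg| := Real.mul_le_sin (abs_nonneg _) harg
    have h4 : |W.arg| ≤ 1.58 * Real.sin |W.arg| := by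
      have h5 : |W.arg| ≤ Real.pi / 2 * Real.sin |W.arg| := by
        calc |W.arg| = Real.pi / 2 * (2 / Real.pi * |W.arg|) := by field_simp
          _ ≤ _ := by gcongr
      have : Real.pi / 2 ≤ 1.58 := by linarith [Real.pi_lt_d2]
      exact h5.trans (by gcongr)
    have h6 : (W.arg * p) ^ 2 / 2 ≤ 5 * Real.sin |W.arg| ^ p := by
      have h7 : Real.sin |W.arg| ^ (2 : ℝ) ≤ Real.sin |W.arg| ^ p :=
        Real.rpow_le_rpow_of_exponent_ge' hsin (Real.sin_le_one _) hp0.le hp2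
      rw [Real.rpow_two] at h7
      have h8 : W.arg ^ 2 ≤ (1.58 * Real.sin |W.arg|) ^ 2 := by
        rw [← sq_abs W.arg]; gcongr
      have h9 : p ^ 2 ≤ 4 := by nlinarith
      nlinarith [sq_nonneg (Real.sin |W.arg|), sq_nonneg W.arg]
    have h10 : ‖W‖ ^ p * Real.sin |W.arg| ^ p ≤ ‖w‖ ^ p := by
      rw [← Real.mul_rpow (norm_nonneg _) hsin]
      refine Real.rpow_le_rpow (by positivity) ?_ hp0.le
      rw [← Real.abs_sin_eq_sin_abs_of_abs_le_pi (by linarith), ← abs_norm W, ← abs_mul,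
        Complex.norm_mul_sin_arg, hW, regPt_im]
      exact Complex.abs_im_le_norm w
    rw [heq]
    have h11 : ‖W‖ ^ p * (1 - 5 * Real.sin |W.arg| ^ p) ≤ ‖W‖ ^ p * Real.cos (W.arg * p) := by
      gcongr; linarith
    linarith
  · have h1 : ‖W‖ ^ p ≤ δ ^ p + ‖w‖ ^ p := by
      rw [hsq _ (norm_nonneg W), norm_regPt_sq, hsq _ hδ, hsq _ (norm_nonneg w)]
      exact Real.rpow_add_le_add_rpow (by positivity) (by positivity) (by linarith) (by linarith)
    have h2 : ‖W‖ ^ p * Real.cos (W.arg * p) ≤ ‖W‖ ^ p * 1 := by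
      gcongr; exact Real.cos_le_one _
    rw [heq]; linarith

section Bounds

variable {δ : ℝ}

lemma abs_re_div_le_one (hδ : 0 < δ) (w : ℂ) : |w.re / √(w.re ^ 2 + δ ^ 2)| ≤ 1 := by
  have := regPt_re_pos hδ w
  rw [abs_div, abs_of_pos this, div_le_one this]
  exact Real.abs_le_sqrt (by nlinarith)

lemma le_sqrt_sq_add (x : ℝ) : δ ≤ √(x ^ 2 + δ ^ 2) :=
  Real.le_sqrt_of_sq_le (by nlinarith [sq_nonneg x])

lemma norm_regPtD_le (hδ : 0 < δ) (w v : ℂ) : ‖regPtD δ w v‖ ≤ 2 * ‖v‖ := by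
  refine (norm_add_le _ _).trans ?_
  rw [Complex.norm_real, norm_mul, Complex.norm_real, Complex.norm_I, mul_one, Real.norm_eq_abs,
    Real.norm_eq_abs, mul_div_right_comm, abs_mul]
  have h1 := abs_re_div_le_one hδ w
  have h2 := Complex.abs_re_le_norm v
  have h3 := Complex.abs_im_le_norm v
  nlinarith [abs_nonneg v.re]

lemma norm_regPtDD_le (hδ : 0 < δ) (w v a : ℂ) :
    ‖regPtDD δ w v a‖ ≤ 2 / δ * ‖v‖ ^ 2 + 2 * ‖a‖ := by
  refine (norm_add_le _ _).trans ?_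
  rw [Complex.norm_real, norm_mul, Complex.norm_real, Complex.norm_I, mul_one, Real.norm_eq_abs,
    Real.norm_eq_abs]
  set s := √(w.re ^ 2 + δ ^ 2) with hs
  have hs0 : 0 < s := regPt_re_pos hδ w
  have h1 : |w.re / s| ≤ 1 := abs_re_div_le_one hδ w
  have h2 : |v.re| ≤ ‖v‖ := Complex.abs_re_le_norm v
  have h3 : |a.im| ≤ ‖a‖ := Complex.abs_im_le_norm a
  have h4 : |a.re| ≤ ‖a‖ := Complex.abs_re_le_norm a
  have e : (v.re ^ 2 + w.re * a.re) / s - (w.re * v.re) ^ 2 / s ^ 3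
      = (1 - (w.re / s) ^ 2) * (v.re ^ 2 / s) + w.re / s * a.re := by field_simp; ring
  have h5 : |v.re ^ 2 / s| ≤ ‖v‖ ^ 2 / δ := by
    rw [abs_of_nonneg (by positivity), ← sq_abs]
    gcongr
    exact le_sqrt_sq_add _
  have h6 : (w.re / s) ^ 2 ≤ 1 := by rw [← sq_abs]; nlinarith [abs_nonneg (w.re / s)]
  have h7 : |1 - (w.re / s) ^ 2| ≤ 1 := by
    rw [abs_le]; constructor <;> nlinarith [sq_nonneg (w.re / s)]
  have h8 : |(1 - (w.re / s) ^ 2) * (v.re ^ 2 / s)| ≤ 1 * (‖v‖ ^ 2 / δ) := by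
    rw [abs_mul]; gcongr
  have h9 : |w.re / s * a.re| ≤ 1 * ‖a‖ := by rw [abs_mul]; gcongr
  have h10 : 0 ≤ ‖v‖ ^ 2 / δ := by positivity
  rw [e]
  have h11 := abs_add_le ((1 - (w.re / s) ^ 2) * (v.re ^ 2 / s)) (w.re / s * a.re)
  have h12 : 2 / δ * ‖v‖ ^ 2 = 2 * (‖v‖ ^ 2 / δ) := by ring
  linarith

variable {p M : ℝ}

lemma abs_regPowD_le (hp : 1 < p) (hδ : 0 < δ) {w : ℂ} (hw : ‖w‖ ≤ M) (v : ℂ) :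
    |regPowD p δ w v| ≤ p * (δ + M) ^ (p - 1) * 2 * ‖v‖ := by
  refine (Complex.abs_re_le_norm _).trans ?_
  rw [norm_mul, norm_mul, Complex.norm_real, Complex.norm_cpow_real, Real.norm_of_nonneg
    (by linarith : 0 ≤ p), mul_assoc _ 2]
  have h1 := norm_regPtD_le hδ w v
  have h2 : ‖regPt δ w‖ ^ (p - 1) ≤ (δ + M) ^ (p - 1) :=
    Real.rpow_le_rpow (norm_nonneg _) ((norm_regPt_le hδ.le w).trans (by linarith)) (by linarith)
  have h3 : 0 ≤ δ + M := by linarith [norm_nonneg w]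
  gcongr

lemma abs_regPowDD_le (hp : 1 < p) (hp2 : p ≤ 2) (hδ : 0 < δ) {w : ℂ} (hw : ‖w‖ ≤ M) (v a : ℂ) :
    |regPowDD p δ w v a| ≤ p * ((p - 1) * δ ^ (p - 2) * (2 * ‖v‖)) * (2 * ‖v‖)
      + p * (δ + M) ^ (p - 1) * (2 / δ * ‖v‖ ^ 2 + 2 * ‖a‖) := by
  refine (Complex.abs_re_le_norm _).trans ((norm_add_le _ _).trans ?_)
  simp only [norm_mul, Complex.norm_real, Complex.norm_cpow_real]
  rw [Real.norm_of_nonneg (by linarith : 0 ≤ p), Real.norm_of_nonneg (by linarith : 0 ≤ p - 1)]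
  have h1 := norm_regPtD_le hδ w v
  have h3 := norm_regPtDD_le hδ w v a
  have h2 : ‖regPt δ w‖ ^ (p - 1) ≤ (δ + M) ^ (p - 1) :=
    Real.rpow_le_rpow (norm_nonneg _) ((norm_regPt_le hδ.le w).trans (by linarith)) (by linarith)
  have h4 : ‖regPt δ w‖ ^ (p - 2) ≤ δ ^ (p - 2) :=
    Real.rpow_le_rpow_of_nonpos hδ (le_norm_regPt w) (by linarith)
  have h5 : 0 ≤ p - 1 := by linarith
  have h6 : 0 ≤ δ + M := by linarith [norm_nonneg w]
  gcongr

end Bounds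

section Measurability

variable {α : Type*} [MeasurableSpace α] {f g h : α → ℂ}

lemma Measurable.regPow (hf : Measurable f) (p δ : ℝ) :
    Measurable fun x => regPow p δ (f x) := by
  unfold _root_.regPow regPt; fun_prop

lemma Measurable.regPowD (hf : Measurable f) (hg : Measurable g) (p δ : ℝ) :
    Measurable fun x => regPowD p δ (f x) (g x) := by
  unfold _root_.regPowD regPt regPtD; fun_prop

lemma Measurable.regPowDD (hf : Measurable f) (hg : Measurable g) (hh : Measurable h) (p δ : ℝ) :
    Measurable fun x => regPowDD p δ (f x) (g x) (h x) := by
  unfold _root_.regPowDD regPt regPtD regPtDD; fun_prop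

end Measurability

/-! ### Integrals of `Re (|Re F| + i Im F) ^ p` over horizontal lines -/

lemma ConvexOn.nonneg_of_tendsto_zero {f : ℝ → ℝ} (hf : ConvexOn ℝ (Set.Ioi 0) f)
    (hlim : Filter.Tendsto f Filter.atTop (nhds 0)) {y : ℝ} (hy : 0 < y) : 0 ≤ f y := by
  -- the chord inequality, with the right end point sent to infinity
  have hle : ∀ y' > y, f y' ≤ f y := by
    intro y' hy'
    have h1 : Filter.Tendsto (fun x => (f x - f y) / (x - y)) Filter.atTop (nhds 0) := by
      have := (hlim.sub_const (f y)).div_atTop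
        (Filter.tendsto_atTop_add_const_right Filter.atTop (-y) Filter.tendsto_id)
      simpa [sub_eq_add_neg] using this
    have h2 : (f y' - f y) / (y' - y) ≤ 0 := by
      refine ge_of_tendsto h1 ?_
      filter_upwards [Filter.eventually_gt_atTop y'] with x hx
      exact hf.secant_mono hy (hy.trans hy') (hy.trans (hy'.trans hx)) hy'.ne' (hy'.trans hx).ne'
        hx.le
    rw [div_le_iff₀ (by linarith)] at h2
    linarith
  refine le_of_tendsto hlim ?_
  filter_upwards [Filter.eventually_gt_atTop y] with y' hy' using hle y' hy'

/-- A holomorphic function on the upper half-plane with the decay at infinity of the Cauchy integral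
of a function with compact support: `F = O(1 / |x|)` and `F', F'' = O(1 / x²)` as `x = Re z → ±∞`,
uniformly in each half-plane `Im z ≥ ε`, and `F → 0` along vertical lines. -/
structure HalfPlaneDecay (F : ℂ → ℂ) : Prop where
  differentiableOn : DifferentiableOn ℂ F upperHalf
  bound : ∀ ε > 0, ∃ C, ∀ z : ℂ, ε ≤ z.im → ‖F z‖ ≤ C * (1 + ‖z.re‖) ^ (-1 : ℝ) ∧
    ‖deriv F z‖ ≤ C * (1 + ‖z.re‖) ^ (-2 : ℝ) ∧
    ‖deriv (deriv F) z‖ ≤ C * (1 + ‖z.re‖) ^ (-2 : ℝ)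
  tendsto : ∀ t : ℝ, Filter.Tendsto (fun y : ℝ => F (t + y * Complex.I)) Filter.atTop (nhds 0)

namespace HalfPlaneDecay

variable {F : ℂ → ℂ} {p δ : ℝ}

lemma isOpen_upperHalf : IsOpen upperHalf := isOpen_lt continuous_const Complex.continuous_im

lemma mk_mem_upperHalf {y : ℝ} (hy : 0 < y) (t : ℝ) : (t : ℂ) + y * Complex.I ∈ upperHalf := by
  simp [upperHalf, hy]

lemma hasDerivAt_horizontal {G : ℂ → ℂ} (hG : DifferentiableOn ℂ G upperHalf) {y : ℝ} (hy : 0 < y)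
    (t : ℝ) : HasDerivAt (fun t : ℝ => G (t + y * Complex.I)) (deriv G (t + y * Complex.I)) t := by
  have h1 := (hG.differentiableAt (isOpen_upperHalf.mem_nhds (mk_mem_upperHalf hy t))).hasDerivAt
  have h2 : HasDerivAt (fun t : ℝ => (t : ℂ) + y * Complex.I) 1 t := by
    simpa using (Complex.ofRealCLM.hasDerivAt (x := t)).add_const (y * Complex.I)
  have h3 := HasDerivAt.comp (h₂ := G) t h1 h2
  rwa [mul_one] at h3

lemma hasDerivAt_vertical {G : ℂ → ℂ} (hG : DifferentiableOn ℂ G upperHalf) {y : ℝ} (hy : 0 < y)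
    (t : ℝ) : HasDerivAt (fun y : ℝ => G (t + y * Complex.I))
      (Complex.I * deriv G (t + y * Complex.I)) y := by
  have h1 := (hG.differentiableAt (isOpen_upperHalf.mem_nhds (mk_mem_upperHalf hy t))).hasDerivAt
  have h2 : HasDerivAt (fun y : ℝ => (t : ℂ) + y * Complex.I) Complex.I y := by
    simpa using ((Complex.ofRealCLM.hasDerivAt (x := y)).mul_const Complex.I).const_add (t : ℂ)
  have h3 := HasDerivAt.comp (h₂ := G) y h1 h2
  rwa [mul_comm] at h3

lemma measurable_horizontal {G : ℂ → ℂ} (hG : DifferentiableOn ℂ G upperHalf) {y : ℝ}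
    (hy : 0 < y) : Measurable fun t : ℝ => G (t + y * Complex.I) := by
  have : Continuous fun t : ℝ => G (t + y * Complex.I) :=
    continuous_iff_continuousAt.2 fun t => (hasDerivAt_horizontal hG hy t).continuousAt
  exact this.measurable

lemma differentiableOn_deriv (hF : HalfPlaneDecay F) : DifferentiableOn ℂ (deriv F) upperHalf :=
  hF.differentiableOn.deriv isOpen_upperHalf

lemma differentiableOn_deriv_deriv (hF : HalfPlaneDecay F) :
    DifferentiableOn ℂ (deriv (deriv F)) upperHalf :=
  hF.differentiableOn_deriv.deriv isOpen_upperHalf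

lemma integrable_one_add_norm_rpow {r : ℝ} (hr : 1 < r) :
    Integrable fun t : ℝ => (1 + ‖t‖) ^ (-r) :=
  integrable_one_add_norm (by simpa using hr)

lemma one_add_norm_rpow_le_one (t : ℝ) {r : ℝ} (hr : r ≤ 0) : (1 + ‖t‖) ^ r ≤ 1 :=
  Real.rpow_le_one_of_one_le_of_nonpos (by linarith [norm_nonneg t]) hr

/-- The bounds in the form used for domination, with a nonnegative constant. -/
lemma exists_bound (hF : HalfPlaneDecay F) {ε : ℝ} (hε : 0 < ε) : ∃ C, 0 ≤ C ∧
    ∀ y, ε ≤ y → ∀ t : ℝ, ‖F (t + y * Complex.I)‖ ≤ C * (1 + ‖t‖) ^ (-1 : ℝ) ∧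
      ‖F (t + y * Complex.I)‖ ≤ C ∧
      ‖deriv F (t + y * Complex.I)‖ ≤ C * (1 + ‖t‖) ^ (-2 : ℝ) ∧
      ‖deriv F (t + y * Complex.I)‖ ≤ C ∧
      ‖deriv (deriv F) (t + y * Complex.I)‖ ≤ C * (1 + ‖t‖) ^ (-2 : ℝ) := by
  obtain ⟨C, hC⟩ := hF.bound ε hε
  have hC0 : 0 ≤ C := by
    have := (norm_nonneg _).trans (hC (ε * Complex.I) (by simp)).1
    simpa using this
  refine ⟨C, hC0, fun y hy t => ?_⟩
  obtain ⟨h1, h2, h3⟩ := hC (t + y * Complex.I) (by simpa using hy)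
  have hre : ((t : ℂ) + y * Complex.I).re = t := by simp
  rw [hre] at h1 h2 h3
  refine ⟨h1, h1.trans ?_, h2, h2.trans ?_, h3⟩
  · exact mul_le_of_le_one_right hC0 (one_add_norm_rpow_le_one t (by norm_num))
  · exact mul_le_of_le_one_right hC0 (one_add_norm_rpow_le_one t (by norm_num))

lemma norm_rpow_le {C q t : ℝ} {w : ℂ} (hC : 0 ≤ C) (hq : 0 ≤ q)
    (h : ‖w‖ ≤ C * (1 + ‖t‖) ^ (-1 : ℝ)) : ‖w‖ ^ q ≤ C ^ q * (1 + ‖t‖) ^ (-q) := by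
  have h0 : 0 ≤ 1 + ‖t‖ := by positivity
  calc ‖w‖ ^ q ≤ (C * (1 + ‖t‖) ^ (-1 : ℝ)) ^ q := Real.rpow_le_rpow (norm_nonneg _) h hq
    _ = _ := by
      rw [Real.mul_rpow hC (by positivity), ← Real.rpow_mul h0]; congr 2; ring

lemma integrable_regPow_sub (hF : HalfPlaneDecay F) (hp : 1 < p) (hp2 : p ≤ 2) (hδ : 0 ≤ δ)
    {y : ℝ} (hy : 0 < y) :
    Integrable fun t : ℝ => regPow p δ (F (t + y * Complex.I)) - δ ^ p := by
  obtain ⟨C, hC0, hC⟩ := hF.exists_bound hy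
  refine ((integrable_one_add_norm_rpow hp).const_mul (5 * C ^ p)).mono'
    (((measurable_horizontal hF.differentiableOn hy).regPow p δ).sub_const _).aestronglyMeasurable
    (Filter.Eventually.of_forall fun t => ?_)
  refine (abs_regPow_sub_le hp hp2 hδ _).trans ?_
  have := norm_rpow_le hC0 (by linarith : 0 ≤ p) (hC y le_rfl t).1
  linarith

section Convexity

variable (hF : HalfPlaneDecay F) (hp : 1 < p) (hp2 : p ≤ 2) (hδ : 0 < δ)

include hF hp hδ in
lemma exists_regPowD_bound {ε : ℝ} (hε : 0 < ε) : ∃ K, ∀ y, ε ≤ y → ∀ t : ℝ, ∀ v : ℂ,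
    ‖v‖ = ‖deriv F (t + y * Complex.I)‖ →
      ‖regPowD p δ (F (t + y * Complex.I)) v‖ ≤ K * (1 + ‖t‖) ^ (-2 : ℝ) := by
  obtain ⟨C, hC0, hC⟩ := hF.exists_bound hε
  refine ⟨p * (δ + C) ^ (p - 1) * 2 * C, fun y hy t v hv => ?_⟩
  obtain ⟨-, h1, h2, -, -⟩ := hC y hy t
  refine (abs_regPowD_le hp hδ h1 v).trans ?_
  rw [hv, mul_assoc _ C]
  gcongr

include hF hp hp2 hδ in
lemma exists_regPowDD_bound {ε : ℝ} (hε : 0 < ε) : ∃ K, ∀ y, ε ≤ y → ∀ t : ℝ, ∀ v a : ℂ,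
    ‖v‖ = ‖deriv F (t + y * Complex.I)‖ → ‖a‖ = ‖deriv (deriv F) (t + y * Complex.I)‖ →
      ‖regPowDD p δ (F (t + y * Complex.I)) v a‖ ≤ K * (1 + ‖t‖) ^ (-2 : ℝ) := by
  obtain ⟨C, hC0, hC⟩ := hF.exists_bound hε
  refine ⟨p * ((p - 1) * δ ^ (p - 2) * (2 * C)) * (2 * C)
      + p * (δ + C) ^ (p - 1) * (2 / δ * (C * C) + 2 * C), fun y hy t v a hv ha => ?_⟩
  obtain ⟨-, h1, h2, h3, h4⟩ := hC y hy t
  rw [← hv] at h2 h3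
  rw [← ha] at h4
  refine (abs_regPowDD_le hp hp2 hδ h1 v a).trans ?_
  have hp1 : 0 ≤ p - 1 := by linarith
  set m := (1 + ‖t‖) ^ (-2 : ℝ) with hm
  have hm0 : 0 ≤ m := by positivity
  calc _ ≤ p * ((p - 1) * δ ^ (p - 2) * (2 * C)) * (2 * (C * m))
      + p * (δ + C) ^ (p - 1) * (2 / δ * (C * (C * m)) + 2 * (C * m)) := by
        rw [sq]; gcongr
    _ = _ := by ring

include hF hp hp2 hδ in
lemma integral_regPowDD_horizontal {y : ℝ} (hy : 0 < y) :
    Integrable (fun t : ℝ => regPowDD p δ (F (t + y * Complex.I))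
      (deriv F (t + y * Complex.I)) (deriv (deriv F) (t + y * Complex.I))) ∧
    ∫ t : ℝ, regPowDD p δ (F (t + y * Complex.I))
      (deriv F (t + y * Complex.I)) (deriv (deriv F) (t + y * Complex.I)) = 0 := by
  have hpow : ∀ K : ℝ, Integrable fun t : ℝ => K * (1 + ‖t‖) ^ (-2 : ℝ) := fun K =>
    (integrable_one_add_norm_rpow (by norm_num)).const_mul K
  obtain ⟨K, hK⟩ := exists_regPowD_bound hF hp hδ hy
  obtain ⟨K', hK'⟩ := exists_regPowDD_bound hF hp hp2 hδ hy
  have hm := measurable_horizontal hF.differentiableOn hy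
  have hm' := measurable_horizontal hF.differentiableOn_deriv hy
  have hm'' := measurable_horizontal hF.differentiableOn_deriv_deriv hy
  have hi2 := (hpow K').mono' (hm.regPowDD hm' hm'' p δ).aestronglyMeasurable
    (Filter.Eventually.of_forall fun t => hK' y le_rfl t _ _ rfl rfl)
  have hi1 := (hpow K).mono' (hm.regPowD hm' p δ).aestronglyMeasurable
    (Filter.Eventually.of_forall fun t => hK y le_rfl t _ rfl)
  have hder : ∀ t : ℝ, HasDerivAt (fun t : ℝ => regPowD p δ (F (t + y * Complex.I))
      (deriv F (t + y * Complex.I))) (regPowDD p δ (F (t + y * Complex.I))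
      (deriv F (t + y * Complex.I)) (deriv (deriv F) (t + y * Complex.I))) t := fun t =>
    hasDerivAt_regPowD (z := fun t : ℝ => F (t + y * Complex.I))
      (z' := fun t : ℝ => deriv F (t + y * Complex.I)) hδ
      (hasDerivAt_horizontal hF.differentiableOn hy t)
      (hasDerivAt_horizontal hF.differentiableOn_deriv hy t)
  exact ⟨hi2, integral_eq_zero_of_hasDerivAt_of_integrable hder hi2 hi1⟩

include hF hp hp2 hδ in
/-- The integral over the horizontal line at height `y` is convex in `y`: two derivatives in `y`
give the integral of the Laplacian, because the second derivative along the line integrates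
to zero. -/
lemma convexOn_integral_regPow_sub : ConvexOn ℝ (Set.Ioi 0)
    fun y : ℝ => ∫ t : ℝ, (regPow p δ (F (t + y * Complex.I)) - δ ^ p) := by
  set g1 : ℝ → ℝ → ℝ := fun y t => regPowD p δ (F (t + y * Complex.I))
    (Complex.I * deriv F (t + y * Complex.I)) with hg1
  set g2 : ℝ → ℝ → ℝ := fun y t => regPowDD p δ (F (t + y * Complex.I))
    (Complex.I * deriv F (t + y * Complex.I)) (-deriv (deriv F) (t + y * Complex.I)) with hg2
  have hnI : ∀ v : ℂ, ‖Complex.I * v‖ = ‖v‖ := fun v => by simp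
  have hpow : ∀ K : ℝ, Integrable fun t : ℝ => K * (1 + ‖t‖) ^ (-2 : ℝ) := fun K =>
    (integrable_one_add_norm_rpow (by norm_num)).const_mul K
  have hm1 : ∀ y, 0 < y → Measurable (g1 y) := fun y hy =>
    (measurable_horizontal hF.differentiableOn hy).regPowD
      ((measurable_horizontal hF.differentiableOn_deriv hy).const_mul _) p δ
  have hm2 : ∀ y, 0 < y → Measurable (g2 y) := fun y hy =>
    (measurable_horizontal hF.differentiableOn hy).regPowDD
      ((measurable_horizontal hF.differentiableOn_deriv hy).const_mul _)
      (measurable_horizontal hF.differentiableOn_deriv_deriv hy).neg p δ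
  have hd1 : ∀ y, 0 < y → ∀ t : ℝ,
      HasDerivAt (fun y : ℝ => regPow p δ (F (t + y * Complex.I)) - δ ^ p) (g1 y t) y :=
    fun y hy t => (hasDerivAt_regPow hδ (hasDerivAt_vertical hF.differentiableOn hy t)).sub_const _
  have hd2 : ∀ y, 0 < y → ∀ t : ℝ, HasDerivAt (fun y : ℝ => g1 y t) (g2 y t) y := by
    intro y hy t
    refine hasDerivAt_regPowD (z := fun y : ℝ => F (t + y * Complex.I))
      (z' := fun y : ℝ => Complex.I * deriv F (t + y * Complex.I)) hδ
      (hasDerivAt_vertical hF.differentiableOn hy t) ?_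
    refine ((hasDerivAt_vertical hF.differentiableOn_deriv hy t).const_mul
      Complex.I).congr_deriv ?_
    rw [← mul_assoc, Complex.I_mul_I, neg_one_mul]
  have hint1 : ∀ y, 0 < y → Integrable (g1 y) := by
    intro y hy
    obtain ⟨K, hK⟩ := exists_regPowD_bound hF hp hδ hy
    exact (hpow K).mono' (hm1 y hy).aestronglyMeasurable
      (Filter.Eventually.of_forall fun t => hK y le_rfl t _ (hnI _))
  have hnhds : ∀ y : ℝ, 0 < y → Set.Ioi (y / 2) ∈ nhds y := fun y hy => Ioi_mem_nhds (by linarith)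
  have hI1 : ∀ y, 0 < y → HasDerivAt
      (fun y : ℝ => ∫ t : ℝ, (regPow p δ (F (t + y * Complex.I)) - δ ^ p)) (∫ t, g1 y t) y := by
    intro y hy
    obtain ⟨K, hK⟩ := exists_regPowD_bound hF hp hδ (half_pos hy)
    refine (hasDerivAt_integral_of_dominated_loc_of_deriv_le (hnhds y hy) ?_
      (integrable_regPow_sub hF hp hp2 hδ.le hy) (hm1 y hy).aestronglyMeasurable
      (Filter.Eventually.of_forall fun t y' hy' => hK y' (le_of_lt hy') t _ (hnI _)) (hpow K)
      (Filter.Eventually.of_forall fun t y' hy' => hd1 y' ((half_pos hy).trans hy') t)).2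
    filter_upwards [hnhds y hy] with y' hy'
    exact (((measurable_horizontal hF.differentiableOn ((half_pos hy).trans hy')).regPow p
      δ).sub_const _).aestronglyMeasurable
  have hI2 : ∀ y, 0 < y → Integrable (g2 y) ∧
      HasDerivAt (fun y : ℝ => ∫ t : ℝ, g1 y t) (∫ t, g2 y t) y := by
    intro y hy
    obtain ⟨K, hK⟩ := exists_regPowDD_bound hF hp hp2 hδ (half_pos hy)
    refine hasDerivAt_integral_of_dominated_loc_of_deriv_le (hnhds y hy) ?_
      (hint1 y hy) (hm2 y hy).aestronglyMeasurable
      (Filter.Eventually.of_forall fun t y' hy' =>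
        hK y' (le_of_lt hy') t _ _ (hnI _) (norm_neg _)) (hpow K)
      (Filter.Eventually.of_forall fun t y' hy' => hd2 y' ((half_pos hy).trans hy') t)
    filter_upwards [hnhds y hy] with y' hy'
    exact (hm1 y' ((half_pos hy).trans hy')).aestronglyMeasurable
  have hpos : ∀ y, 0 < y → 0 ≤ ∫ t, g2 y t := by
    intro y hy
    obtain ⟨hi2, hzero⟩ := integral_regPowDD_horizontal hF hp hp2 hδ hy
    have hadd : ∀ t : ℝ, 0 ≤ regPowDD p δ (F (t + y * Complex.I))
        (deriv F (t + y * Complex.I)) (deriv (deriv F) (t + y * Complex.I)) + g2 y t := fun t =>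
      regPowDD_add_nonneg hp hp2 hδ _ _ _
    have hsum := integral_add hi2 (hI2 y hy).1
    rw [hzero, zero_add] at hsum
    exact hsum ▸ integral_nonneg hadd
  refine convexOn_of_hasDerivWithinAt2_nonneg (f' := fun y => ∫ t, g1 y t)
    (f'' := fun y => ∫ t, g2 y t) (convex_Ioi 0)
    (fun y hy => (hI1 y hy).continuousAt.continuousWithinAt) ?_ ?_ ?_
  all_goals rw [interior_Ioi]
  · exact fun y hy => (hI1 y hy).hasDerivWithinAt
  · exact fun y hy => (hI2 y hy).2.hasDerivWithinAt
  · exact fun y hy => hpos y hy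

include hF hp hp2 hδ in
lemma integral_regPow_sub_nonneg {y : ℝ} (hy : 0 < y) :
    0 ≤ ∫ t : ℝ, (regPow p δ (F (t + y * Complex.I)) - δ ^ p) := by
  refine (convexOn_integral_regPow_sub hF hp hp2 hδ).nonneg_of_tendsto_zero ?_ hy
  obtain ⟨C, hC0, hC⟩ := hF.exists_bound one_pos
  have hp0 : 0 < p := by linarith
  rw [show (0 : ℝ) = ∫ _ : ℝ, (0 : ℝ) by simp]
  refine tendsto_integral_filter_of_dominated_convergence
    (fun t => 5 * C ^ p * (1 + ‖t‖) ^ (-p)) ?_ ?_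
    ((integrable_one_add_norm_rpow hp).const_mul _) ?_
  · filter_upwards [Filter.eventually_gt_atTop 0] with y hy
    exact (integrable_regPow_sub hF hp hp2 hδ.le hy).1
  · filter_upwards [Filter.eventually_ge_atTop 1] with y hy
    refine Filter.Eventually.of_forall fun t => (abs_regPow_sub_le hp hp2 hδ.le _).trans ?_
    have := norm_rpow_le hC0 hp0.le (hC y hy t).1
    linarith
  · refine Filter.Eventually.of_forall fun t => ?_
    refine squeeze_zero_norm (fun y => abs_regPow_sub_le hp hp2 hδ.le _) ?_
    have h1 := (hF.tendsto t).norm.rpow_const (p := p) (Or.inr hp0.le)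
    simpa [Real.zero_rpow hp0.ne'] using h1.const_mul 5

end Convexity

/-- The limit `δ → 0` of the previous inequality. -/
lemma integral_regPow_zero_nonneg (hF : HalfPlaneDecay F) (hp : 1 < p) (hp2 : p ≤ 2) {y : ℝ}
    (hy : 0 < y) : 0 ≤ ∫ t : ℝ, regPow p 0 (F (t + y * Complex.I)) := by
  have hp0 : 0 < p := by linarith
  obtain ⟨C, hC0, hC⟩ := hF.exists_bound hy
  have hlim : Filter.Tendsto
      (fun δ : ℝ => ∫ t : ℝ, (regPow p δ (F (t + y * Complex.I)) - δ ^ p))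
      (nhdsWithin 0 (Set.Ioi 0)) (nhds (∫ t : ℝ, regPow p 0 (F (t + y * Complex.I)))) := by
    refine tendsto_integral_filter_of_dominated_convergence
      (fun t => 5 * C ^ p * (1 + ‖t‖) ^ (-p)) ?_ ?_
      ((integrable_one_add_norm_rpow hp).const_mul _) ?_
    · filter_upwards [self_mem_nhdsWithin] with δ hδ
      exact (integrable_regPow_sub hF hp hp2 (le_of_lt hδ) hy).1
    · filter_upwards [self_mem_nhdsWithin] with δ hδ
      refine Filter.Eventually.of_forall fun t =>
        (abs_regPow_sub_le hp hp2 (le_of_lt hδ) _).trans ?_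
      have := norm_rpow_le hC0 hp0.le (hC y le_rfl t).1
      linarith
    · refine Filter.Eventually.of_forall fun t => Filter.Tendsto.mono_left ?_ nhdsWithin_le_nhds
      set w := F (t + y * Complex.I)
      have h1 : ContinuousAt (fun z : ℂ => z ^ (p : ℂ)) (regPt 0 w) :=
        Complex.continuousAt_cpow_const_of_re_pos (Or.inl (by rw [regPt_re]; positivity))
          (by simpa using hp0)
      have h2 : ContinuousAt (fun δ : ℝ => regPt δ w ^ (p : ℂ)) 0 :=
        ContinuousAt.comp (g := fun z : ℂ => z ^ (p : ℂ)) (f := fun δ : ℝ => regPt δ w) h1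
          (by unfold regPt; fun_prop)
      have h3 : ContinuousAt (fun δ : ℝ => δ ^ p) 0 :=
        (Real.continuous_rpow_const hp0.le).continuousAt
      have h4 := ((Complex.continuous_re.continuousAt.comp h2).sub h3).tendsto
      rw [Pi.sub_apply, Real.zero_rpow hp0.ne', sub_zero] at h4
      exact h4
  refine ge_of_tendsto hlim ?_
  filter_upwards [self_mem_nhdsWithin] with δ hδ
  exact integral_regPow_sub_nonneg hF hp hp2 hδ hy

lemma integrable_abs_rpow (hF : HalfPlaneDecay F) (hp : 1 < p) {y : ℝ} (hy : 0 < y) {L : ℂ → ℝ}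
    (hL : Measurable L) (hLle : ∀ w, |L w| ≤ ‖w‖) :
    Integrable fun t : ℝ => |L (F (t + y * Complex.I))| ^ p := by
  obtain ⟨C, hC0, hC⟩ := hF.exists_bound hy
  refine ((integrable_one_add_norm_rpow hp).const_mul (C ^ p)).mono' ?_
    (Filter.Eventually.of_forall fun t => ?_)
  · have := measurable_horizontal hF.differentiableOn hy
    exact ((hL.comp this).abs.pow_const p).aestronglyMeasurable
  · rw [Real.norm_of_nonneg (by positivity)]
    refine le_trans ?_ (norm_rpow_le hC0 (by linarith : 0 ≤ p) (hC y le_rfl t).1)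
    exact Real.rpow_le_rpow (abs_nonneg _) (hLle _) (by linarith)

/-- The theorem of Pichorides on horizontal lines: the `L^p` norm of the imaginary part of `F` is
at most `tan (π / (2 p))` times that of the real part. -/
lemma integral_abs_im_rpow_le (hF : HalfPlaneDecay F) (hp : 1 < p) (hp2 : p ≤ 2) {y : ℝ}
    (hy : 0 < y) :
    ∫ t : ℝ, |(F (t + y * Complex.I)).im| ^ p ≤
      Real.tan (Real.pi / (2 * p)) ^ p * ∫ t : ℝ, |(F (t + y * Complex.I)).re| ^ p := by
  have hre := hF.integrable_abs_rpow hp hy Complex.measurable_re Complex.abs_re_le_norm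
  have him := hF.integrable_abs_rpow hp hy Complex.measurable_im Complex.abs_im_le_norm
  have hG : Integrable fun t : ℝ => regPow p 0 (F (t + y * Complex.I)) := by
    simpa [Real.zero_rpow (by linarith : p ≠ 0)] using integrable_regPow_sub hF hp hp2 le_rfl hy
  have hpt : ∀ w : ℂ, |w.im| ^ p ≤ Real.tan (Real.pi / (2 * p)) ^ p * |w.re| ^ p
      - pichoridesConst p * regPow p 0 w := by
    intro w
    have := abs_rpow_le_pichorides hp hp2 (abs_nonneg w.re) w.im
    rwa [regPow, regPt, zero_pow two_ne_zero, add_zero, Real.sqrt_sq_eq_abs]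
  have h1 := integral_mono him ((hre.const_mul _).sub (hG.const_mul _))
    (fun t => hpt (F (t + y * Complex.I)))
  simp only [Pi.sub_apply] at h1
  rw [integral_sub (hre.const_mul _) (hG.const_mul _), integral_const_mul,
    integral_const_mul] at h1
  have h2 := mul_nonneg (pichoridesConst_pos hp hp2).le
    (integral_regPow_zero_nonneg hF hp hp2 hy)
  linarith

end HalfPlaneDecay

/-! ### The Cauchy kernel and the conjugate Poisson kernel -/

/-- The conjugate Poisson kernel `Q(x, y) = π⁻¹ x / (x² + y²)`. -/
noncomputable def conjPoissonKernelR (x y : ℝ) : ℝ := 1 / Real.pi * (x / (x ^ 2 + y ^ 2))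

/-- The conjugate Poisson integral of `u` at `x + i y`. -/
noncomputable def conjPoissonInt (u : ℝ → ℂ) (y x : ℝ) : ℂ :=
  ∫ t : ℝ, (conjPoissonKernelR (x - t) y : ℂ) * u t

@[fun_prop]
lemma Measurable.conjPoissonKernelR {α : Type*} [MeasurableSpace α] {f g : α → ℝ}
    (hf : Measurable f) (hg : Measurable g) :
    Measurable fun a => conjPoissonKernelR (f a) (g a) := by
  unfold _root_.conjPoissonKernelR; fun_prop

@[fun_prop]
lemma Measurable.cauchyKernel {α : Type*} [MeasurableSpace α] {f g : α → ℝ}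
    (hf : Measurable f) (hg : Measurable g) : Measurable fun a => cauchyKernel (f a) (g a) := by
  unfold _root_.cauchyKernel; fun_prop

lemma cauchyKernel_eq (x : ℝ) {y : ℝ} (hy : y ≠ 0) :
    cauchyKernel x y = poissonKernelR x y + Complex.I * conjPoissonKernelR x y := by
  have h : (x : ℂ) + Complex.I * y ≠ 0 := fun h => hy (by simpa using congrArg Complex.im h)
  have h' : (x : ℂ) - Complex.I * y ≠ 0 := fun h => hy (by simpa using congrArg Complex.im h)
  have h2 : (x : ℂ) ^ 2 + y ^ 2 = (x + Complex.I * y) * (x - Complex.I * y) := by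
    linear_combination (y : ℂ) ^ 2 * Complex.I_sq
  rw [cauchyKernel, poissonKernelR, conjPoissonKernelR]
  push_cast
  rw [h2]
  have hpi : (Real.pi : ℂ) ≠ 0 := by exact_mod_cast Real.pi_ne_zero
  field_simp
  linear_combination -(y : ℂ) * Complex.I_sq

lemma cauchyKernel_re (x : ℝ) {y : ℝ} (hy : y ≠ 0) :
    (cauchyKernel x y).re = poissonKernelR x y := by simp [cauchyKernel_eq x hy]

lemma cauchyKernel_im (x : ℝ) {y : ℝ} (hy : y ≠ 0) :
    (cauchyKernel x y).im = conjPoissonKernelR x y := by simp [cauchyKernel_eq x hy]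

lemma abs_conjPoissonKernelR_le (x : ℝ) {y : ℝ} (hy : y ≠ 0) :
    |conjPoissonKernelR x y| ≤ ‖cauchyKernel x y‖ := by
  rw [← cauchyKernel_im x hy]; exact Complex.abs_im_le_norm _

lemma abs_poissonKernelR_le (x : ℝ) {y : ℝ} (hy : y ≠ 0) :
    |poissonKernelR x y| ≤ ‖cauchyKernel x y‖ := by
  rw [← cauchyKernel_re x hy]; exact Complex.abs_re_le_norm _

lemma conjPoissonKernelR_neg (x y : ℝ) : conjPoissonKernelR (-x) y = -conjPoissonKernelR x y := by
  simp [conjPoissonKernelR, neg_div]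

lemma poissonKernelR_neg (x y : ℝ) : poissonKernelR (-x) y = poissonKernelR x y := by
  simp [poissonKernelR]

lemma cauchyKernel_sub_im (z : ℂ) (t : ℝ) :
    cauchyKernel (z.re - t) z.im = Complex.I / Real.pi * (z - t)⁻¹ := by
  rw [cauchyKernel, one_div]
  congr 2
  conv_rhs => rw [← Complex.re_add_im z]
  push_cast; ring

/-- For a point `z` of the half-plane `Im z ≥ ε` and `|t| ≤ R`, the distance from `z` to `t` is at
least a multiple of `1 + |Re z|`. -/
lemma norm_sub_inv_le {ε R : ℝ} (hε : 0 < ε) (hR : 0 ≤ R) {z : ℂ} (hz : ε ≤ z.im) {t : ℝ}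
    (ht : |t| ≤ R) : ‖(z - t)⁻¹‖ ≤ (1 + (R + 1) / ε) * (1 + ‖z.re‖)⁻¹ := by
  have h1 : ε ≤ ‖z - t‖ := by
    refine le_trans ?_ (Complex.abs_im_le_norm _)
    simpa using hz.trans (le_abs_self _)
  have h2 : |z.re - t| ≤ ‖z - t‖ := by simpa using Complex.abs_re_le_norm (z - t)
  have h3 : |z.re| ≤ |z.re - t| + |t| := by simpa using abs_add_le (z.re - t) t
  have h4 : R + 1 ≤ (R + 1) / ε * ‖z - t‖ := by
    calc R + 1 = (R + 1) / ε * ε := by field_simp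
      _ ≤ _ := by gcongr
  rw [norm_inv, ← div_eq_mul_inv, le_div_iff₀ (by positivity), inv_mul_le_iff₀ (hε.trans_le h1),
    Real.norm_eq_abs]
  linarith

lemma norm_cauchyKernel_le {y : ℝ} (hy : 0 < y) :
    ∃ C, 0 ≤ C ∧ ∀ x, ‖cauchyKernel x y‖ ≤ C * (1 + ‖x‖) ^ (-1 : ℝ) := by
  refine ⟨1 / Real.pi * (1 + (0 + 1) / y), by positivity, fun x => ?_⟩
  have h := cauchyKernel_sub_im (x + y * Complex.I) 0
  have h' := norm_sub_inv_le (z := x + y * Complex.I) (t := 0) hy le_rfl (by simp) (by simp)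
  simp only [Complex.add_re, Complex.ofReal_re, Complex.mul_re, Complex.I_re, mul_zero,
    Complex.ofReal_im, Complex.I_im, mul_one, sub_self, add_zero, sub_zero, Complex.add_im,
    Complex.mul_im, zero_add] at h h'
  rw [h, norm_mul, norm_div, Complex.norm_I, Complex.norm_real,
    Real.norm_of_nonneg Real.pi_pos.le, mul_assoc, Real.rpow_neg_one, zero_add]
  gcongr

lemma norm_cauchyKernel_le_inv {y : ℝ} (hy : 0 < y) (x : ℝ) :
    ‖cauchyKernel x y‖ ≤ 1 / Real.pi * y⁻¹ := by
  have h := cauchyKernel_sub_im (x + y * Complex.I) 0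
  simp only [Complex.add_re, Complex.ofReal_re, Complex.mul_re, Complex.I_re, mul_zero,
    Complex.ofReal_im, Complex.I_im, mul_one, sub_self, add_zero, sub_zero, Complex.add_im,
    Complex.mul_im, zero_add] at h
  rw [h, norm_mul, norm_div, Complex.norm_I, Complex.norm_real, norm_inv,
    Real.norm_of_nonneg Real.pi_pos.le]
  gcongr
  simpa using (le_abs_self _).trans (Complex.abs_im_le_norm ((x : ℂ) + y * Complex.I - (0 : ℝ)))

/-- Membership in `L^q` of a function that decays like the Cauchy kernel. -/
lemma memLp_of_norm_le {f : ℝ → ℂ} (hf : AEStronglyMeasurable f volume) {C q : ℝ} (hC : 0 ≤ C)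
    (hq : 1 < q) (h : ∀ x, ‖f x‖ ≤ C * (1 + ‖x‖) ^ (-1 : ℝ)) :
    MemLp f (ENNReal.ofReal q) volume := by
  have hq0 : 0 < q := by linarith
  rw [← integrable_norm_rpow_iff hf (by simpa using hq0) ENNReal.ofReal_ne_top,
    ENNReal.toReal_ofReal hq0.le]
  refine ((HalfPlaneDecay.integrable_one_add_norm_rpow hq).const_mul (C ^ q)).mono'
    (hf.norm.aemeasurable.pow_const q).aestronglyMeasurable
    (Filter.Eventually.of_forall fun x => ?_)
  rw [Real.norm_of_nonneg (by positivity)]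
  exact HalfPlaneDecay.norm_rpow_le hC hq0.le (h x)

lemma memLp_cauchyKernel {y q : ℝ} (hy : 0 < y) (hq : 1 < q) :
    MemLp (fun x => cauchyKernel x y) (ENNReal.ofReal q) volume := by
  obtain ⟨C, hC0, hC⟩ := norm_cauchyKernel_le hy
  have : Measurable fun x => cauchyKernel x y := by fun_prop
  exact memLp_of_norm_le this.aestronglyMeasurable hC0 hq hC

lemma memLp_cauchyKernel_sub {y q : ℝ} (hy : 0 < y) (hq : 1 < q) (x : ℝ) :
    MemLp (fun t => cauchyKernel (x - t) y) (ENNReal.ofReal q) volume :=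
  (memLp_cauchyKernel hy hq).comp_measurePreserving (Measure.measurePreserving_sub_left volume x)

section Integrability

variable {p : ℝ} {u : ℝ → ℂ} {y : ℝ}

lemma integrable_cauchyKernel_mul (hp : 1 < p) (hu : MemLp u (ENNReal.ofReal p) volume)
    (hy : 0 < y) (x : ℝ) : Integrable fun t => cauchyKernel (x - t) y * u t := by
  have hpq := Real.HolderConjugate.conjExponent hp
  have := hpq.symm.ennrealOfReal
  exact (memLp_cauchyKernel_sub hy hpq.symm.lt x).integrable_mul hu

lemma integrable_conjPoissonKernelR_mul (hp : 1 < p) (hu : MemLp u (ENNReal.ofReal p) volume)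
    (hy : 0 < y) (x : ℝ) : Integrable fun t => (conjPoissonKernelR (x - t) y : ℂ) * u t := by
  refine (integrable_cauchyKernel_mul hp hu hy x).mono ?_ (Filter.Eventually.of_forall fun t => ?_)
  · have : Measurable fun t => (conjPoissonKernelR (x - t) y : ℂ) := by fun_prop
    exact this.aestronglyMeasurable.mul hu.1
  · rw [norm_mul, norm_mul, Complex.norm_real]
    gcongr
    exact abs_conjPoissonKernelR_le _ hy.ne'

lemma integrable_poissonKernelR_mul (hp : 1 < p) (hu : MemLp u (ENNReal.ofReal p) volume)
    (hy : 0 < y) (x : ℝ) : Integrable fun t => (poissonKernelR (x - t) y : ℂ) * u t := by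
  refine (integrable_cauchyKernel_mul hp hu hy x).mono ?_ (Filter.Eventually.of_forall fun t => ?_)
  · have : Measurable fun t => (poissonKernelR (x - t) y : ℂ) := by fun_prop
    exact this.aestronglyMeasurable.mul hu.1
  · rw [norm_mul, norm_mul, Complex.norm_real]
    gcongr
    exact abs_poissonKernelR_le _ hy.ne'

lemma cauchyInt_eq (hp : 1 < p) (hu : MemLp u (ENNReal.ofReal p) volume) {z : ℂ}
    (hz : z ∈ upperHalf) :
    cauchyInt u z = poissonInt u z + Complex.I * conjPoissonInt u z.im z.re := by
  have hz : 0 < z.im := hz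
  rw [cauchyInt, poissonInt, conjPoissonInt, ← integral_const_mul, ← integral_add
    (integrable_poissonKernelR_mul hp hu hz _)
    ((integrable_conjPoissonKernelR_mul hp hu hz _).const_mul _)]
  refine integral_congr_ae (Filter.Eventually.of_forall fun t => ?_)
  simp only [cauchyKernel_eq _ hz.ne']
  ring

/-- The conjugate Poisson kernel is real, so that the conjugate Poisson integral commutes with the
real-linear maps `w ↦ Re (c w)`. -/
lemma cauchyInt_re_mul_im (hp : 1 < p) (hu : MemLp u (ENNReal.ofReal p) volume) (hy : 0 < y)
    (x : ℝ) (c : ℂ) : (cauchyInt (fun t => ((c * u t).re : ℂ)) (x + y * Complex.I)).im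
      = (c * conjPoissonInt u y x).re := by
  have hv : MemLp (fun t => ((c * u t).re : ℂ)) (ENNReal.ofReal p) volume :=
    ((hu.const_mul c).re).ofReal
  have e1 := integral_im (integrable_cauchyKernel_mul hp hv hy x)
  have e2 := integral_re ((integrable_conjPoissonKernelR_mul hp hu hy x).const_mul c)
  rw [RCLike.im_to_complex] at e1
  rw [RCLike.re_to_complex] at e2
  have hre : ((x : ℂ) + y * Complex.I).re = x := by simp
  have him : ((x : ℂ) + y * Complex.I).im = y := by simp
  rw [cauchyInt, conjPoissonInt, ← integral_const_mul, hre, him, ← e1, ← e2]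
  refine integral_congr_ae (Filter.Eventually.of_forall fun t => ?_)
  simp only [RCLike.im_to_complex, RCLike.re_to_complex, Complex.im_mul_ofReal,
    cauchyKernel_im _ hy.ne']
  rw [mul_left_comm, Complex.re_ofReal_mul]

lemma cauchyInt_re_mul_re (hp : 1 < p) (hu : MemLp u (ENNReal.ofReal p) volume) (hy : 0 < y)
    (x : ℝ) (c : ℂ) : (cauchyInt (fun t => ((c * u t).re : ℂ)) (x + y * Complex.I)).re
      = (c * poissonInt u (x + y * Complex.I)).re := by
  have hv : MemLp (fun t => ((c * u t).re : ℂ)) (ENNReal.ofReal p) volume :=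
    ((hu.const_mul c).re).ofReal
  have e1 := integral_re (integrable_cauchyKernel_mul hp hv hy x)
  have e2 := integral_re ((integrable_poissonKernelR_mul hp hu hy x).const_mul c)
  rw [RCLike.re_to_complex] at e1 e2
  have hre : ((x : ℂ) + y * Complex.I).re = x := by simp
  have him : ((x : ℂ) + y * Complex.I).im = y := by simp
  rw [cauchyInt, poissonInt, ← integral_const_mul, hre, him, ← e1, ← e2]
  refine integral_congr_ae (Filter.Eventually.of_forall fun t => ?_)
  simp only [RCLike.re_to_complex, Complex.re_mul_ofReal, cauchyKernel_re _ hy.ne']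
  rw [mul_left_comm, Complex.re_ofReal_mul]

end Integrability

/-! ### Decay of the Cauchy integral of a compactly supported function -/

/-- Up to a constant factor, the `k`-th derivative of the Cauchy integral. -/
noncomputable def cauchyIntDer (u : ℝ → ℂ) (k : ℕ) (z : ℂ) : ℂ :=
  ∫ t : ℝ, ((z - t)⁻¹) ^ (k + 1) * u t

section Decay

variable {u : ℝ → ℂ}

lemma im_le_norm_sub (z : ℂ) (t : ℝ) : z.im ≤ ‖z - t‖ := by
  simpa using (le_abs_self _).trans (Complex.abs_im_le_norm (z - t))

lemma norm_inv_sub_le {c : ℝ} (hc : 0 < c) {z : ℂ} (hz : c ≤ z.im) (t : ℝ) :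
    ‖(z - t)⁻¹‖ ≤ c⁻¹ := by
  rw [norm_inv]
  exact inv_anti₀ hc (hz.trans (im_le_norm_sub z t))

lemma aestronglyMeasurable_inv_sub_pow_mul (hu : AEStronglyMeasurable u volume) (z : ℂ) (k : ℕ) :
    AEStronglyMeasurable (fun t : ℝ => ((z - t)⁻¹) ^ k * u t) volume := by
  have : Measurable fun t : ℝ => ((z - t)⁻¹) ^ k := by fun_prop
  exact this.aestronglyMeasurable.mul hu

lemma integrable_inv_sub_pow_mul (hu : Integrable u) {z : ℂ} (hz : 0 < z.im) (k : ℕ) :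
    Integrable fun t : ℝ => ((z - t)⁻¹) ^ k * u t := by
  refine (hu.norm.const_mul ((z.im)⁻¹ ^ k)).mono' (aestronglyMeasurable_inv_sub_pow_mul hu.1 z k)
    (Filter.Eventually.of_forall fun t => ?_)
  rw [norm_mul, norm_pow]
  gcongr
  exact norm_inv_sub_le hz le_rfl t

lemma hasDerivAt_cauchyIntDer (hu : Integrable u) (k : ℕ) {z : ℂ} (hz : 0 < z.im) :
    HasDerivAt (cauchyIntDer u k) (-(k + 1) * cauchyIntDer u (k + 1) z) z := by
  have hs : {w : ℂ | z.im / 2 < w.im} ∈ nhds z :=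
    (isOpen_lt continuous_const Complex.continuous_im).mem_nhds (by
      show z.im / 2 < z.im; linarith)
  have h := (hasDerivAt_integral_of_dominated_loc_of_deriv_le (μ := volume)
    (F := fun (w : ℂ) (t : ℝ) => ((w - t)⁻¹) ^ (k + 1) * u t)
    (F' := fun (w : ℂ) (t : ℝ) => -(k + 1) * (((w - t)⁻¹) ^ (k + 1 + 1) * u t))
    (bound := fun t => (k + 1) * ((z.im / 2)⁻¹ ^ (k + 1 + 1) * ‖u t‖)) hs
    (Filter.Eventually.of_forall fun w => aestronglyMeasurable_inv_sub_pow_mul hu.1 w _)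
    (integrable_inv_sub_pow_mul hu hz _)
    ((aestronglyMeasurable_inv_sub_pow_mul hu.1 z _).const_mul _)
    (Filter.Eventually.of_forall fun t w hw => ?_) ((hu.norm.const_mul _).const_mul _)
    (Filter.Eventually.of_forall fun t w hw => ?_)).2
  · rw [integral_const_mul] at h
    exact h
  · rw [norm_mul, norm_mul, norm_pow, norm_neg]
    have : ‖(k : ℂ) + 1‖ = k + 1 := by exact_mod_cast Complex.norm_natCast (k + 1)
    rw [this]
    gcongr
    exact norm_inv_sub_le (by positivity) (le_of_lt hw) t
  · have hw0 : w - t ≠ 0 := fun h0 => by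
      have h1 := im_le_norm_sub w t
      rw [h0, norm_zero] at h1
      have h2 : z.im / 2 < w.im := hw
      linarith
    have h1 := ((((hasDerivAt_id w).sub_const (t : ℂ)).inv hw0).pow (k + 1)).mul_const (u t)
    refine h1.congr_deriv ?_
    simp only [id, Pi.inv_apply, Nat.add_sub_cancel]
    rw [neg_div, one_div, ← inv_pow]
    push_cast
    ring

lemma norm_cauchyIntDer_le (hu : Integrable u) {R : ℝ} (hR : 0 ≤ R)
    (hsupp : ∀ t, R < |t| → u t = 0) (k : ℕ) {ε : ℝ} (hε : 0 < ε) {z : ℂ} (hz : ε ≤ z.im) :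
    ‖cauchyIntDer u k z‖ ≤
      ((1 + (R + 1) / ε) * (1 + ‖z.re‖)⁻¹) ^ (k + 1) * ∫ t, ‖u t‖ := by
  rw [← integral_const_mul]
  refine norm_integral_le_of_norm_le (hu.norm.const_mul _)
    (Filter.Eventually.of_forall fun t => ?_)
  rw [norm_mul, norm_pow]
  by_cases ht : R < |t|
  · simp [hsupp t ht]
  · gcongr
    exact norm_sub_inv_le hε hR hz (not_lt.1 ht)

lemma cauchyInt_eq_cauchyIntDer (u : ℝ → ℂ) (z : ℂ) :
    cauchyInt u z = Complex.I / Real.pi * cauchyIntDer u 0 z := by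
  rw [cauchyInt, cauchyIntDer, ← integral_const_mul]
  simp only [cauchyKernel_sub_im, zero_add, pow_one, mul_assoc]

lemma hasDerivAt_cauchyInt (hu : Integrable u) {z : ℂ} (hz : 0 < z.im) :
    HasDerivAt (cauchyInt u) (-(Complex.I / Real.pi) * cauchyIntDer u 1 z) z := by
  have h := (hasDerivAt_cauchyIntDer hu 0 hz).const_mul (Complex.I / Real.pi)
  have e : cauchyInt u = fun z => Complex.I / Real.pi * cauchyIntDer u 0 z :=
    funext (cauchyInt_eq_cauchyIntDer u)
  rw [e]
  refine h.congr_deriv ?_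
  simp

/-- The Cauchy integral of a compactly supported function has the decay at infinity that the
convexity argument on horizontal lines needs. -/
lemma halfPlaneDecay_cauchyInt (hu : Integrable u) (hc : HasCompactSupport u) :
    HalfPlaneDecay (cauchyInt u) := by
  obtain ⟨R, hR, hsupp⟩ : ∃ R, 0 ≤ R ∧ ∀ t, R < |t| → u t = 0 := by
    obtain ⟨R, hR⟩ := hc.isCompact.isBounded.exists_norm_le
    refine ⟨max R 0, le_max_right _ _, fun t ht => image_eq_zero_of_notMem_tsupport fun h => ?_⟩
    exact absurd ((hR t h).trans (le_max_left _ 0)) (not_le.2 ht)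
  have hd1 : ∀ z ∈ upperHalf, deriv (cauchyInt u) z
      = -(Complex.I / Real.pi) * cauchyIntDer u 1 z := fun z hz =>
    (hasDerivAt_cauchyInt hu hz).deriv
  have hd2 : ∀ z ∈ upperHalf, deriv (deriv (cauchyInt u)) z
      = 2 * (Complex.I / Real.pi) * cauchyIntDer u 2 z := by
    intro z hz
    have e : deriv (cauchyInt u) =ᶠ[nhds z] fun z => -(Complex.I / Real.pi) * cauchyIntDer u 1 z :=
      Filter.eventually_of_mem (HalfPlaneDecay.isOpen_upperHalf.mem_nhds hz) hd1
    rw [e.deriv_eq, ((hasDerivAt_cauchyIntDer hu 1 hz).const_mul _).deriv]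
    push_cast; ring
  have hnorm : ‖Complex.I / (Real.pi : ℂ)‖ ≤ 1 := by
    rw [norm_div, Complex.norm_I, Complex.norm_real, Real.norm_of_nonneg Real.pi_pos.le,
      div_le_one Real.pi_pos]
    linarith [Real.pi_gt_three]
  refine ⟨fun z hz => (hasDerivAt_cauchyInt hu hz).differentiableAt.differentiableWithinAt, ?_, ?_⟩
  · intro ε hε
    set K := 1 + (R + 1) / ε with hK
    set A := ∫ t, ‖u t‖ with hA
    have hA0 : 0 ≤ A := integral_nonneg fun t => norm_nonneg _
    have hK1 : 1 ≤ K := by rw [hK]; have : 0 ≤ (R + 1) / ε := by positivity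
                           linarith
    refine ⟨2 * K ^ 3 * A, fun z hz => ?_⟩
    have hzu : z ∈ upperHalf := hε.trans_le hz
    set m := (1 + ‖z.re‖)⁻¹ with hm
    have hm0 : 0 ≤ m := by positivity
    have hm1 : m ≤ 1 := inv_le_one_of_one_le₀ (by linarith [norm_nonneg z.re])
    have e1 : (1 + ‖z.re‖) ^ (-1 : ℝ) = m := Real.rpow_neg_one _
    have e2 : (1 + ‖z.re‖) ^ (-2 : ℝ) = m ^ 2 := by
      rw [hm, inv_pow, Real.rpow_neg (by positivity), Real.rpow_two]
    rw [e1, e2, cauchyInt_eq_cauchyIntDer, hd1 z hzu, hd2 z hzu, norm_mul, norm_mul, norm_neg,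
      norm_mul, norm_mul, Complex.norm_two]
    have b0 := norm_cauchyIntDer_le hu hR hsupp 0 hε hz
    have b1 := norm_cauchyIntDer_le hu hR hsupp 1 hε hz
    have b2 := norm_cauchyIntDer_le hu hR hsupp 2 hε hz
    rw [← hK, ← hm, mul_pow] at b0 b1 b2
    have k1 : K ≤ K ^ 3 := le_self_pow₀ hK1 (by norm_num)
    have k2 : K ^ 2 ≤ K ^ 3 := pow_le_pow_right₀ hK1 (by norm_num)
    have hm3 : m ^ 3 ≤ m ^ 2 := pow_le_pow_of_le_one hm0 hm1 (by norm_num)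
    refine ⟨?_, ?_, ?_⟩
    · calc _ ≤ 1 * (K ^ 1 * m ^ 1 * A) := by gcongr
        _ ≤ 2 * (K ^ 3 * m ^ 1 * A) := by rw [pow_one K]; gcongr; norm_num
        _ = _ := by ring
    · calc _ ≤ 1 * (K ^ 2 * m ^ 2 * A) := by gcongr
        _ ≤ 2 * (K ^ 3 * m ^ 2 * A) := by gcongr; norm_num
        _ = _ := by ring
    · calc _ ≤ 2 * 1 * (K ^ 3 * m ^ 3 * A) := by gcongr
        _ ≤ 2 * 1 * (K ^ 3 * m ^ 2 * A) := by gcongr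
        _ = _ := by ring
  · intro t
    refine squeeze_zero_norm' (a := fun y : ℝ => y⁻¹ * ∫ t, ‖u t‖) ?_ ?_
    · filter_upwards [Filter.eventually_gt_atTop 0] with y hy
      rw [cauchyInt_eq_cauchyIntDer, norm_mul]
      have : ‖cauchyIntDer u 0 (t + y * Complex.I)‖ ≤ y⁻¹ * ∫ t, ‖u t‖ := by
        rw [← integral_const_mul]
        refine norm_integral_le_of_norm_le (hu.norm.const_mul _)
          (Filter.Eventually.of_forall fun s => ?_)
        rw [norm_mul, zero_add, pow_one]
        gcongr
        exact norm_inv_sub_le hy (by simp) s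
      calc _ ≤ 1 * (y⁻¹ * ∫ t, ‖u t‖) := by gcongr
        _ = _ := one_mul _
    · simpa using tendsto_inv_atTop_zero.mul_const (∫ t, ‖u t‖)

end Decay

/-! ### `L^p` norms as lower integrals -/

section Norms

variable {α β : Type*} [MeasurableSpace α] [MeasurableSpace β] {μ : Measure α} {ν : Measure β}
  {E F : Type*} [NormedAddCommGroup E] [NormedAddCommGroup F]

lemma eLpNorm_ofReal_exponent {p : ℝ} (hp : 0 < p) (f : α → E) :
    eLpNorm f (ENNReal.ofReal p) μ = (∫⁻ x, ‖f x‖ₑ ^ p ∂μ) ^ (1 / p) := by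
  rw [eLpNorm_eq_lintegral_rpow_enorm_toReal (by simpa using hp) ENNReal.ofReal_ne_top,
    ENNReal.toReal_ofReal hp.le]

lemma eLpNorm_ofReal_exponent_rpow {p : ℝ} (hp : 0 < p) (f : α → E) :
    eLpNorm f (ENNReal.ofReal p) μ ^ p = ∫⁻ x, ‖f x‖ₑ ^ p ∂μ := by
  rw [eLpNorm_ofReal_exponent hp, ← ENNReal.rpow_mul, one_div_mul_cancel hp.ne', ENNReal.rpow_one]

lemma eLpNorm_le_mul_of_lintegral_le {p : ℝ} (hp : 0 < p) {f : α → E} {g : β → F} {A : ℝ≥0∞}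
    (h : ∫⁻ x, ‖f x‖ₑ ^ p ∂μ ≤ A ^ p * ∫⁻ x, ‖g x‖ₑ ^ p ∂ν) :
    eLpNorm f (ENNReal.ofReal p) μ ≤ A * eLpNorm g (ENNReal.ofReal p) ν := by
  rw [← ENNReal.rpow_le_rpow_iff hp, ENNReal.mul_rpow_of_nonneg _ _ hp.le,
    eLpNorm_ofReal_exponent_rpow hp, eLpNorm_ofReal_exponent_rpow hp]
  exact h

lemma lintegral_enorm_mul_le {p q : ℝ} (hpq : p.HolderConjugate q) {f : α → E} {g : α → F}
    (hf : AEStronglyMeasurable f μ) (hg : AEStronglyMeasurable g μ) :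
    ∫⁻ x, ‖f x‖ₑ * ‖g x‖ₑ ∂μ
      ≤ eLpNorm f (ENNReal.ofReal p) μ * eLpNorm g (ENNReal.ofReal q) μ := by
  rw [eLpNorm_ofReal_exponent hpq.pos, eLpNorm_ofReal_exponent hpq.symm.pos]
  exact ENNReal.lintegral_mul_le_Lp_mul_Lq μ hpq hf.enorm hg.enorm

end Norms

lemma enorm_rpow_eq_ofReal {E : Type*} [NormedAddCommGroup E] (w : E) {p : ℝ} (hp : 0 ≤ p) :
    ‖w‖ₑ ^ p = ENNReal.ofReal (‖w‖ ^ p) := by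
  rw [← ofReal_norm, ENNReal.ofReal_rpow_of_nonneg (norm_nonneg _) hp]

/-! ### Extension of norm estimates from a dense class -/

lemma exists_seq_hasCompactSupport {p : ℝ} {u : ℝ → ℂ}
    (hu : MemLp u (ENNReal.ofReal p) volume) :
    ∃ g : ℕ → ℝ → ℂ, (∀ n, Continuous (g n)) ∧ (∀ n, HasCompactSupport (g n)) ∧
      (∀ n, MemLp (g n) (ENNReal.ofReal p) volume) ∧
      Filter.Tendsto (fun n => eLpNorm (u - g n) (ENNReal.ofReal p) volume) Filter.atTop
        (nhds 0) := by
  have h : ∀ n : ℕ, ∃ g : ℝ → ℂ, HasCompactSupport g ∧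
      eLpNorm (u - g) (ENNReal.ofReal p) volume ≤ ((n : ℝ≥0∞) + 1)⁻¹ ∧ Continuous g ∧
      MemLp g (ENNReal.ofReal p) volume := fun n =>
    hu.exists_hasCompactSupport_eLpNorm_sub_le ENNReal.ofReal_ne_top
      (ENNReal.inv_ne_zero.2 (by finiteness))
  choose g hg1 hg2 hg3 hg4 using h
  refine ⟨g, hg3, hg1, hg4, ?_⟩
  refine tendsto_of_tendsto_of_tendsto_of_le_of_le tendsto_const_nhds ?_ (fun n => zero_le) hg2
  have := (Filter.tendsto_add_atTop_iff_nat 1).2 ENNReal.tendsto_inv_nat_nhds_zero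
  simpa using this

/-- Pointwise convergence of integral operators with kernels in the dual exponent. -/
lemma tendsto_integral_mul_of_eLpNorm {p q : ℝ} (hpq : p.HolderConjugate q) {K u : ℝ → ℂ}
    {g : ℕ → ℝ → ℂ} (hK : MemLp K (ENNReal.ofReal q) volume)
    (hu : MemLp u (ENNReal.ofReal p) volume)
    (hg : ∀ n, MemLp (g n) (ENNReal.ofReal p) volume)
    (hlim : Filter.Tendsto (fun n => eLpNorm (u - g n) (ENNReal.ofReal p) volume) Filter.atTop
      (nhds 0)) :
    Filter.Tendsto (fun n => ∫ t, K t * g n t) Filter.atTop (nhds (∫ t, K t * u t)) := by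
  have hconj := hpq.symm.ennrealOfReal
  rw [tendsto_iff_edist_tendsto_0]
  refine tendsto_of_tendsto_of_tendsto_of_le_of_le tendsto_const_nhds
    (h := fun n => eLpNorm K (ENNReal.ofReal q) volume
      * eLpNorm (u - g n) (ENNReal.ofReal p) volume) ?_ (fun n => zero_le) (fun n => ?_)
  · simpa using ENNReal.Tendsto.const_mul hlim (Or.inr hK.eLpNorm_ne_top)
  · have hi : ∀ {v : ℝ → ℂ}, MemLp v (ENNReal.ofReal p) volume →
        Integrable fun t => K t * v t := fun hv => hK.integrable_mul hv
    rw [edist_comm, edist_eq_enorm_sub, ← integral_sub (hi hu) (hi (hg n))]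
    refine (enorm_integral_le_lintegral_enorm _).trans ?_
    refine le_trans (le_of_eq ?_) (lintegral_enorm_mul_le hpq.symm hK.1 (hu.sub (hg n)).1)
    refine lintegral_congr fun t => ?_
    rw [← mul_sub, enorm_mul, Pi.sub_apply]

/-- By Fatou's lemma, a norm estimate for an operator on continuous functions with compact support
extends to `L^p` if the operator is pointwise continuous on `L^p`. -/
lemma eLpNorm_le_of_hasCompactSupport {α : Type*} [MeasurableSpace α] {μ : Measure α}
    {p : ℝ} (hp : 1 ≤ p) {T : (ℝ → ℂ) → α → ℂ} {A : ℝ≥0∞} (hA : A ≠ ∞)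
    (hT : ∀ g : ℝ → ℂ, Continuous g → HasCompactSupport g →
      AEStronglyMeasurable (T g) μ ∧
      eLpNorm (T g) (ENNReal.ofReal p) μ ≤ A * eLpNorm g (ENNReal.ofReal p) volume)
    {u : ℝ → ℂ} (hu : MemLp u (ENNReal.ofReal p) volume)
    (hlim : ∀ g : ℕ → ℝ → ℂ, (∀ n, MemLp (g n) (ENNReal.ofReal p) volume) →
      Filter.Tendsto (fun n => eLpNorm (u - g n) (ENNReal.ofReal p) volume) Filter.atTop
        (nhds 0) → ∀ᵐ x ∂μ, Filter.Tendsto (fun n => T (g n) x) Filter.atTop (nhds (T u x))) :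
    eLpNorm (T u) (ENNReal.ofReal p) μ ≤ A * eLpNorm u (ENNReal.ofReal p) volume := by
  obtain ⟨g, hg1, hg2, hg3, hg4⟩ := exists_seq_hasCompactSupport hu
  refine (Lp.eLpNorm_lim_le_liminf_eLpNorm (fun n => (hT _ (hg1 n) (hg2 n)).1) _
    (hlim g hg3 hg4)).trans ?_
  have hbound : ∀ n, eLpNorm (T (g n)) (ENNReal.ofReal p) μ ≤
      A * (eLpNorm u (ENNReal.ofReal p) volume
        + eLpNorm (u - g n) (ENNReal.ofReal p) volume) := by
    intro n
    refine (hT _ (hg1 n) (hg2 n)).2.trans ?_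
    gcongr
    have h1 : g n = u - (u - g n) := by abel
    conv_lhs => rw [h1]
    exact eLpNorm_sub_le hu.1 (hu.sub (hg3 n)).1 (by simpa using hp)
  have hl : Filter.Tendsto (fun n => A * (eLpNorm u (ENNReal.ofReal p) volume
        + eLpNorm (u - g n) (ENNReal.ofReal p) volume)) Filter.atTop
      (nhds (A * eLpNorm u (ENNReal.ofReal p) volume)) := by
    refine ENNReal.Tendsto.const_mul ?_ (Or.inr hA)
    simpa using tendsto_const_nhds.add hg4
  exact (Filter.liminf_le_liminf (Filter.Eventually.of_forall hbound)).trans hl.liminf_eq.le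

/-! ### The Poisson integral on horizontal lines -/

lemma stronglyMeasurable_cauchyInt {u : ℝ → ℂ} (hu : StronglyMeasurable u) :
    StronglyMeasurable (cauchyInt u) := by
  refine StronglyMeasurable.integral_prod_right (f := fun (z : ℂ) (t : ℝ) =>
    cauchyKernel (z.re - t) z.im * u t) ?_
  have h1 : Measurable fun a : ℂ × ℝ => a.1.re - a.2 :=
    (Complex.measurable_re.comp measurable_fst).sub measurable_snd
  have h2 : Measurable fun a : ℂ × ℝ => a.1.im := Complex.measurable_im.comp measurable_fst
  exact (h1.cauchyKernel h2).stronglyMeasurable.mul (hu.comp_measurable measurable_snd)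

lemma stronglyMeasurable_conjPoissonInt {u : ℝ → ℂ} (hu : StronglyMeasurable u) (y : ℝ) :
    StronglyMeasurable (conjPoissonInt u y) := by
  refine StronglyMeasurable.integral_prod_right (f := fun (x t : ℝ) =>
    (conjPoissonKernelR (x - t) y : ℂ) * u t) ?_
  have h3 : Measurable fun a : ℝ × ℝ => conjPoissonKernelR (a.1 - a.2) y := by fun_prop
  exact (Complex.continuous_ofReal.measurable.comp h3).stronglyMeasurable.mul
    (hu.comp_measurable measurable_snd)

lemma measurable_ofReal_add_mul_I (y : ℝ) : Measurable fun x : ℝ => (x : ℂ) + y * Complex.I := by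
  fun_prop

/-- Jensen's inequality for the probability density `P(x - ·, y)`. -/
lemma enorm_poissonInt_rpow_le {p : ℝ} (hp : 1 ≤ p) {u : ℝ → ℂ}
    (hu : AEStronglyMeasurable u volume) {z : ℂ} (hz : z ∈ upperHalf) :
    ‖poissonInt u z‖ₑ ^ p
      ≤ ∫⁻ t, ENNReal.ofReal (poissonKernelR (z.re - t) z.im) * ‖u t‖ₑ ^ p := by
  have hp0 : 0 < p := by linarith
  set k : ℝ → ℝ≥0∞ := fun t => ENNReal.ofReal (poissonKernelR (z.re - t) z.im) with hk
  have hkm : Measurable k := by fun_prop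
  set ν := volume.withDensity k with hν
  have : IsProbabilityMeasure ν := ⟨by
    rw [hν, withDensity_apply _ MeasurableSet.univ, Measure.restrict_univ]
    exact lintegral_poissonKernelR _ hz⟩
  have huν : AEStronglyMeasurable u ν := hu.mono_ac (withDensity_absolutelyContinuous _ _)
  have h1 : ‖poissonInt u z‖ₑ ≤ eLpNorm u (ENNReal.ofReal p) ν := by
    refine (enorm_poissonInt_le u hz).trans ?_
    refine le_trans (le_of_eq ?_) (eLpNorm_le_eLpNorm_of_exponent_le
      (p := 1) (by simpa using hp) huν)
    rw [eLpNorm_one_eq_lintegral_enorm, hν,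
      lintegral_withDensity_eq_lintegral_mul₀ hkm.aemeasurable hu.enorm]
    rfl
  calc ‖poissonInt u z‖ₑ ^ p ≤ eLpNorm u (ENNReal.ofReal p) ν ^ p := by gcongr
    _ = ∫⁻ t, ‖u t‖ₑ ^ p ∂ν := eLpNorm_ofReal_exponent_rpow hp0 u
    _ = _ := by
      rw [hν, lintegral_withDensity_eq_lintegral_mul₀ hkm.aemeasurable (hu.enorm.pow_const p)]
      rfl

lemma lintegral_poissonInt_line_rpow_le {p : ℝ} (hp : 1 ≤ p) {u : ℝ → ℂ}
    (hu : AEStronglyMeasurable u volume) {y : ℝ} (hy : 0 < y) :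
    ∫⁻ x : ℝ, ‖poissonInt u (x + y * Complex.I)‖ₑ ^ p ≤ ∫⁻ t, ‖u t‖ₑ ^ p := by
  calc _ ≤ ∫⁻ x : ℝ, ∫⁻ t, ENNReal.ofReal (poissonKernelR (x - t) y) * ‖u t‖ₑ ^ p := by
        refine lintegral_mono fun x => ?_
        simpa using enorm_poissonInt_rpow_le hp hu (HalfPlaneDecay.mk_mem_upperHalf hy x)
    _ = ∫⁻ t, ∫⁻ x : ℝ, ENNReal.ofReal (poissonKernelR (x - t) y) * ‖u t‖ₑ ^ p := by
        refine lintegral_lintegral_swap ?_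
        have h1 : Measurable fun a : ℝ × ℝ => ENNReal.ofReal (poissonKernelR (a.1 - a.2) y) := by
          fun_prop
        exact h1.aemeasurable.mul ((hu.enorm.pow_const p).comp_snd)
    _ = ∫⁻ t, ‖u t‖ₑ ^ p := by
        refine lintegral_congr fun t => ?_
        rw [lintegral_mul_const _ (by fun_prop)]
        simp_rw [show ∀ x : ℝ, poissonKernelR (x - t) y = poissonKernelR (t - x) y from fun x => by
          rw [← poissonKernelR_neg, neg_sub]]
        rw [lintegral_poissonKernelR t hy, one_mul]

/-! ### The conjugate Poisson integral on horizontal lines -/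

/-- The `p`-th power of the modulus of a complex number is proportional to the average of the
`p`-th powers of its real projections. -/
lemma exists_lintegral_abs_re_rpow {p : ℝ} (hp : 0 < p) : ∃ c : ℝ≥0∞, c ≠ 0 ∧ c ≠ ∞ ∧ ∀ w : ℂ,
    ∫⁻ θ in Set.Ioc 0 (2 * Real.pi),
      ENNReal.ofReal (|(Complex.exp (θ * Complex.I) * w).re| ^ p) = c * ‖w‖ₑ ^ p := by
  have hpi := Real.pi_pos
  have hcont : Continuous fun θ : ℝ => |Real.cos θ| ^ p :=
    Real.continuous_cos.abs.rpow_const fun _ => Or.inr hp.le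
  have hper : Function.Periodic (fun θ : ℝ => |Real.cos θ| ^ p) (2 * Real.pi) := fun θ => by
    simp only [Real.cos_add_two_pi]
  have hpos : 0 < ∫ θ in (0 : ℝ)..2 * Real.pi, |Real.cos θ| ^ p :=
    intervalIntegral.integral_pos (by positivity) hcont.continuousOn
      (fun θ _ => by positivity) ⟨0, ⟨le_rfl, by positivity⟩, by simp⟩
  refine ⟨ENNReal.ofReal (∫ θ in (0 : ℝ)..2 * Real.pi, |Real.cos θ| ^ p), by simpa using hpos,
    ENNReal.ofReal_ne_top, fun w => ?_⟩
  have hre : ∀ θ : ℝ, |(Complex.exp (θ * Complex.I) * w).re| ^ p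
      = ‖w‖ ^ p * |Real.cos (θ + w.arg)| ^ p := by
    intro θ
    conv_lhs => rw [← Complex.norm_mul_exp_arg_mul_I w, mul_left_comm, ← Complex.exp_add,
      ← add_mul, ← Complex.ofReal_add, Complex.re_ofReal_mul, Complex.exp_ofReal_mul_I_re]
    rw [abs_mul, abs_norm, Real.mul_rpow (norm_nonneg _) (abs_nonneg _)]
  have hint : Integrable (fun θ : ℝ => ‖w‖ ^ p * |Real.cos (θ + w.arg)| ^ p)
      (volume.restrict (Set.Ioc 0 (2 * Real.pi))) :=
    ((continuous_const.mul (hcont.comp (continuous_id.add continuous_const))).integrableOn_Ioc)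
  simp_rw [hre]
  rw [← ofReal_integral_eq_lintegral_ofReal hint
    (Filter.Eventually.of_forall fun θ => by positivity),
    ← intervalIntegral.integral_of_le (by positivity), intervalIntegral.integral_const_mul,
    intervalIntegral.integral_comp_add_right (fun θ => |Real.cos θ| ^ p),
    zero_add, add_comm (2 * Real.pi), hper.intervalIntegral_add_eq w.arg 0, zero_add,
    ENNReal.ofReal_mul (by positivity), enorm_rpow_eq_ofReal w hp.le, mul_comm]

/-- An `L^p` inequality between all real projections of two complex functions implies the
inequality between the functions. -/
lemma lintegral_enorm_rpow_le_of_re {p : ℝ} (hp : 0 < p) {f g : ℝ → ℂ} (hf : Measurable f)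
    (hg : Measurable g) {A : ℝ≥0∞}
    (h : ∀ c : ℂ, ∫⁻ x, ENNReal.ofReal (|(c * f x).re| ^ p)
      ≤ A * ∫⁻ x, ENNReal.ofReal (|(c * g x).re| ^ p)) :
    ∫⁻ x, ‖f x‖ₑ ^ p ≤ A * ∫⁻ x, ‖g x‖ₑ ^ p := by
  obtain ⟨c, hc0, hc1, hc⟩ := exists_lintegral_abs_re_rpow hp
  have hmeas : ∀ {f : ℝ → ℂ}, Measurable f → Measurable (Function.uncurry fun (x θ : ℝ) =>
      ENNReal.ofReal (|(Complex.exp (θ * Complex.I) * f x).re| ^ p)) := by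
    intro f hf
    have h1 : Measurable fun a : ℝ × ℝ => f a.1 := hf.comp measurable_fst
    have h2 : Measurable fun a : ℝ × ℝ => Complex.exp (a.2 * Complex.I) := by fun_prop
    exact ((Complex.measurable_re.comp (h2.mul h1)).abs.pow_const p).ennreal_ofReal
  have key : ∀ {f : ℝ → ℂ}, Measurable f → c * ∫⁻ x, ‖f x‖ₑ ^ p
      = ∫⁻ θ in Set.Ioc 0 (2 * Real.pi), ∫⁻ x : ℝ,
        ENNReal.ofReal (|(Complex.exp (θ * Complex.I) * f x).re| ^ p) := by
    intro f hf
    rw [← lintegral_const_mul _ (hf.enorm.pow_const p),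
      ← lintegral_lintegral_swap (hmeas hf).aemeasurable]
    exact lintegral_congr fun x => (hc (f x)).symm
  rw [← ENNReal.mul_le_mul_iff_right hc0 hc1, mul_left_comm, key hf, key hg,
    ← lintegral_const_mul _ (hmeas hg).lintegral_prod_left]
  exact lintegral_mono fun θ => h _

lemma lintegral_conjPoissonInt_rpow_le {p : ℝ} (hp : 1 < p) (hp2 : p ≤ 2) {u : ℝ → ℂ}
    (hu : Continuous u) (hc : HasCompactSupport u) {y : ℝ} (hy : 0 < y) :
    ∫⁻ x, ‖conjPoissonInt u y x‖ₑ ^ p ≤ ENNReal.ofReal (Real.tan (Real.pi / (2 * p)) ^ p) *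
      ∫⁻ x : ℝ, ‖poissonInt u (x + y * Complex.I)‖ₑ ^ p := by
  have hp0 : 0 < p := by linarith
  have hup : MemLp u (ENNReal.ofReal p) volume := hu.memLp_of_hasCompactSupport hc
  refine lintegral_enorm_rpow_le_of_re hp0
    (stronglyMeasurable_conjPoissonInt hu.stronglyMeasurable y).measurable
    ((stronglyMeasurable_poissonInt hu.stronglyMeasurable).measurable.comp
      (measurable_ofReal_add_mul_I y)) fun c => ?_
  have hvc : Continuous fun t => ((c * u t).re : ℂ) := by fun_prop
  have hvs : HasCompactSupport fun t => ((c * u t).re : ℂ) :=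
    hc.comp_left (g := fun w : ℂ => ((c * w).re : ℂ)) (by simp)
  have hF := halfPlaneDecay_cauchyInt (hvc.integrable_of_hasCompactSupport hvs) hvs
  have h1 := hF.integral_abs_im_rpow_le hp hp2 hy
  have him := hF.integrable_abs_rpow hp hy Complex.measurable_im Complex.abs_im_le_norm
  have hre := hF.integrable_abs_rpow hp hy Complex.measurable_re Complex.abs_re_le_norm
  simp only [cauchyInt_re_mul_im hp hup hy, cauchyInt_re_mul_re hp hup hy] at h1 him hre
  simp only [Function.comp_apply]
  rw [← ofReal_integral_eq_lintegral_ofReal him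
    (Filter.Eventually.of_forall fun x => by positivity),
    ← ofReal_integral_eq_lintegral_ofReal hre (Filter.Eventually.of_forall fun x => by positivity),
    ← ENNReal.ofReal_mul]
  · exact ENNReal.ofReal_le_ofReal h1
  · have := pi_div_two_mul_mem hp
    exact Real.rpow_nonneg (Real.tan_nonneg_of_nonneg_of_le_pi_div_two this.1.le this.2.le) _

lemma memLp_conjPoissonKernelR_sub {y q : ℝ} (hy : 0 < y) (hq : 1 < q) (x : ℝ) :
    MemLp (fun t => (conjPoissonKernelR (x - t) y : ℂ)) (ENNReal.ofReal q) volume := by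
  have : Measurable fun t => (conjPoissonKernelR (x - t) y : ℂ) := by fun_prop
  refine (memLp_cauchyKernel_sub hy hq x).mono this.aestronglyMeasurable
    (Filter.Eventually.of_forall fun t => ?_)
  rw [Complex.norm_real]
  exact abs_conjPoissonKernelR_le _ hy.ne'

/-- For `1 < p ≤ 2` the operator `u ↦ Q_y * u` has norm at most `tan (π / (2 p))` on `L^p`. -/
lemma eLpNorm_conjPoissonInt_le_of_le_two {p : ℝ} (hp : 1 < p) (hp2 : p ≤ 2) {u : ℝ → ℂ}
    (hu : MemLp u (ENNReal.ofReal p) volume) {y : ℝ} (hy : 0 < y) :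
    eLpNorm (conjPoissonInt u y) (ENNReal.ofReal p) volume ≤
      ENNReal.ofReal (Real.tan (Real.pi / (2 * p))) * eLpNorm u (ENNReal.ofReal p) volume := by
  have hpq := Real.HolderConjugate.conjExponent hp
  have hp0 : 0 < p := by linarith
  refine eLpNorm_le_of_hasCompactSupport (T := fun u => conjPoissonInt u y) hp.le
    ENNReal.ofReal_ne_top (fun g hg hgc =>
      ⟨(stronglyMeasurable_conjPoissonInt hg.stronglyMeasurable y).aestronglyMeasurable, ?_⟩) hu
    (fun g hg hlim => Filter.Eventually.of_forall fun x => ?_)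
  · refine eLpNorm_le_mul_of_lintegral_le hp0 ((lintegral_conjPoissonInt_rpow_le hp hp2 hg hgc
      hy).trans ?_)
    have := pi_div_two_mul_mem hp
    rw [ENNReal.ofReal_rpow_of_nonneg
      (Real.tan_nonneg_of_nonneg_of_le_pi_div_two this.1.le this.2.le) hp0.le]
    refine mul_le_mul_right ?_ _
    exact lintegral_poissonInt_line_rpow_le hp.le hg.aestronglyMeasurable hy
  · exact tendsto_integral_mul_of_eLpNorm hpq (memLp_conjPoissonKernelR_sub hy hpq.symm.lt x) hu hg
      hlim

/-! ### Duality -/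

section Duality

variable {p q : ℝ} {u v : ℝ → ℂ} {y : ℝ}

lemma memLp_poissonInt_line (hp : 1 < p) (hu : MemLp u (ENNReal.ofReal p) volume)
    (hus : StronglyMeasurable u) (hy : 0 < y) :
    MemLp (fun x : ℝ => poissonInt u (x + y * Complex.I)) (ENNReal.ofReal p) volume ∧
      eLpNorm (fun x : ℝ => poissonInt u (x + y * Complex.I)) (ENNReal.ofReal p) volume
        ≤ eLpNorm u (ENNReal.ofReal p) volume := by
  have h : eLpNorm (fun x : ℝ => poissonInt u (x + y * Complex.I)) (ENNReal.ofReal p) volume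
      ≤ 1 * eLpNorm u (ENNReal.ofReal p) volume := by
    refine eLpNorm_le_mul_of_lintegral_le (by linarith) ?_
    rw [ENNReal.one_rpow, one_mul]
    exact lintegral_poissonInt_line_rpow_le hp.le hu.1 hy
  rw [one_mul] at h
  exact ⟨⟨((stronglyMeasurable_poissonInt hus).comp_measurable
    (measurable_ofReal_add_mul_I y)).aestronglyMeasurable, h.trans_lt hu.2⟩, h⟩

lemma memLp_cauchyInt_line (hp : 1 < p) (hu : Continuous u) (hc : HasCompactSupport u)
    (hy : 0 < y) :
    MemLp (fun x : ℝ => cauchyInt u (x + y * Complex.I)) (ENNReal.ofReal p) volume := by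
  have hF := halfPlaneDecay_cauchyInt (hu.integrable_of_hasCompactSupport hc) hc
  obtain ⟨C, hC0, hC⟩ := hF.exists_bound hy
  exact memLp_of_norm_le ((stronglyMeasurable_cauchyInt hu.stronglyMeasurable).comp_measurable
    (measurable_ofReal_add_mul_I y)).aestronglyMeasurable hC0 hp fun x => (hC y le_rfl x).1

lemma cauchyInt_line_eq (hp : 1 < p) (hu : MemLp u (ENNReal.ofReal p) volume) (hy : 0 < y)
    (x : ℝ) : cauchyInt u (x + y * Complex.I)
      = poissonInt u (x + y * Complex.I) + Complex.I * conjPoissonInt u y x := by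
  rw [cauchyInt_eq hp hu (HalfPlaneDecay.mk_mem_upperHalf hy x)]
  simp

lemma memLp_conjPoissonInt (hp : 1 < p) (hu : Continuous u) (hc : HasCompactSupport u)
    (hy : 0 < y) : MemLp (conjPoissonInt u y) (ENNReal.ofReal p) volume := by
  have hup : MemLp u (ENNReal.ofReal p) volume := hu.memLp_of_hasCompactSupport hc
  have h := ((memLp_cauchyInt_line hp hu hc hy).sub
    (memLp_poissonInt_line hp hup hu.stronglyMeasurable hy).1).const_mul (-Complex.I)
  refine (memLp_congr_ae (Filter.Eventually.of_forall fun x => ?_)).1 h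
  simp only [Pi.sub_apply, cauchyInt_line_eq hp hup hy]
  linear_combination -conjPoissonInt u y x * Complex.I_sq

/-- Hölder's inequality for the convolution with `|Q_y|`; the bound is uniform by translation
invariance. -/
lemma exists_lintegral_conjPoissonKernelR_mul_le (hpq : p.HolderConjugate q)
    (hv : MemLp v (ENNReal.ofReal q) volume) (hy : 0 < y) : ∃ M : ℝ≥0∞, M < ∞ ∧
      ∀ t, ∫⁻ x, ‖(conjPoissonKernelR (x - t) y : ℂ)‖ₑ * ‖v x‖ₑ ≤ M := by
  set k : ℝ → ℂ := fun x => (conjPoissonKernelR x y : ℂ) with hk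
  have hkm : Measurable k := by fun_prop
  have hkL : MemLp k (ENNReal.ofReal p) volume := by
    refine (memLp_congr_norm hkm.aestronglyMeasurable
      (memLp_conjPoissonKernelR_sub hy hpq.lt 0).1 (Filter.Eventually.of_forall fun x => ?_)).2
      (memLp_conjPoissonKernelR_sub hy hpq.lt 0)
    rw [hk, zero_sub, conjPoissonKernelR_neg, Complex.ofReal_neg, norm_neg]
  refine ⟨eLpNorm k (ENNReal.ofReal p) volume * eLpNorm v (ENNReal.ofReal q) volume,
    ENNReal.mul_lt_top hkL.2 hv.2, fun t => ?_⟩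
  have hmp := measurePreserving_sub_right (volume : Measure ℝ) t
  have h1 := lintegral_enorm_mul_le hpq (hkL.1.comp_measurePreserving hmp) hv.1
  rwa [eLpNorm_comp_measurePreserving hkL.1 hmp] at h1

/-- The conjugate Poisson kernel is odd, so that the operator `u ↦ Q_y * u` is antisymmetric. -/
lemma integral_conjPoissonInt_mul (hpq : p.HolderConjugate q) (hu : Integrable u)
    (hv : MemLp v (ENNReal.ofReal q) volume) (hy : 0 < y) :
    ∫ x, conjPoissonInt u y x * v x = -∫ t, u t * conjPoissonInt v y t := by
  have hmeas : AEStronglyMeasurable (Function.uncurry fun x t : ℝ =>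
      (conjPoissonKernelR (x - t) y : ℂ) * u t * v x) (volume.prod volume) := by
    have h1 : Measurable fun a : ℝ × ℝ => (conjPoissonKernelR (a.1 - a.2) y : ℂ) := by fun_prop
    exact (h1.aestronglyMeasurable.mul hu.1.comp_snd).mul hv.1.comp_fst
  have hint : Integrable (Function.uncurry fun x t : ℝ =>
      (conjPoissonKernelR (x - t) y : ℂ) * u t * v x) (volume.prod volume) := by
    refine ⟨hmeas, ?_⟩
    rw [hasFiniteIntegral_iff_enorm, lintegral_prod_symm _ hmeas.enorm]
    obtain ⟨M, hM, hKM⟩ := exists_lintegral_conjPoissonKernelR_mul_le hpq hv hy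
    calc ∫⁻ t, ∫⁻ x, ‖(conjPoissonKernelR (x - t) y : ℂ) * u t * v x‖ₑ
        ≤ ∫⁻ t, ‖u t‖ₑ * M := by
          refine lintegral_mono fun t => ?_
          have hm : Measurable fun x => ‖(conjPoissonKernelR (x - t) y : ℂ)‖ₑ := by fun_prop
          have hm' : AEMeasurable (fun x => ‖(conjPoissonKernelR (x - t) y : ℂ)‖ₑ * ‖v x‖ₑ)
            volume := hm.aemeasurable.mul hv.1.enorm
          refine le_trans (le_of_eq ?_) (mul_le_mul_right (hKM t) ‖u t‖ₑ)
          rw [← lintegral_const_mul'' _ hm']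
          refine lintegral_congr fun x => ?_
          rw [enorm_mul, enorm_mul, mul_comm ‖(conjPoissonKernelR (x - t) y : ℂ)‖ₑ, mul_assoc]
      _ < ∞ := by
          rw [lintegral_mul_const'' _ hu.1.enorm]
          exact ENNReal.mul_lt_top hu.2 hM
  calc ∫ x, conjPoissonInt u y x * v x
      = ∫ x, ∫ t, (conjPoissonKernelR (x - t) y : ℂ) * u t * v x := by
        refine integral_congr_ae (Filter.Eventually.of_forall fun x => ?_)
        exact (integral_mul_const _ _).symm
    _ = ∫ t, ∫ x, (conjPoissonKernelR (x - t) y : ℂ) * u t * v x := integral_integral_swap hint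
    _ = ∫ t, -(u t * conjPoissonInt v y t) := by
        refine integral_congr_ae (Filter.Eventually.of_forall fun t => ?_)
        simp only
        rw [conjPoissonInt, ← integral_const_mul, ← integral_neg]
        refine integral_congr_ae (Filter.Eventually.of_forall fun x => ?_)
        simp only
        rw [← neg_sub t x, conjPoissonKernelR_neg]
        push_cast; ring
    _ = _ := integral_neg _

/-- An estimate for the operator `u ↦ Q_y * u` passes to the dual exponent, by testing against
`|f| ^ (p - 2) * conj f` for `f = Q_y * u`. -/
lemma eLpNorm_conjPoissonInt_le_of_dual (hpq : p.HolderConjugate q) {A : ℝ≥0∞}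
    (hA : ∀ v : ℝ → ℂ, MemLp v (ENNReal.ofReal q) volume →
      eLpNorm (conjPoissonInt v y) (ENNReal.ofReal q) volume
        ≤ A * eLpNorm v (ENNReal.ofReal q) volume)
    (hu : Continuous u) (hc : HasCompactSupport u) (hy : 0 < y) :
    eLpNorm (conjPoissonInt u y) (ENNReal.ofReal p) volume
      ≤ A * eLpNorm u (ENNReal.ofReal p) volume := by
  have hp0 := hpq.pos
  have hq0 := hpq.symm.pos
  have hp1 := hpq.lt
  set f := conjPoissonInt u y with hf
  have hfL : MemLp f (ENNReal.ofReal p) volume := memLp_conjPoissonInt hp1 hu hc hy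
  have hfm : StronglyMeasurable f := stronglyMeasurable_conjPoissonInt hu.stronglyMeasurable y
  set v : ℝ → ℂ := fun x => ((‖f x‖ ^ (p - 2) : ℝ) : ℂ) * (starRingEnd ℂ) (f x) with hv
  have hvm : StronglyMeasurable v := by
    have h1 : Measurable fun x => ((‖f x‖ ^ (p - 2) : ℝ) : ℂ) := by
      have := hfm.norm.measurable
      fun_prop
    exact h1.stronglyMeasurable.mul (Complex.continuous_conj.comp_stronglyMeasurable hfm)
  have hvnorm : ∀ x, ‖v x‖ = ‖f x‖ ^ (p - 1) := by
    intro x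
    rw [hv, norm_mul, Complex.norm_real, Real.norm_of_nonneg (by positivity), RCLike.norm_conj,
      ← Real.rpow_add_one' (norm_nonneg _) (by linarith)]
    congr 1; ring
  have hfv : ∀ x, f x * v x = ((‖f x‖ ^ p : ℝ) : ℂ) := by
    intro x
    have h1 : ‖f x‖ ^ p = ‖f x‖ ^ (p - 2) * ‖f x‖ ^ 2 := by
      rw [← Real.rpow_two, ← Real.rpow_add' (norm_nonneg _) (by linarith)]; congr 1; ring
    rw [h1, hv]
    push_cast
    rw [mul_left_comm, Complex.mul_conj, ← Complex.sq_norm]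
    push_cast; ring
  set N := ∫⁻ x, ‖f x‖ₑ ^ p with hN
  have hNf : eLpNorm f (ENNReal.ofReal p) volume = N ^ (1 / p) := eLpNorm_ofReal_exponent hp0 f
  have hNv : eLpNorm v (ENNReal.ofReal q) volume = N ^ (1 / q) := by
    rw [eLpNorm_ofReal_exponent hq0]
    congr 1
    refine lintegral_congr fun x => ?_
    rw [enorm_rpow_eq_ofReal _ hq0.le, enorm_rpow_eq_ofReal _ hp0.le, hvnorm,
      ← Real.rpow_mul (norm_nonneg _), hpq.sub_one_mul_conj]
  have hNtop : N ≠ ∞ := by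
    have := hfL.2.ne
    rw [hNf] at this
    intro h
    rw [h, ENNReal.top_rpow_of_pos (by positivity)] at this
    exact this rfl
  rcases eq_or_ne N 0 with hN0 | hN0
  · rw [hNf, hN0, ENNReal.zero_rpow_of_pos (by positivity)]; exact zero_le
  have hvL : MemLp v (ENNReal.ofReal q) volume :=
    ⟨hvm.aestronglyMeasurable, by
      rw [hNv]; exact ENNReal.rpow_lt_top_of_nonneg (by positivity) hNtop⟩
  have hNle : N ≤ eLpNorm u (ENNReal.ofReal p) volume * (A * N ^ (1 / q)) := by
    have hfi : Integrable fun x => ‖f x‖ ^ p := by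
      have := hfL.integrable_norm_rpow (by simpa using hp0) ENNReal.ofReal_ne_top
      rwa [ENNReal.toReal_ofReal hp0.le] at this
    have h1 : N = ‖∫ x, f x * v x‖ₑ := by
      simp_rw [hfv]
      rw [integral_complex_ofReal, ← ofReal_norm, Complex.norm_real,
        Real.norm_of_nonneg (integral_nonneg fun x => by positivity),
        ofReal_integral_eq_lintegral_ofReal hfi
          (Filter.Eventually.of_forall fun x => by positivity)]
      exact lintegral_congr fun x => enorm_rpow_eq_ofReal _ hp0.le
    rw [hf, integral_conjPoissonInt_mul hpq (hu.integrable_of_hasCompactSupport hc) hvL hy,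
      enorm_neg] at h1
    refine h1.le.trans ?_
    refine (enorm_integral_le_lintegral_enorm _).trans ?_
    simp_rw [enorm_mul]
    refine (lintegral_enorm_mul_le hpq hu.aestronglyMeasurable
      (stronglyMeasurable_conjPoissonInt hvm y).aestronglyMeasurable).trans ?_
    gcongr
    rw [← hNv]
    exact hA v hvL
  have hsplit : N ^ (1 / p) * N ^ (1 / q) = N := by
    rw [← ENNReal.rpow_add _ _ hN0 hNtop, one_div, one_div, hpq.inv_add_inv_eq_one,
      ENNReal.rpow_one]
  have hq1 : N ^ (1 / q) ≠ 0 := by simp [hN0, hNtop]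
  have hq2 : N ^ (1 / q) ≠ ∞ := ENNReal.rpow_ne_top_of_nonneg (by positivity) hNtop
  rw [hNf, ← ENNReal.mul_le_mul_iff_left hq1 hq2, hsplit]
  exact hNle.trans (le_of_eq (by ring))

end Duality

/-- The bound of Pichorides for the norm of the Hilbert transform. -/
noncomputable def pichoridesNorm (p : ℝ) : ℝ :=
  Real.tan (Real.pi / 2 * max p⁻¹ (Real.conjExponent p)⁻¹)

lemma pichoridesNorm_nonneg {p : ℝ} (hp : 1 < p) : 0 ≤ pichoridesNorm p := by
  have hpq := Real.HolderConjugate.conjExponent hp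
  have h1 := hpq.inv_pos
  have h2 : p⁻¹ < 1 := inv_lt_one_of_one_lt₀ hp
  have h3 : (Real.conjExponent p)⁻¹ < 1 := inv_lt_one_of_one_lt₀ hpq.symm.lt
  refine Real.tan_nonneg_of_nonneg_of_le_pi_div_two ?_ ?_
  · have := le_max_left p⁻¹ (Real.conjExponent p)⁻¹
    have := Real.pi_pos
    positivity
  · have := max_lt h2 h3
    nlinarith [Real.pi_pos]

/-- The theorem of Pichorides, for the operators `u ↦ Q_y * u` instead of the Hilbert
transform. -/
lemma eLpNorm_conjPoissonInt_le {p : ℝ} (hp : 1 < p) {u : ℝ → ℂ}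
    (hu : MemLp u (ENNReal.ofReal p) volume) {y : ℝ} (hy : 0 < y) :
    eLpNorm (conjPoissonInt u y) (ENNReal.ofReal p) volume ≤
      ENNReal.ofReal (pichoridesNorm p) * eLpNorm u (ENNReal.ofReal p) volume := by
  have hpq := Real.HolderConjugate.conjExponent hp
  set q := Real.conjExponent p with hq
  have hinv := hpq.inv_add_inv_eq_one
  rcases le_or_gt p 2 with hp2 | hp2
  · have hmax : max p⁻¹ q⁻¹ = p⁻¹ := by
      have : 2⁻¹ ≤ p⁻¹ := inv_anti₀ (by linarith) hp2
      exact max_eq_left (by linarith)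
    have h := eLpNorm_conjPoissonInt_le_of_le_two hp hp2 hu hy
    rwa [pichoridesNorm, ← hq, hmax, ← div_eq_mul_inv, div_div]
  · have hpinv : p⁻¹ < 2⁻¹ := inv_strictAnti₀ (by norm_num) hp2
    have hmax : max p⁻¹ q⁻¹ = q⁻¹ := max_eq_right (by linarith)
    have hq2 : q ≤ 2 := by
      have : 2⁻¹ ≤ q⁻¹ := by linarith
      exact (inv_le_inv₀ (by norm_num) hpq.symm.pos).1 this
    refine eLpNorm_le_of_hasCompactSupport (T := fun u => conjPoissonInt u y) hp.le
      ENNReal.ofReal_ne_top (fun g hg hgc =>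
        ⟨(stronglyMeasurable_conjPoissonInt hg.stronglyMeasurable y).aestronglyMeasurable,
          eLpNorm_conjPoissonInt_le_of_dual hpq (fun v hv => ?_) hg hgc hy⟩) hu
      (fun g hg hlim => Filter.Eventually.of_forall fun x =>
        tendsto_integral_mul_of_eLpNorm hpq (memLp_conjPoissonKernelR_sub hy hpq.symm.lt x) hu hg
          hlim)
    have h := eLpNorm_conjPoissonInt_le_of_le_two hpq.symm.lt hq2 hv hy
    rwa [pichoridesNorm, ← hq, hmax, ← div_eq_mul_inv, div_div]

/-! ### The Cauchy integral as the Poisson integral of its trace on a horizontal line -/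

/-- At `+∞` the argument of `s - a` tends to `0`. -/
lemma tendsto_log_sub_log_atTop {a : ℂ} (ha : a.im ≠ 0) :
    Filter.Tendsto (fun s : ℝ => Complex.log (s - a) - Real.log s) Filter.atTop (nhds 0) := by
  have h1 : Filter.Tendsto (fun s : ℝ => Complex.log (1 - a * ((s⁻¹ : ℝ) : ℂ))) Filter.atTop
      (nhds 0) := by
    have h2 : Filter.Tendsto (fun s : ℝ => 1 - a * ((s⁻¹ : ℝ) : ℂ)) Filter.atTop (nhds 1) := by
      have := (Complex.continuous_ofReal.tendsto 0).comp tendsto_inv_atTop_zero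
      simpa using (this.const_mul a).const_sub 1
    simpa using h2.clog (by simp)
  refine h1.congr' ?_
  filter_upwards [Filter.eventually_gt_atTop 0] with s hs
  have hs0 : (s : ℂ) ≠ 0 := by exact_mod_cast hs.ne'
  have hne : 1 - a * ((s⁻¹ : ℝ) : ℂ) ≠ 0 := fun h => by
    have := congrArg Complex.im h
    simp [ha, hs.ne'] at this
  have e : (s : ℂ) - a = s * (1 - a * ((s⁻¹ : ℝ) : ℂ)) := by push_cast; field_simp
  rw [e, Complex.log_ofReal_mul hs hne]; ring

/-- At `-∞` the argument of `s - a` tends to `-π` or `π`, according to the sign of `Im a`. -/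
lemma tendsto_log_sub_log_atBot {a : ℂ} (ha : a.im ≠ 0) :
    Filter.Tendsto (fun s : ℝ => Complex.log (s - a) - Real.log (-s)) Filter.atBot
      (nhds (if 0 < a.im then -(Real.pi * Complex.I) else Real.pi * Complex.I)) := by
  have h2 : Filter.Tendsto (fun s : ℝ => -1 + a * ((s⁻¹ : ℝ) : ℂ)) Filter.atBot (nhds (-1)) := by
    have := (Complex.continuous_ofReal.tendsto 0).comp tendsto_inv_atBot_zero
    simpa using (this.const_mul a).const_add (-1)
  have him : ∀ s : ℝ, (-1 + a * ((s⁻¹ : ℝ) : ℂ)).im = a.im * s⁻¹ := fun s => by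
    simp only [Complex.add_im, Complex.neg_im, Complex.one_im, neg_zero, zero_add,
      Complex.im_mul_ofReal]
  have h1 : Filter.Tendsto (fun s : ℝ => Complex.log (-1 + a * ((s⁻¹ : ℝ) : ℂ))) Filter.atBot
      (nhds (if 0 < a.im then -(Real.pi * Complex.I) else Real.pi * Complex.I)) := by
    split_ifs with hpos
    · have h3 := Complex.tendsto_log_nhdsWithin_im_neg_of_re_neg_of_im_zero (z := -1)
        (by simp) (by simp)
      have h4 := h3.comp (tendsto_nhdsWithin_iff.2 ⟨h2, by
        filter_upwards [Filter.eventually_lt_atBot 0] with s hs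
        show (-1 + a * ((s⁻¹ : ℝ) : ℂ)).im < 0
        rw [him]
        exact mul_neg_of_pos_of_neg hpos (inv_lt_zero.2 hs)⟩)
      rw [norm_neg, norm_one, Real.log_one, Complex.ofReal_zero] at h4
      simpa [Function.comp_def] using h4
    · have hneg : a.im < 0 := lt_of_le_of_ne (not_lt.1 hpos) ha
      have h3 := Complex.tendsto_log_nhdsWithin_im_nonneg_of_re_neg_of_im_zero (z := -1)
        (by simp) (by simp)
      have h4 := h3.comp (tendsto_nhdsWithin_iff.2 ⟨h2, by
        filter_upwards [Filter.eventually_lt_atBot 0] with s hs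
        show 0 ≤ (-1 + a * ((s⁻¹ : ℝ) : ℂ)).im
        rw [him]
        exact (mul_pos_of_neg_of_neg hneg (inv_lt_zero.2 hs)).le⟩)
      rw [norm_neg, norm_one, Real.log_one, Complex.ofReal_zero] at h4
      simpa [Function.comp_def] using h4
  refine h1.congr' ?_
  filter_upwards [Filter.eventually_lt_atBot 0] with s hs
  have hs0 : (s : ℂ) ≠ 0 := by exact_mod_cast hs.ne
  have hne : -1 + a * ((s⁻¹ : ℝ) : ℂ) ≠ 0 := fun h => by
    have := congrArg Complex.im h
    rw [him] at this
    simp [ha, hs.ne] at this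
  have e : (s : ℂ) - a = ((-s : ℝ) : ℂ) * (-1 + a * ((s⁻¹ : ℝ) : ℂ)) := by
    push_cast; field_simp; ring
  rw [e, Complex.log_ofReal_mul (by linarith) hne]; ring

lemma memLp_two_inv_sub {a : ℂ} (ha : a.im ≠ 0) :
    MemLp (fun s : ℝ => ((s : ℂ) - a)⁻¹) (ENNReal.ofReal 2) volume := by
  have hm : Measurable fun s : ℝ => ((s : ℂ) - a)⁻¹ := by fun_prop
  refine memLp_of_norm_le (C := 1 + (|a.re| + 1) / |a.im|) hm.aestronglyMeasurable (by positivity)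
    (by norm_num) fun s => ?_
  have h := norm_sub_inv_le (ε := |a.im|) (R := |a.re|) (z := s + |a.im| * Complex.I) (t := a.re)
    (abs_pos.2 ha) (abs_nonneg _) (by simp) le_rfl
  have hn : ‖((s : ℂ) - a)⁻¹‖ = ‖((s : ℂ) + |a.im| * Complex.I - (a.re : ℝ))⁻¹‖ := by
    rw [norm_inv, norm_inv, Complex.norm_def, Complex.norm_def, Complex.normSq_apply,
      Complex.normSq_apply]
    simp
  rw [hn, Real.rpow_neg_one]
  simpa using h

lemma integrable_inv_sub_mul_inv_sub {a b : ℂ} (ha : a.im ≠ 0) (hb : b.im ≠ 0) :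
    Integrable fun s : ℝ => ((s : ℂ) - a)⁻¹ * ((s : ℂ) - b)⁻¹ := by
  have : (ENNReal.ofReal 2).HolderConjugate (ENNReal.ofReal 2) :=
    Real.HolderConjugate.two_two.ennrealOfReal
  exact (memLp_two_inv_sub ha).integrable_mul (memLp_two_inv_sub hb)

/-- A partial fraction computation; the antiderivative is a difference of logarithms. -/
lemma integral_inv_sub_mul_inv_sub {a b : ℂ} (ha : a.im ≠ 0) (hb : b.im < 0) (hab : a ≠ b) :
    ∫ s : ℝ, ((s : ℂ) - a)⁻¹ * ((s : ℂ) - b)⁻¹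
      = if 0 < a.im then 2 * Real.pi * Complex.I * (a - b)⁻¹ else 0 := by
  have hb' : b.im ≠ 0 := hb.ne
  have hslit : ∀ {c : ℂ}, c.im ≠ 0 → ∀ s : ℝ, (s : ℂ) - c ∈ Complex.slitPlane := fun hc s =>
    Or.inr (by simpa using hc)
  have hlog : ∀ {c : ℂ}, c.im ≠ 0 → ∀ s : ℝ,
      HasDerivAt (fun s : ℝ => Complex.log (s - c)) ((s : ℂ) - c)⁻¹ s := by
    intro c hc s
    have h1 := (Complex.ofRealCLM.hasDerivAt (x := s)).sub_const c
    simpa using h1.clog_real (hslit hc s)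
  have hder : ∀ s : ℝ, HasDerivAt (fun s : ℝ =>
      (Complex.log (s - a) - Complex.log (s - b)) * (a - b)⁻¹)
      (((s : ℂ) - a)⁻¹ * ((s : ℂ) - b)⁻¹) s := by
    intro s
    refine (((hlog ha s).sub (hlog hb' s)).mul_const (a - b)⁻¹).congr_deriv ?_
    have h1 := Complex.slitPlane_ne_zero (hslit ha s)
    have h2 := Complex.slitPlane_ne_zero (hslit hb' s)
    have h3 := sub_ne_zero.2 hab
    field_simp
    ring
  have htop := ((tendsto_log_sub_log_atTop ha).sub (tendsto_log_sub_log_atTop hb')).mul_const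
    (a - b)⁻¹
  have hbot := ((tendsto_log_sub_log_atBot ha).sub (tendsto_log_sub_log_atBot hb')).mul_const
    (a - b)⁻¹
  simp only [sub_sub_sub_cancel_right] at htop hbot
  rw [integral_of_hasDerivAt_of_tendsto hder (integrable_inv_sub_mul_inv_sub ha hb') hbot htop,
    if_neg (not_lt.2 hb.le)]
  split_ifs <;> ring

lemma poissonKernelR_eq_inv_sub {z : ℂ} (hz : z ∈ upperHalf) (s : ℝ) :
    (poissonKernelR (z.re - s) z.im : ℂ) = (2 * Real.pi * Complex.I)⁻¹ *
      (((s : ℂ) - z)⁻¹ - ((s : ℂ) - (starRingEnd ℂ) z)⁻¹) := by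
  have hz' : 0 < z.im := hz
  have hpi : (Real.pi : ℂ) ≠ 0 := by exact_mod_cast Real.pi_ne_zero
  obtain ⟨x, y, hzxy⟩ : ∃ x y : ℝ, z = x + y * Complex.I := ⟨z.re, z.im, (Complex.re_add_im z).symm⟩
  have hx : z.re = x := by simp [hzxy]
  have hy : z.im = y := by simp [hzxy]
  have hy0 : y ≠ 0 := by rw [← hy]; exact hz'.ne'
  have hconj : (starRingEnd ℂ) z = x - y * Complex.I := by
    rw [hzxy]; simp [sub_eq_add_neg]
  have h1 : (s : ℂ) - (x + y * Complex.I) ≠ 0 := fun h => hy0 (by simpa using congrArg Complex.im h)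
  have h2 : (s : ℂ) - (x - y * Complex.I) ≠ 0 := fun h => hy0 (by simpa using congrArg Complex.im h)
  have h3 : ((x : ℂ) - s) ^ 2 + y ^ 2
      = (s - (x + y * Complex.I)) * (s - (x - y * Complex.I)) := by
    linear_combination (y : ℂ) ^ 2 * Complex.I_sq
  rw [hx, hy, hconj, hzxy, poissonKernelR]
  push_cast
  rw [h3]
  field_simp
  ring

/-- The Poisson formula for the function `(s - b)⁻¹`, holomorphic in the upper half-plane. -/
lemma integral_poissonKernelR_mul_inv_sub {z b : ℂ} (hz : z ∈ upperHalf) (hb : b.im < 0)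
    (hzb : (starRingEnd ℂ) z ≠ b) :
    ∫ s : ℝ, (poissonKernelR (z.re - s) z.im : ℂ) * ((s : ℂ) - b)⁻¹ = (z - b)⁻¹ := by
  have hz' : 0 < z.im := hz
  have hzc : ((starRingEnd ℂ) z).im ≠ 0 := by simpa using hz'.ne'
  have hne : z ≠ b := fun h => by rw [h] at hz'; linarith
  have e : ∀ s : ℝ, (poissonKernelR (z.re - s) z.im : ℂ) * ((s : ℂ) - b)⁻¹
      = (2 * Real.pi * Complex.I)⁻¹ * (((s : ℂ) - z)⁻¹ * ((s : ℂ) - b)⁻¹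
        - ((s : ℂ) - (starRingEnd ℂ) z)⁻¹ * ((s : ℂ) - b)⁻¹) := fun s => by
    rw [poissonKernelR_eq_inv_sub hz]; ring
  simp_rw [e]
  rw [integral_const_mul, integral_sub (integrable_inv_sub_mul_inv_sub hz'.ne' hb.ne)
    (integrable_inv_sub_mul_inv_sub hzc hb.ne), integral_inv_sub_mul_inv_sub hz'.ne' hb hne,
    integral_inv_sub_mul_inv_sub hzc hb hzb, if_pos hz', if_neg (by simpa using hz'.le), sub_zero]
  have hpi : (2 * Real.pi * Complex.I : ℂ) ≠ 0 := by simp [Real.pi_ne_zero]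
  rw [inv_mul_cancel_left₀ hpi]

/-- The semigroup identity `P_y * S_ε = S_{y + ε}`. -/
lemma cauchyInt_add_eq_poissonInt {u : ℝ → ℂ} (hu : Integrable u) {z : ℂ} (hz : z ∈ upperHalf)
    {ε : ℝ} (hε : 0 < ε) : cauchyInt u (z + ε * Complex.I)
      = poissonInt (fun s => cauchyInt u (s + ε * Complex.I)) z := by
  have hmeas : Measurable fun a : ℝ × ℝ => cauchyKernel (a.1 - a.2) ε := by fun_prop
  have hint : Integrable (Function.uncurry fun s t : ℝ =>
      (poissonKernelR (z.re - s) z.im : ℂ) * (cauchyKernel (s - t) ε * u t))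
      (volume.prod volume) := by
    have h1 : Integrable (fun a : ℝ × ℝ => (poissonKernelR (z.re - a.1) z.im : ℂ) * u a.2)
        (volume.prod volume) := (integrable_poissonKernelR z.re hz).ofReal.mul_prod hu
    refine (h1.bdd_mul hmeas.aestronglyMeasurable (c := 1 / Real.pi * ε⁻¹)
      (Filter.Eventually.of_forall fun a => norm_cauchyKernel_le_inv hε _)).congr
      (Filter.Eventually.of_forall fun a => ?_)
    simp only [Function.uncurry]
    ring
  have hker : ∀ s t : ℝ, cauchyKernel (s - t) ε
      = Complex.I / Real.pi * ((s : ℂ) - (t - ε * Complex.I))⁻¹ := by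
    intro s t
    have := cauchyKernel_sub_im (s + ε * Complex.I) t
    simp only [Complex.add_re, Complex.ofReal_re, Complex.mul_re, Complex.I_re, mul_zero,
      Complex.ofReal_im, Complex.I_im, mul_one, sub_self, add_zero, Complex.add_im,
      Complex.mul_im, zero_add] at this
    rw [this]; congr 2; ring
  calc cauchyInt u (z + ε * Complex.I)
      = ∫ t, ∫ s : ℝ, (poissonKernelR (z.re - s) z.im : ℂ) * (cauchyKernel (s - t) ε * u t) := by
        rw [cauchyInt]
        refine integral_congr_ae ?_
        -- the exceptional point is where two poles coincide in the partial fractions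
        filter_upwards [compl_mem_ae_iff.2 (measure_singleton z.re)] with t ht
        have hzb : (starRingEnd ℂ) z ≠ t - ε * Complex.I := fun h => ht (by
          simpa using (congrArg Complex.re h).symm)
        have h1 := integral_poissonKernelR_mul_inv_sub hz (b := t - ε * Complex.I)
          (by simpa using hε) hzb
        have h2 : ∀ s : ℝ, (poissonKernelR (z.re - s) z.im : ℂ) * (cauchyKernel (s - t) ε * u t)
            = (Complex.I / Real.pi * u t) * ((poissonKernelR (z.re - s) z.im : ℂ) *
              ((s : ℂ) - (t - ε * Complex.I))⁻¹) := fun s => by rw [hker]; ring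
        simp_rw [h2]
        rw [integral_const_mul, h1, cauchyKernel_sub_im,
          show z + ε * Complex.I - t = z - (t - ε * Complex.I) by ring]
        ring
    _ = ∫ s : ℝ, ∫ t, (poissonKernelR (z.re - s) z.im : ℂ) * (cauchyKernel (s - t) ε * u t) :=
        (integral_integral_swap hint).symm
    _ = _ := by
        rw [poissonInt]
        refine integral_congr_ae (Filter.Eventually.of_forall fun s => ?_)
        simp only
        rw [integral_const_mul, cauchyInt]
        simp

/-! ### Operator norms -/

section OpNorm

variable {p : ℝ} {μ : Measure ℂ}

lemma poissonInt_congr_ae {u v : ℝ → ℂ} (h : u =ᵐ[volume] v) : poissonInt u = poissonInt v :=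
  funext fun z => integral_congr_ae (h.mono fun t ht => by simp only [ht])

lemma cauchyInt_congr_ae {u v : ℝ → ℂ} (h : u =ᵐ[volume] v) : cauchyInt u = cauchyInt v :=
  funext fun z => integral_congr_ae (h.mono fun t ht => by simp only [ht])

lemma aestronglyMeasurable_cauchyInt {u : ℝ → ℂ} (hu : AEStronglyMeasurable u volume) :
    AEStronglyMeasurable (cauchyInt u) μ := by
  rw [cauchyInt_congr_ae hu.ae_eq_mk]
  exact (stronglyMeasurable_cauchyInt hu.stronglyMeasurable_mk).aestronglyMeasurable

lemma aestronglyMeasurable_poissonInt {u : ℝ → ℂ} (hu : AEStronglyMeasurable u volume) :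
    AEStronglyMeasurable (poissonInt u) μ := by
  rw [poissonInt_congr_ae hu.ae_eq_mk]
  exact (stronglyMeasurable_poissonInt hu.stronglyMeasurable_mk).aestronglyMeasurable

lemma lpOpNorm_le {T : (ℝ → ℂ) → ℂ → ℂ} {C : ℝ≥0∞} (hC : C ≠ ∞)
    (hT : ∀ u : ℝ → ℂ, MemLp u (ENNReal.ofReal p) volume → AEStronglyMeasurable (T u) μ)
    (h : ∀ u : ℝ → ℂ, MemLp u (ENNReal.ofReal p) volume →
      eLpNorm (T u) (ENNReal.ofReal p) μ ≤ C * eLpNorm u (ENNReal.ofReal p) volume) :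
    lpOpNorm T p μ ≤ C := by
  lift C to ℝ≥0 using hC
  exact iInf₂_le_of_le C (fun u hu => ⟨⟨hT u hu,
    (h u hu).trans_lt (ENNReal.mul_lt_top ENNReal.coe_lt_top hu.2)⟩, h u hu⟩) le_rfl

/-- The infimum that defines a finite operator norm is attained. -/
lemma eLpNorm_le_lpOpNorm_mul {T : (ℝ → ℂ) → ℂ → ℂ} (hT : lpOpNorm T p μ ≠ ∞) {u : ℝ → ℂ}
    (hu : MemLp u (ENNReal.ofReal p) volume) : MemLp (T u) (ENNReal.ofReal p) μ ∧
      eLpNorm (T u) (ENNReal.ofReal p) μ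
        ≤ lpOpNorm T p μ * eLpNorm u (ENNReal.ofReal p) volume := by
  obtain ⟨C, hC⟩ := iInf_lt_iff.1 (lt_top_iff_ne_top.2 hT)
  obtain ⟨hC, -⟩ := iInf_lt_iff.1 hC
  refine ⟨(hC u hu).1, ?_⟩
  rcases eq_or_ne (eLpNorm u (ENNReal.ofReal p) volume) 0 with h0 | h0
  · have := (hC u hu).2
    rw [h0, mul_zero] at this
    rw [h0, mul_zero]; exact this
  · rw [← ENNReal.div_le_iff_le_mul (Or.inl h0) (Or.inl hu.2.ne)]
    refine le_iInf₂ fun C hC => ?_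
    rw [ENNReal.div_le_iff_le_mul (Or.inl h0) (Or.inl hu.2.ne)]
    exact (hC u hu).2

/-- The upper bound for the norm of the Poisson integral from the Carleson embedding. -/
noncomputable def poissonBound (p : ℝ) (kx ky : ℝ≥0) : ℝ≥0∞ :=
  ((6 * kx + ky) * ENNReal.ofReal (2 ^ p / (p - 1))) ^ (1 / p)

variable {kx ky : ℝ≥0}

lemma poissonBound_ne_top (hp : 1 < p) : poissonBound p kx ky ≠ ∞ := by
  have hp0 : 0 < p := by linarith
  refine ENNReal.rpow_ne_top_of_nonneg (by positivity) ?_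
  finiteness

lemma eLpNorm_poissonInt_le (hp : 1 < p) (hμ : WellProjected upperHalf kx ky μ) {u : ℝ → ℂ}
    (hu : AEStronglyMeasurable u volume) :
    eLpNorm (poissonInt u) (ENNReal.ofReal p) μ
      ≤ poissonBound p kx ky * eLpNorm u (ENNReal.ofReal p) volume := by
  have hp0 : 0 < p := by linarith
  rw [poissonInt_congr_ae hu.ae_eq_mk, eLpNorm_congr_ae hu.ae_eq_mk]
  refine eLpNorm_le_mul_of_lintegral_le hp0 ?_
  rw [poissonBound, ← ENNReal.rpow_mul, one_div_mul_cancel hp0.ne', ENNReal.rpow_one]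
  simp_rw [enorm_rpow_eq_ofReal _ hp0.le]
  exact lintegral_poissonInt_rpow_le hμ hu.stronglyMeasurable_mk hp

lemma lpOpNorm_poissonInt_le (hp : 1 < p) (hμ : WellProjected upperHalf kx ky μ) :
    lpOpNorm poissonInt p μ ≤ poissonBound p kx ky :=
  lpOpNorm_le (poissonBound_ne_top hp) (fun _ hu => aestronglyMeasurable_poissonInt hu.1)
    fun _ hu => eLpNorm_poissonInt_le hp hμ hu.1

lemma K₃_le (hp : 1 < p) : K₃ p kx ky ≤ poissonBound p kx ky :=
  iSup₂_le fun _ hμ => lpOpNorm_poissonInt_le hp hμ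

/-- The traces `u ↦ S_y * u` of the Cauchy integral on horizontal lines are bounded on `L^p`. -/
lemma eLpNorm_cauchyInt_line_le (hp : 1 < p) {u : ℝ → ℂ} (hu : Continuous u)
    (hc : HasCompactSupport u) {y : ℝ} (hy : 0 < y) :
    eLpNorm (fun x : ℝ => cauchyInt u (x + y * Complex.I)) (ENNReal.ofReal p) volume
      ≤ ENNReal.ofReal (1 + pichoridesNorm p) * eLpNorm u (ENNReal.ofReal p) volume := by
  have hup : MemLp u (ENNReal.ofReal p) volume := hu.memLp_of_hasCompactSupport hc
  have h1 := memLp_poissonInt_line hp hup hu.stronglyMeasurable hy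
  have h2 := memLp_conjPoissonInt hp hu hc hy
  have e : (fun x : ℝ => cauchyInt u (x + y * Complex.I))
      = (fun x : ℝ => poissonInt u (x + y * Complex.I)) + Complex.I • conjPoissonInt u y :=
    funext fun x => cauchyInt_line_eq hp hup hy x
  rw [e]
  refine (eLpNorm_add_le h1.1.1 (h2.1.const_smul _) (by simpa using hp.le)).trans ?_
  rw [eLpNorm_const_smul, ENNReal.ofReal_add zero_le_one (pichoridesNorm_nonneg hp), add_mul,
    ENNReal.ofReal_one, one_mul]
  have hI : ‖Complex.I‖ₑ = 1 := by rw [← ofReal_norm, Complex.norm_I, ENNReal.ofReal_one]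
  rw [hI, one_mul]
  exact add_le_add h1.2 (eLpNorm_conjPoissonInt_le hp hup hy)

/-- The Cauchy integral is, up to a vertical translation that is removed by Fatou's lemma, the
Poisson integral of its trace on a horizontal line. -/
lemma eLpNorm_cauchyInt_le_of_hasCompactSupport (hp : 1 < p)
    (hμ : WellProjected upperHalf kx ky μ) {u : ℝ → ℂ} (hu : Continuous u)
    (hc : HasCompactSupport u) : eLpNorm (cauchyInt u) (ENNReal.ofReal p) μ ≤
      lpOpNorm poissonInt p μ * ENNReal.ofReal (1 + pichoridesNorm p)
        * eLpNorm u (ENNReal.ofReal p) volume := by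
  have hH : ∀ᵐ z ∂μ, z ∈ upperHalf := by
    rw [ae_iff]; exact hμ.compl_null
  have hui : Integrable u volume := hu.integrable_of_hasCompactSupport hc
  set ε : ℕ → ℝ := fun n => 1 / ((n : ℝ) + 1) with hε
  have hε0 : ∀ n, 0 < ε n := fun n => Nat.one_div_pos_of_nat
  have hεlim : Filter.Tendsto ε Filter.atTop (nhds 0) := tendsto_one_div_add_atTop_nhds_zero_nat
  have hm : ∀ n, AEStronglyMeasurable (fun z : ℂ => cauchyInt u (z + ε n * Complex.I)) μ :=
    fun n => ((stronglyMeasurable_cauchyInt hu.stronglyMeasurable).comp_measurable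
      (measurable_id.add_const _)).aestronglyMeasurable
  have hlim : ∀ᵐ z ∂μ, Filter.Tendsto (fun n => cauchyInt u (z + ε n * Complex.I)) Filter.atTop
      (nhds (cauchyInt u z)) := by
    filter_upwards [hH] with z hz
    have h1 : ContinuousAt (cauchyInt u) z := (hasDerivAt_cauchyInt hui hz).continuousAt
    refine h1.tendsto.comp ?_
    have h2 := (Complex.continuous_ofReal.tendsto 0).comp hεlim
    simpa using (h2.mul_const Complex.I).const_add z
  have hbound : ∀ n, eLpNorm (fun z : ℂ => cauchyInt u (z + ε n * Complex.I))
      (ENNReal.ofReal p) μ ≤ lpOpNorm poissonInt p μ * ENNReal.ofReal (1 + pichoridesNorm p)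
        * eLpNorm u (ENNReal.ofReal p) volume := by
    intro n
    rw [eLpNorm_congr_ae (hH.mono fun z hz => cauchyInt_add_eq_poissonInt hui hz (hε0 n))]
    refine (eLpNorm_le_lpOpNorm_mul
      ((lpOpNorm_poissonInt_le hp hμ).trans_lt (poissonBound_ne_top hp).lt_top).ne
      (memLp_cauchyInt_line hp hu hc (hε0 n))).2.trans ?_
    rw [mul_assoc]
    gcongr
    exact eLpNorm_cauchyInt_line_le hp hu hc (hε0 n)
  exact (Lp.eLpNorm_lim_le_liminf_eLpNorm hm _ hlim).trans
    ((Filter.liminf_le_liminf (Filter.Eventually.of_forall hbound)).trans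
      tendsto_const_nhds.liminf_eq.le)

lemma lpOpNorm_poissonInt_mul_ne_top (hp : 1 < p) (hμ : WellProjected upperHalf kx ky μ) :
    lpOpNorm poissonInt p μ * ENNReal.ofReal (1 + pichoridesNorm p) ≠ ∞ :=
  ENNReal.mul_ne_top
    ((lpOpNorm_poissonInt_le hp hμ).trans_lt (poissonBound_ne_top hp).lt_top).ne
    ENNReal.ofReal_ne_top

lemma lpOpNorm_cauchyInt_le (hp : 1 < p) (hμ : WellProjected upperHalf kx ky μ) :
    lpOpNorm cauchyInt p μ
      ≤ lpOpNorm poissonInt p μ * ENNReal.ofReal (1 + pichoridesNorm p) := by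
  have hA := lpOpNorm_poissonInt_mul_ne_top hp hμ
  have hpq := Real.HolderConjugate.conjExponent hp
  refine lpOpNorm_le hA (fun _ hu => aestronglyMeasurable_cauchyInt hu.1) fun u hu => ?_
  refine eLpNorm_le_of_hasCompactSupport hp.le hA (fun g hg hgc =>
    ⟨(stronglyMeasurable_cauchyInt hg.stronglyMeasurable).aestronglyMeasurable,
      eLpNorm_cauchyInt_le_of_hasCompactSupport hp hμ hg hgc⟩) hu fun g hg hlim => ?_
  have hH : ∀ᵐ z ∂μ, z ∈ upperHalf := by
    rw [ae_iff]; exact hμ.compl_null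
  filter_upwards [hH] with z hz
  exact tendsto_integral_mul_of_eLpNorm hpq (memLp_cauchyKernel_sub hz hpq.symm.lt z.re) hu hg hlim

lemma K₄_le (hp : 1 < p) :
    K₄ p kx ky ≤ K₃ p kx ky * ENNReal.ofReal (1 + pichoridesNorm p) :=
  iSup₂_le fun μ hμ => (lpOpNorm_cauchyInt_le hp hμ).trans
    (mul_le_mul_left (le_iSup₂ (f := fun (μ : Measure ℂ) (_ : WellProjected upperHalf kx ky μ) =>
      lpOpNorm poissonInt p μ) μ hμ) _)

lemma pichoridesNorm_two : pichoridesNorm 2 = 1 := by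
  have h : Real.conjExponent 2 = 2 := by norm_num [Real.conjExponent]
  rw [pichoridesNorm, h, max_self, ← div_eq_mul_inv, div_div,
    show (2 : ℝ) * 2 = 4 by norm_num, Real.tan_pi_div_four]

lemma K₄_two_le : K₄ 2 kx ky ≤ ENNReal.ofReal (4 * √(6 * (kx : ℝ) + ky)) := by
  have h1 := (K₄_le (kx := kx) (ky := ky) one_lt_two).trans (mul_le_mul_left (K₃_le one_lt_two) _)
  refine h1.trans (le_of_eq ?_)
  have h2 : (6 * kx + ky : ℝ≥0∞) = ENNReal.ofReal (6 * (kx : ℝ) + ky) := by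
    rw [ENNReal.ofReal_add (by positivity) (by positivity), ENNReal.ofReal_mul (by norm_num)]
    simp
  have h0 : (0 : ℝ) ≤ 6 * kx + ky := by positivity
  rw [pichoridesNorm_two, poissonBound, h2, ← ENNReal.ofReal_mul h0,
    ENNReal.ofReal_rpow_of_nonneg (by positivity) (by norm_num),
    ← ENNReal.ofReal_mul (by positivity), ← Real.sqrt_eq_rpow]
  congr 1
  rw [show (2 : ℝ) ^ (2 : ℝ) / (2 - 1) = 2 ^ 2 by norm_num, Real.sqrt_mul h0,
    Real.sqrt_sq (by norm_num)]
  ring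

lemma cauchyInt_add (hp : 1 < p) {u v : ℝ → ℂ} (hu : MemLp u (ENNReal.ofReal p) volume)
    (hv : MemLp v (ENNReal.ofReal p) volume) {z : ℂ} (hz : z ∈ upperHalf) :
    cauchyInt (u + v) z = cauchyInt u z + cauchyInt v z := by
  rw [cauchyInt, cauchyInt, cauchyInt, ← integral_add (integrable_cauchyKernel_mul hp hu hz _)
    (integrable_cauchyKernel_mul hp hv hz _)]
  simp only [Pi.add_apply, mul_add]

lemma cauchyInt_smul (c : ℂ) (u : ℝ → ℂ) (z : ℂ) : cauchyInt (c • u) z = c * cauchyInt u z := by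
  rw [cauchyInt, cauchyInt, ← integral_const_mul]
  simp only [Pi.smul_apply, smul_eq_mul, mul_left_comm]

/-- An operator with finite norm in the sense of `lpOpNorm` is a continuous linear map between
`L^p` spaces of the same norm. -/
lemma exists_continuousLinearMap [Fact (1 ≤ ENNReal.ofReal p)] (hp : 1 < p)
    (hμ : WellProjected upperHalf kx ky μ) :
    ∃ T : Lp ℂ (ENNReal.ofReal p) (volume : Measure ℝ) →L[ℂ] Lp ℂ (ENNReal.ofReal p) μ,
      (∀ u : Lp ℂ (ENNReal.ofReal p) (volume : Measure ℝ), T u =ᵐ[μ] cauchyInt u) ∧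
        ‖T‖ₑ = lpOpNorm cauchyInt p μ := by
  have hH : ∀ᵐ z ∂μ, z ∈ upperHalf := by
    rw [ae_iff]; exact hμ.compl_null
  have hfin : lpOpNorm cauchyInt p μ ≠ ∞ := ((lpOpNorm_cauchyInt_le hp hμ).trans_lt
    (lpOpNorm_poissonInt_mul_ne_top hp hμ).lt_top).ne
  have hmem : ∀ u : Lp ℂ (ENNReal.ofReal p) (volume : Measure ℝ),
      MemLp (cauchyInt u) (ENNReal.ofReal p) μ := fun u =>
    (eLpNorm_le_lpOpNorm_mul hfin (Lp.memLp u)).1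
  set L : Lp ℂ (ENNReal.ofReal p) (volume : Measure ℝ) →ₗ[ℂ] Lp ℂ (ENNReal.ofReal p) μ :=
    { toFun := fun u => (hmem u).toLp _
      map_add' := fun u v => by
        rw [← MemLp.toLp_add, MemLp.toLp_eq_toLp_iff, cauchyInt_congr_ae (Lp.coeFn_add u v)]
        exact hH.mono fun z hz => cauchyInt_add hp (Lp.memLp u) (Lp.memLp v) hz
      map_smul' := fun c u => by
        rw [RingHom.id_apply, ← MemLp.toLp_const_smul, MemLp.toLp_eq_toLp_iff,
          cauchyInt_congr_ae (Lp.coeFn_smul c u)]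
        exact Filter.Eventually.of_forall fun z => cauchyInt_smul c u z } with hL
  have hLnorm : ∀ u, ‖L u‖ₑ ≤ lpOpNorm cauchyInt p μ * ‖u‖ₑ := fun u => by
    have h1 : ‖L u‖ₑ = eLpNorm (cauchyInt u) (ENNReal.ofReal p) μ := Lp.enorm_toLp (hmem _)
    rw [h1, Lp.enorm_def]
    exact (eLpNorm_le_lpOpNorm_mul hfin (Lp.memLp u)).2
  have hbound : ∀ u, ‖L u‖ ≤ (lpOpNorm cauchyInt p μ).toReal * ‖u‖ := fun u => by
    have h1 := ENNReal.toReal_mono (ENNReal.mul_ne_top hfin enorm_ne_top) (hLnorm u)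
    rwa [ENNReal.toReal_mul, toReal_enorm, toReal_enorm] at h1
  refine ⟨L.mkContinuous _ hbound, fun u => (hmem u).coeFn_toLp, le_antisymm ?_ ?_⟩
  · rw [← ofReal_norm]
    exact ENNReal.ofReal_le_of_le_toReal
      (L.mkContinuous_norm_le ENNReal.toReal_nonneg hbound)
  · refine lpOpNorm_le enorm_ne_top (fun _ hu => aestronglyMeasurable_cauchyInt hu.1) fun u hu => ?_
    have h1 := (L.mkContinuous _ hbound).le_opENorm (hu.toLp u)
    have h2 : ‖L.mkContinuous _ hbound (hu.toLp u)‖ₑ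
        = eLpNorm (cauchyInt (hu.toLp u)) (ENNReal.ofReal p) μ := Lp.enorm_toLp (hmem _)
    rwa [h2, Lp.enorm_toLp, cauchyInt_congr_ae hu.coeFn_toLp] at h1

end OpNorm

theorem theorem2 (p : ℝ) (hp : 1 < p) [Fact (1 ≤ ENNReal.ofReal p)] (kx ky : ℝ≥0) :
    -- the Cauchy integral of an `L^p` function is defined at every point of the half-plane
    (∀ u : ℝ → ℂ, MemLp u (ENNReal.ofReal p) volume → ∀ z ∈ upperHalf,
      Integrable (fun t : ℝ => cauchyKernel (z.re - t) z.im * u t) volume) ∧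
    -- it is a bounded linear operator from `L^p(ℝ)` to `L^p(μ)`
    (∀ μ : Measure ℂ, WellProjected upperHalf kx ky μ →
      ∃ T : Lp ℂ (ENNReal.ofReal p) (volume : Measure ℝ) →L[ℂ] Lp ℂ (ENNReal.ofReal p) μ,
        (∀ u : Lp ℂ (ENNReal.ofReal p) (volume : Measure ℝ), T u =ᵐ[μ] cauchyInt u) ∧
          ‖T‖ₑ = lpOpNorm cauchyInt p μ) ∧
    -- with uniform norm bounds
    K₄ p kx ky < ∞ ∧
    K₄ p kx ky ≤ K₃ p kx ky *
      ENNReal.ofReal (1 + Real.tan (Real.pi / 2 * max p⁻¹ (Real.conjExponent p)⁻¹)) ∧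
    K₄ 2 kx ky ≤ ENNReal.ofReal (4 * Real.sqrt (6 * (kx : ℝ) + (ky : ℝ))) := by
  refine ⟨fun u hu z hz => integrable_cauchyKernel_mul hp hu hz z.re,
    fun μ hμ => exists_continuousLinearMap hp hμ, ?_, K₄_le hp, K₄_two_le⟩
  refine (K₄_le hp).trans_lt (ENNReal.mul_lt_top ?_ ENNReal.ofReal_lt_top)
  exact (K₃_le hp).trans_lt (poissonBound_ne_top hp).lt_top
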